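/- **Setting.** Let $M$ be a smooth oriented four-dimensional manifold with a smooth Lorentzian metric $g_{ab}$ of signature $(-,+,+,+)$; $;$ is its Levi-Civita derivative, $R_{ab}$ its Ricci tensor, and $\eta^{abcd}=\eta^{[abcd]}$, $\eta^{0123}=(-\det g)^{-1/2}$ in positively oriented charts. An *electromagnetic string fluid (EMSF) spacetime* consists of $(M,g)$, a smooth four-velocity $u^a$ ($u_au^a=-1$), a smooth nowhere vanishing magnetic field $H^a$ with $H_au^a=0$, a current $J^a$, smooth functions $\rho$ (energy density) and $p_\perp$ (transverse pressure), and constants $\lambda,\Lambda$, such that, with $H=(H_aH^a)^{1/2}$, $n^a=H^a/H$, $h_{ab}=g_{ab}+u_au_b$, $p_{ab}=h_{ab}-n_an_b$ and $F^{ab}=\eta^{abcd}H_cu_d$, $$F_{[ab;c]}=0,\qquad F^{ab}{}_{;b}=J^a,\qquad R_{ab}=T_{ab}+\left(\Lambda-\tfrac12T^c{}_c\right)g_{ab},$$ $$T_{ab}=\left(\rho+\tfrac12\lambda H^2\right)(u_au_b-n_an_b)+\left(p_\perp+\tfrac12\lambda H^2\right)p_{ab}.$$ A dot is the covariant derivative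 along $u^a$, a star that along $n^a$. Put $\theta_{ab}=h_a^ch_b^du_{(c;d)}$, $\theta=h^{ab}u_{a;b}$, $\sigma_{ab}=\theta_{ab}-\frac13\theta h_{ab}$, $\omega^a=\frac12\eta^{abcd}u_{b;c}u_d$, $\mathcal E=p^{cd}n_{c;d}$, $\mathcal S_{ab}=(p_a^cp_b^d-\frac12p^{cd}p_{ab})n_{(c;d)}$, $\mathcal R_{ab}=p_a^cp_b^dn_{[c;d]}$, $\mathcal R^a=\frac12\eta^{abcd}\mathcal R_{bc}u_d$, $N_a=p_{ab}(\dot n^b-\overset{*}{u}{}^b)$, $e=-u^aJ_a$, $j^a=h^a_bJ^b$; for a function $\psi$ put $\gamma_\psi=\psi_{;ab}n^an^b$ and $\alpha_\psi=p^{ab}\psi_{;ab}$. **Proposition.** Let $\xi>0$ be a smooth function and $\psi$ a function on an EMSF spacetime. Then $\xi^a=\xi n^a$ is a conformal Killing vector with conformal factor $\psi$, i.e. $L_{\xi^a}g_{ab}=2\psi g_{ab}$, if and only if the following system holds: $$\dot\rho-(\rho+p_\perp)(\ln H)^{\cdot}=0,\qquad \overset{*}{\rho}-(\rho+p_\perp)(\ln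 H)^{*}=0,$$ $$p_a^b\left[\left(p_\perp+\tfrac12\lambda H^2-\Lambda\right)_{,b}+(\rho+p_\perp+\lambda H^2)(\dot u_b-\overset{*}{n}_b)\right]=0,$$ $$\psi_{;ab}=-\gamma_\psi(u_au_b-n_an_b)+\tfrac12\alpha_\psi p_{ab},$$ $$\left[\left(p_\perp+\tfrac12\lambda H^2-\Lambda\right)H\right]^{*}=-\frac{3H}{\xi}\alpha_\psi,\qquad \left(p_\perp+\tfrac12\lambda H^2-\Lambda\right)(\ln H)^{*}=-\frac2\xi(\gamma_\psi+\alpha_\psi),$$ $$\mathcal S_{ab}=0,\qquad \mathcal E=-(\ln H)^{*},$$ $$\dot n^a=-\tfrac12(\ln H)^{*}u^a+p^a_b\sigma^b_cn^c,\qquad \overset{*}{n}{}^a=(\ln\xi)^{*}n^a-(\ln\xi)^{,a},$$ $$N_a=0,\qquad \sigma_{ab}n^an^b-\tfrac23\theta=(\ln H)^{\cdot},\qquad e=2\omega^aH_a,\qquad \mathcal R^a=-\frac{j^bH_b}{2H^3}H^a,$$ $$\psi=\tfrac12\xi\,\mathcal E=\overset{*}{\xi}.$$ Furthermore, in this case the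 vorticity $\omega^a$ is at every point parallel to $H^a$ or zero, and $\psi=\frac12\xi\mathcal E=-\frac12\xi(\ln H)^{*}$. -/

import Mathlib

open scoped Manifold ContDiff

noncomputable section

namespace EMSF

/-! ### Tensor calculus in a coordinate chart

Coordinates take values in `R4`; tensor fields in a chart are given by their components. -/

/-- The coordinate space. -/
abbrev R4 : Type := EuclideanSpace ℝ (Fin 4)

/-- Components of a tensor field with one index. -/
abbrev Field1 : Type := R4 → Fin 4 → ℝ

/-- Components of a tensor field with two indices. -/
abbrev Field2 : Type := R4 → Fin 4 → Fin 4 → ℝ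

/-- The partial derivative `∂_a f`. -/
def pd (f : R4 → ℝ) (y : R4) (a : Fin 4) : ℝ :=
  fderiv ℝ f y (EuclideanSpace.single a (1 : ℝ))

/-- The inverse metric `g^{ab}`. -/
def inv (g : Field2) (y : R4) (a b : Fin 4) : ℝ := (Matrix.of (g y))⁻¹ a b

/-- Christoffel symbols `Γ^a_{bc}` of the metric `g`. -/
def christoffel (g : Field2) (y : R4) (a b c : Fin 4) : ℝ :=
  (1 / 2) * ∑ d, inv g y a d *
    (pd (fun z => g z d c) y b + pd (fun z => g z d b) y c - pd (fun z => g z b c) y d)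

/-- The Ricci tensor
`R_{ab} = ∂_c Γ^c_{ab} - ∂_b Γ^c_{ac} + Γ^c_{cd} Γ^d_{ab} - Γ^c_{bd} Γ^d_{ac}`. -/
def ricci (g : Field2) (y : R4) (a b : Fin 4) : ℝ :=
  ∑ c, (pd (fun z => christoffel g z c a b) y c - pd (fun z => christoffel g z c a c) y b)
  + ∑ c, ∑ d, (christoffel g y c c d * christoffel g y d a b
      - christoffel g y c b d * christoffel g y d a c)

/-- Lowering an index: `X_a = g_{ab} X^b`. -/
def lower (g : Field2) (X : Field1) (y : R4) (a : Fin 4) : ℝ := ∑ b, g y a b * X y b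

/-- Raising an index: `w^a = g^{ab} w_b`. -/
def raise (g : Field2) (w : Field1) (y : R4) (a : Fin 4) : ℝ := ∑ b, inv g y a b * w y b

/-- Lowering both indices: `F_{ab} = g_{ac} g_{bd} F^{cd}`. -/
def lower2 (g F : Field2) (y : R4) (a b : Fin 4) : ℝ :=
  ∑ c, ∑ d, g y a c * g y b d * F y c d

/-- The covariant derivative `w_{a;b}` of a covector field. -/
def covD (g : Field2) (w : Field1) (y : R4) (a b : Fin 4) : ℝ :=
  pd (fun z => w z a) y b - ∑ c, christoffel g y c a b * w y c

/-- The covariant derivative `F_{ab;c}` of a tensor field with two lower indices. -/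
def covD2 (g F : Field2) (y : R4) (a b c : Fin 4) : ℝ :=
  pd (fun z => F z a b) y c
    - ∑ d, (christoffel g y d a c * F y d b + christoffel g y d b c * F y a d)

/-- The divergence `F^{ab}_{;b}` of a tensor field with two upper indices. -/
def div2 (g F : Field2) (y : R4) (a : Fin 4) : ℝ :=
  ∑ b, (pd (fun z => F z a b) y b
    + ∑ d, (christoffel g y a d b * F y d b + christoffel g y b d b * F y a d))

/-- The second covariant derivative `f_{;ab}` of a scalar. -/
def hess (g : Field2) (f : R4 → ℝ) (y : R4) (a b : Fin 4) : ℝ :=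
  covD g (fun z c => pd f z c) y a b

/-- The Lie derivative `(L_X g)_{ab} = X^c ∂_c g_{ab} + g_{cb} ∂_a X^c + g_{ac} ∂_b X^c`. -/
def lieMetric (g : Field2) (X : Field1) (y : R4) (a b : Fin 4) : ℝ :=
  ∑ c, (X y c * pd (fun z => g z a b) y c
    + g y c b * pd (fun z => X z c) y a + g y a c * pd (fun z => X z c) y b)

/-- The permutation symbol, with value `1` at `(0,1,2,3)`. -/
def permSymbol (a b c d : Fin 4) : ℝ :=
  Matrix.det (fun i j : Fin 4 => if ![a, b, c, d] i = j then (1 : ℝ) else 0)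

/-- The alternating tensor: `η^{abcd} = η^{[abcd]}`, `η^{0123} = (-det g)^{-1/2}`
(in a positively oriented chart). -/
def eta (g : Field2) (y : R4) (a b c d : Fin 4) : ℝ :=
  (Real.sqrt (-(Matrix.of (g y)).det))⁻¹ * permSymbol a b c d

/-- The derivative `X(f) = f_{,a} X^a` of a scalar along a vector field. -/
def along (X : Field1) (f : R4 → ℝ) (y : R4) : ℝ := ∑ a, X y a * pd f y a

/-- The contraction `w_a X^a`. -/
def contract (w X : Field1) (y : R4) : ℝ := ∑ a, w y a * X y a

/-! ### The kinematic quantities of a double congruence -/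

/-- Components, in a chart, of a metric and of two vector fields `u^a`, `n^a`
(used with `u_a u^a = -1`, `n_a n^a = 1`, `u_a n^a = 0`). -/
structure Congruences where
  g : Field2
  u : Field1
  n : Field1

namespace Congruences

variable (C : Congruences)

/-- `u_a`. -/
def uL : Field1 := lower C.g C.u

/-- `n_a`. -/
def nL : Field1 := lower C.g C.n

/-- `u_{a;b}`. -/
def Du : Field2 := covD C.g C.uL

/-- `n_{a;b}`. -/
def Dn : Field2 := covD C.g C.nL

/-- `h_{ab} = g_{ab} + u_a u_b`. -/
def h (y : R4) (a b : Fin 4) : ℝ := C.g y a b + C.uL y a * C.uL y b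

/-- The mixed projector `h^a_b`. -/
def hMix (y : R4) (a b : Fin 4) : ℝ := (if a = b then 1 else 0) + C.u y a * C.uL y b

/-- `h^{ab}`. -/
def hUp (y : R4) (a b : Fin 4) : ℝ := inv C.g y a b + C.u y a * C.u y b

/-- The screen projector `p_{ab} = h_{ab} - n_a n_b`. -/
def p (y : R4) (a b : Fin 4) : ℝ := C.h y a b - C.nL y a * C.nL y b

/-- The mixed screen projector `p^a_b`. -/
def pMix (y : R4) (a b : Fin 4) : ℝ := C.hMix y a b - C.n y a * C.nL y b

/-- `p^{ab}`. -/
def pUp (y : R4) (a b : Fin 4) : ℝ := C.hUp y a b - C.n y a * C.n y b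

/-- The acceleration `u̇_a = u_{a;b} u^b`. -/
def uDot (y : R4) (a : Fin 4) : ℝ := ∑ b, C.Du y a b * C.u y b

/-- `u*_a = u_{a;b} n^b`. -/
def uStar (y : R4) (a : Fin 4) : ℝ := ∑ b, C.Du y a b * C.n y b

/-- `ṅ_a = n_{a;b} u^b`. -/
def nDot (y : R4) (a : Fin 4) : ℝ := ∑ b, C.Dn y a b * C.u y b

/-- `n*_a = n_{a;b} n^b`. -/
def nStar (y : R4) (a : Fin 4) : ℝ := ∑ b, C.Dn y a b * C.n y b

/-- The expansion `θ = h^{ab} u_{a;b}`. -/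
def theta (y : R4) : ℝ := ∑ a, ∑ b, C.hUp y a b * C.Du y a b

/-- `θ_{ab} = h_a^c h_b^d u_{(c;d)}`. -/
def thetaT (y : R4) (a b : Fin 4) : ℝ :=
  ∑ c, ∑ d, C.hMix y c a * C.hMix y d b * ((C.Du y c d + C.Du y d c) / 2)

/-- The shear `σ_{ab} = θ_{ab} - (1/3) θ h_{ab}`. -/
def sigma (y : R4) (a b : Fin 4) : ℝ := C.thetaT y a b - (1 / 3) * C.theta y * C.h y a b

/-- The vorticity vector `ω^a = (1/2) η^{abcd} u_{b;c} u_d`. -/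
def omega (y : R4) (a : Fin 4) : ℝ :=
  (1 / 2) * ∑ b, ∑ c, ∑ d, eta C.g y a b c d * C.Du y b c * C.uL y d

/-- The screen expansion `E = p^{cd} n_{c;d}`. -/
def screenExp (y : R4) : ℝ := ∑ c, ∑ d, C.pUp y c d * C.Dn y c d

/-- The screen shear `S_{ab} = (p_a^c p_b^d - (1/2) p^{cd} p_{ab}) n_{(c;d)}`. -/
def screenShear (y : R4) (a b : Fin 4) : ℝ :=
  ∑ c, ∑ d, (C.pMix y c a * C.pMix y d b - (1 / 2) * C.pUp y c d * C.p y a b)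
    * ((C.Dn y c d + C.Dn y d c) / 2)

/-- The screen rotation `R_{ab} = p_a^c p_b^d n_{[c;d]}`. -/
def screenRot (y : R4) (a b : Fin 4) : ℝ :=
  ∑ c, ∑ d, C.pMix y c a * C.pMix y d b * ((C.Dn y c d - C.Dn y d c) / 2)

/-- The screen rotation vector `R^a = (1/2) η^{abcd} R_{bc} u_d`. -/
def screenRotVec (y : R4) (a : Fin 4) : ℝ :=
  (1 / 2) * ∑ b, ∑ c, ∑ d, eta C.g y a b c d * C.screenRot y b c * C.uL y d

/-- The Greenberg vector `N_a = p_{ab} (ṅ^b - u*^b)`, with the contraction written as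
`p_a^b (ṅ_b - u*_b)`. -/
def greenberg (y : R4) (a : Fin 4) : ℝ :=
  ∑ b, C.pMix y b a * (C.nDot y b - C.uStar y b)

/-- `γ_f = f_{;ab} n^a n^b`. -/
def gammaOf (f : R4 → ℝ) (y : R4) : ℝ := ∑ a, ∑ b, hess C.g f y a b * C.n y a * C.n y b

/-- `α_f = p^{ab} f_{;ab}`. -/
def alphaOf (f : R4 → ℝ) (y : R4) : ℝ := ∑ a, ∑ b, C.pUp y a b * hess C.g f y a b

end Congruences

/-! ### Fields on a four-dimensional manifold and their components in charts -/

section Manifold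

variable {M : Type*} [TopologicalSpace M] [ChartedSpace R4 M]

/-- Components `X^a` of a vector field in the chart `e`. -/
def vecComp (e : OpenPartialHomeomorph M R4) (X : ∀ x : M, TangentSpace (𝓡 4) x) : Field1 :=
  fun y a =>
    (show R4 from mfderiv (𝓡 4) (𝓡 4) e (e.symm y) (X (e.symm y))) a

/-- The coordinate vector `∂_a` of the chart `e` at the point with coordinates `y`. -/
def coordVec (e : OpenPartialHomeomorph M R4) (y : R4) (a : Fin 4) :
    TangentSpace (𝓡 4) (e.symm y) :=
  mfderiv (𝓡 4) (𝓡 4) e.symm y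
    (show TangentSpace (𝓡 4) y from (EuclideanSpace.single a (1 : ℝ) : R4))

/-- Components `g_{ab} = g(∂_a, ∂_b)` in the chart `e`. -/
def metricComp (e : OpenPartialHomeomorph M R4)
    (g : ∀ x : M, LinearMap.BilinForm ℝ (TangentSpace (𝓡 4) x)) : Field2 :=
  fun y a b => g (e.symm y) (coordVec e y a) (coordVec e y b)

/-- A scalar in the chart `e`. -/
def scalComp (e : OpenPartialHomeomorph M R4) (f : M → ℝ) : R4 → ℝ := fun y => f (e.symm y)

variable (M) in
/-- An orientation, given by an atlas of (smooth) charts with positive transition Jacobians;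
its charts are called positively oriented. -/
structure OrientedAtlas where
  charts : Set (OpenPartialHomeomorph M R4)
  smooth : ∀ e ∈ charts, e ∈ IsManifold.maximalAtlas (𝓡 4) ∞ M
  cover : ∀ x : M, ∃ e ∈ charts, x ∈ e.source
  positive : ∀ e ∈ charts, ∀ e' ∈ charts, ∀ x ∈ e.source ∩ e'.source,
    0 < (fderiv ℝ (fun y => e' (e.symm y)) (e x)).det

/-- Smoothness of a scalar field. -/
def SmoothScalar (A : OrientedAtlas M) (f : M → ℝ) : Prop :=
  ∀ e ∈ A.charts, ContDiffOn ℝ ∞ (scalComp e f) e.target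

/-- Smoothness of a vector field. -/
def SmoothVec (A : OrientedAtlas M) (X : ∀ x : M, TangentSpace (𝓡 4) x) : Prop :=
  ∀ e ∈ A.charts, ∀ a, ContDiffOn ℝ ∞ (fun y => vecComp e X y a) e.target

/-- A smooth Lorentzian metric of signature `(-,+,+,+)`. -/
structure IsLorentzian (A : OrientedAtlas M)
    (g : ∀ x : M, LinearMap.BilinForm ℝ (TangentSpace (𝓡 4) x)) : Prop where
  smooth : ∀ e ∈ A.charts, ∀ a b, ContDiffOn ℝ ∞ (fun y => metricComp e g y a b) e.target
  symm : ∀ (x : M) (v w : TangentSpace (𝓡 4) x), g x v w = g x w v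
  signature : ∀ x : M, ∃ b : Module.Basis (Fin 4) ℝ (TangentSpace (𝓡 4) x),
    ∀ i j, g x (b i) (b j) = if i = j then (if i = 0 then -1 else 1) else 0

/-- The vector field `X` is a conformal Killing vector of `g` with conformal factor `ψ`:
`L_X g = 2 ψ g`. -/
def IsCKV (A : OrientedAtlas M) (g : ∀ x : M, LinearMap.BilinForm ℝ (TangentSpace (𝓡 4) x))
    (X : ∀ x : M, TangentSpace (𝓡 4) x) (ψ : M → ℝ) : Prop :=
  ∀ e ∈ A.charts, ∀ y ∈ e.target, ∀ a b,
    lieMetric (metricComp e g) (vecComp e X) y a b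
      = 2 * scalComp e ψ y * metricComp e g y a b

variable (M) in
/-- The fields of an electromagnetic string fluid: metric, four-velocity `u^a`, magnetic field
`H^a`, four-current `J^a`, energy density `ρ` and transverse pressure `p_⊥` of the fluid, the
constant `λ` of the electromagnetic energy-momentum tensor, the cosmological constant `Λ`. -/
structure Fluid where
  g : ∀ x : M, LinearMap.BilinForm ℝ (TangentSpace (𝓡 4) x)
  u : ∀ x : M, TangentSpace (𝓡 4) x
  Hvec : ∀ x : M, TangentSpace (𝓡 4) x
  J : ∀ x : M, TangentSpace (𝓡 4) x
  rho : M → ℝ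
  pPerp : M → ℝ
  lam : ℝ
  Lam : ℝ

namespace Fluid

variable (S : Fluid M)

/-- The magnetic field strength `H = (H_a H^a)^{1/2}`. -/
def H (x : M) : ℝ := Real.sqrt (S.g x (S.Hvec x) (S.Hvec x))

/-- The unit vector `n^a = H^a / H`. -/
def n (x : M) : TangentSpace (𝓡 4) x := (S.H x)⁻¹ • S.Hvec x

/-- The double congruence `(u^a, n^a)` in the chart `e`. -/
def congr (e : OpenPartialHomeomorph M R4) : Congruences where
  g := metricComp e S.g
  u := vecComp e S.u
  n := vecComp e S.n

/-- The electromagnetic field tensor with vanishing electric field,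
`F^{ab} = η^{abcd} H_c u_d`, in the chart `e`. -/
def F (e : OpenPartialHomeomorph M R4) : Field2 := fun y a b =>
  ∑ c, ∑ d, eta (metricComp e S.g) y a b c d
    * lower (metricComp e S.g) (vecComp e S.Hvec) y c
    * lower (metricComp e S.g) (vecComp e S.u) y d

/-- `μ_tot = ρ + λ H² / 2`, as a scalar on the manifold. -/
def muTot (x : M) : ℝ := S.rho x + (1 / 2) * S.lam * S.H x ^ 2

/-- `q = p_⊥ + λ H² / 2`. -/
def q (x : M) : ℝ := S.pPerp x + (1 / 2) * S.lam * S.H x ^ 2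

/-- The energy-momentum tensor
`T_{ab} = (ρ + λH²/2) u_a u_b - (ρ + λH²/2) n_a n_b + (p_⊥ + λH²/2) p_{ab}`
in the chart `e`. -/
def T (e : OpenPartialHomeomorph M R4) : Field2 := fun y a b =>
  scalComp e S.muTot y * (S.congr e).uL y a * (S.congr e).uL y b
    - scalComp e S.muTot y * (S.congr e).nL y a * (S.congr e).nL y b
    + scalComp e S.q y * (S.congr e).p y a b

/-- The fields form an electromagnetic string fluid spacetime: `g` is Lorentzian, `u^a` is unit
timelike, `H^a` is nowhere zero and orthogonal to `u^a`, and Maxwell's equations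
`F_{[ab;c]} = 0`, `F^{ab}_{;b} = J^a` and Einstein's equations
`R_{ab} = T_{ab} + (Λ - T/2) g_{ab}` hold. -/
structure IsEMSF (A : OrientedAtlas M) : Prop where
  lorentzian : IsLorentzian A S.g
  smooth_u : SmoothVec A S.u
  smooth_H : SmoothVec A S.Hvec
  smooth_J : SmoothVec A S.J
  smooth_rho : SmoothScalar A S.rho
  smooth_pPerp : SmoothScalar A S.pPerp
  unit_u : ∀ x, S.g x (S.u x) (S.u x) = -1
  ortho : ∀ x, S.g x (S.Hvec x) (S.u x) = 0
  H_ne_zero : ∀ x, S.Hvec x ≠ 0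
  maxwell_hom : ∀ e ∈ A.charts, ∀ y ∈ e.target, ∀ a b c,
    covD2 (metricComp e S.g) (lower2 (metricComp e S.g) (S.F e)) y a b c
      + covD2 (metricComp e S.g) (lower2 (metricComp e S.g) (S.F e)) y b c a
      + covD2 (metricComp e S.g) (lower2 (metricComp e S.g) (S.F e)) y c a b = 0
  maxwell_inhom : ∀ e ∈ A.charts, ∀ y ∈ e.target, ∀ a,
    div2 (metricComp e S.g) (S.F e) y a = vecComp e S.J y a
  einstein : ∀ e ∈ A.charts, ∀ y ∈ e.target, ∀ a b,
    ricci (metricComp e S.g) y a b = S.T e y a b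
      + (S.Lam - (1 / 2) * ∑ c, ∑ d, inv (metricComp e S.g) y c d * S.T e y c d)
        * metricComp e S.g y a b

/-- The charge density `e = -u^a J_a` in the chart `e`. -/
def charge (e : OpenPartialHomeomorph M R4) (y : R4) : ℝ :=
  -contract (S.congr e).uL (vecComp e S.J) y

/-- The conduction current `j^a = h^a_b J^b` in the chart `e`. -/
def current (e : OpenPartialHomeomorph M R4) : Field1 := fun y a =>
  ∑ b, (S.congr e).hMix y a b * vecComp e S.J y b

/-- The magnetic field covector `H_a` in the chart `e`. -/
def HL (e : OpenPartialHomeomorph M R4) : Field1 :=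
  lower (metricComp e S.g) (vecComp e S.Hvec)

/-- `ln H` in the chart `e`. -/
def lnH (e : OpenPartialHomeomorph M R4) : R4 → ℝ :=
  scalComp e (fun x => Real.log (S.H x))

/-- The system of equations for `ξ` and `ψ`, at the point with coordinates `y` in the chart `e`.
Here `C` is the double congruence, a dot is the derivative along `u^a`, a star that
along `n^a`. -/
structure SystemAt (ξ ψ : M → ℝ) (e : OpenPartialHomeomorph M R4) (C : Congruences) (y : R4) :
    Prop where
  /-- `ρ̇ - (ρ + p_⊥) (ln H)˙ = 0` -/
  energy_dot : along C.u (scalComp e S.rho) y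
    - (scalComp e S.rho y + scalComp e S.pPerp y) * along C.u (S.lnH e) y = 0
  /-- `ρ* - (ρ + p_⊥) (ln H)* = 0` -/
  energy_star : along C.n (scalComp e S.rho) y
    - (scalComp e S.rho y + scalComp e S.pPerp y) * along C.n (S.lnH e) y = 0
  /-- `p_a^b [ (p_⊥ + λH²/2 - Λ)_{,b} + (ρ + p_⊥ + λH²) (u̇_b - n*_b) ] = 0` -/
  momentum : ∀ a, ∑ b, C.pMix y b a * (pd (scalComp e (fun x => S.q x - S.Lam)) y b
    + (scalComp e S.rho y + scalComp e S.pPerp y + S.lam * scalComp e S.H y ^ 2)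
      * (C.uDot y b - C.nStar y b)) = 0
  /-- `ψ_{;ab} = -γ_ψ (u_a u_b - n_a n_b) + (1/2) α_ψ p_{ab}` -/
  hessian : ∀ a b, hess C.g (scalComp e ψ) y a b
    = -C.gammaOf (scalComp e ψ) y * (C.uL y a * C.uL y b - C.nL y a * C.nL y b)
      + (1 / 2) * C.alphaOf (scalComp e ψ) y * C.p y a b
  /-- `[ (p_⊥ + λH²/2 - Λ) H ]* = -(3 H / ξ) α_ψ` -/
  field_one : along C.n (scalComp e (fun x => (S.q x - S.Lam) * S.H x)) y
    = -(3 * scalComp e S.H y / scalComp e ξ y) * C.alphaOf (scalComp e ψ) y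
  /-- `(p_⊥ + λH²/2 - Λ) (ln H)* = -(2 / ξ) (γ_ψ + α_ψ)` -/
  field_two : scalComp e (fun x => S.q x - S.Lam) y * along C.n (S.lnH e) y
    = -(2 / scalComp e ξ y)
      * (C.gammaOf (scalComp e ψ) y + C.alphaOf (scalComp e ψ) y)
  /-- `S_{ab} = 0` -/
  shear : ∀ a b, C.screenShear y a b = 0
  /-- `E = -(ln H)*` -/
  expansion : C.screenExp y = -along C.n (S.lnH e) y
  /-- `ṅ^a = -(1/2) (ln H)* u^a + p^a_b σ^b_c n^c` -/
  n_dot : ∀ a, raise C.g C.nDot y a = -(1 / 2) * along C.n (S.lnH e) y * C.u y a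
    + ∑ b, C.pMix y a b * raise C.g (fun z d => ∑ c, C.sigma z d c * C.n z c) y b
  /-- `n*^a = (ln ξ)* n^a - (ln ξ)^{,a}` -/
  n_star : ∀ a, raise C.g C.nStar y a
    = along C.n (scalComp e (fun x => Real.log (ξ x))) y * C.n y a
      - raise C.g (pd (scalComp e (fun x => Real.log (ξ x)))) y a
  /-- `N_a = 0` -/
  greenberg : ∀ a, C.greenberg y a = 0
  /-- `σ_{ab} n^a n^b - (2/3) θ = (ln H)˙` -/
  shear_nn : ∑ a, ∑ b, C.sigma y a b * C.n y a * C.n y b - (2 / 3) * C.theta y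
    = along C.u (S.lnH e) y
  /-- `e = 2 ω^a H_a` -/
  charge_eq : S.charge e y = 2 * contract (S.HL e) C.omega y
  /-- `R^a = -(j^b H_b / (2 H³)) H^a` -/
  rotation : ∀ a, C.screenRotVec y a
    = -(contract (S.HL e) (S.current e) y / (2 * scalComp e S.H y ^ 3))
      * vecComp e S.Hvec y a
  /-- `ψ = (1/2) ξ E` -/
  factor_exp : scalComp e ψ y = (1 / 2) * scalComp e ξ y * C.screenExp y
  /-- `ψ = ξ*` -/
  factor_star : scalComp e ψ y = along C.n (scalComp e ξ) y

/-- The system of equations holds everywhere. -/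
def System (A : OrientedAtlas M) (ξ ψ : M → ℝ) : Prop :=
  ∀ e ∈ A.charts, ∀ y ∈ e.target, S.SystemAt ξ ψ e (S.congr e) y

/-- At every point `ω^a` is a multiple of `H^a`: it is parallel to `H^a` or vanishes. -/
def VorticityParallel (A : OrientedAtlas M) : Prop :=
  ∀ e ∈ A.charts, ∀ y ∈ e.target, ∃ c : ℝ, ∀ a,
    (S.congr e).omega y a = c * vecComp e S.Hvec y a

/-- `ψ = (1/2) ξ E = -(1/2) ξ (ln H)*`. -/
def FactorFormula (A : OrientedAtlas M) (ξ ψ : M → ℝ) : Prop :=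
  ∀ e ∈ A.charts, ∀ y ∈ e.target,
    scalComp e ψ y = (1 / 2) * scalComp e ξ y * (S.congr e).screenExp y ∧
    scalComp e ψ y
      = -(1 / 2) * scalComp e ξ y * along (S.congr e).n (S.lnH e) y

end Fluid

end Manifold

end EMSF

end

/-! The kinematic half is linear algebra at a point. Split the conformal Killing equation of ξn^a
along u^a, n^a and the screen. Its nn component is ψ = ξ*, the trace less the uu and nn components
is ψ = ½ξE, the trace-free screen part is S_ab = 0, and contraction with n^b gives n*^a. The
homogeneous Maxwell equations say (H^a u^b − u^a H^b)_{;b} = 0, and their u, n and screen components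
are E = −(ln H)*, σ_ab n^a n^b − ⅔θ = (ln H)˙ and N_a = 0. Combined with the mixed u component of
the Killing equation they make u*_a + u^c n_{c;a} a multiple of u_a (`curl_of_conformal`). This
yields the formula for ṅ^a, L u_a = ψ u_a, and a vorticity along H^a. Since u_a and H_a are both
annihilated by F^{ab}, contracting F^{ab}_{;b} = J^a with them gives the equations for e and R^a.
Conversely, the kinematic equations of the system reassemble every component of the Killing equation
(`conformal_of_system`).

For the dynamical half, put P = p_⊥ + ½λH² − Λ, Q = ρ + ½λH² + Λ and W = P + Q. Einstein's equations
become R_ab = W(u_a u_b − n_a n_b) + Q g_ab. The contracted Bianchi identity (`Geom.conservation`)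
then gives, with the help of Maxwell's equations, Q˙ = W(ln H)˙ and Q* = W(ln H)*, and its screen
part is the momentum equation. A conformal Killing vector satisfies L R_ab = −2ψ_{;ab} − g_ab □ψ
(`lie2_ric_of_conformal`). Both u_a and n_a scale by ψ under L, so the other side is ξP*(u_a u_b −
n_a n_b) + ξP(ln H)* g_ab (`lie_ric`). Traces and components of this single tensor equation are the
Hessian equation and the two field equations.

Identities that involve derivatives are proved over an abstract ring with four commuting derivations
(`Geom`), where they are polynomial identities. The smooth functions on a chart domain form such a
ring, and evaluation at points returns the coordinate expressions. -/

noncomputable section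

namespace EMSF

/-! ### The ring of smooth functions on an open set of the coordinate space -/

/-- The algebra of smooth functions on an open set. -/
def smoothFn (U : TopologicalSpace.Opens R4) : Subalgebra ℝ (U → ℝ) where
  -- Elements are functions on `U` itself, so equality in the ring is equality on `U`; the witness
  -- `F` may be arbitrary outside `U`.
  carrier := {f | ∃ F : R4 → ℝ, ContDiffOn ℝ ∞ F U ∧ ∀ y : U, f y = F y}
  mul_mem' := by
    rintro f g ⟨F, hF, hf⟩ ⟨G, hG, hg⟩
    exact ⟨fun y => F y * G y, hF.mul hG, fun y => by simp [hf, hg]⟩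
  add_mem' := by
    rintro f g ⟨F, hF, hf⟩ ⟨G, hG, hg⟩
    exact ⟨fun y => F y + G y, hF.add hG, fun y => by simp [hf, hg]⟩
  algebraMap_mem' r := ⟨fun _ => r, contDiffOn_const, fun _ => rfl⟩

namespace smoothFn

variable {U : TopologicalSpace.Opens R4}

/-- The smooth function on `U` given by a function on the coordinate space. -/
def of (F : R4 → ℝ) (hF : ContDiffOn ℝ ∞ F U) : smoothFn U := ⟨fun y => F y, F, hF, fun _ => rfl⟩

/-- A function on the coordinate space that extends a smooth function on `U`. -/
def extend (f : smoothFn U) : R4 → ℝ := f.2.choose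

lemma contDiffOn_extend (f : smoothFn U) : ContDiffOn ℝ ∞ (extend f) U := f.2.choose_spec.1

lemma extend_apply (f : smoothFn U) (y : U) : extend f y = f.1 y := (f.2.choose_spec.2 y).symm

/-- Evaluation at a point. -/
def eval (y : U) : smoothFn U →+* ℝ := (Pi.evalRingHom (fun _ : U => ℝ) y).comp (smoothFn U).val

lemma eval_apply (y : U) (f : smoothFn U) : eval y f = f.1 y := rfl

lemma ext_eval {f g : smoothFn U} (h : ∀ y, eval y f = eval y g) : f = g :=
  Subtype.ext (funext h)

@[simp] lemma eval_of (y : U) (F : R4 → ℝ) (hF : ContDiffOn ℝ ∞ F U) : eval y (of F hF) = F y := rfl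

@[simp] lemma eval_smul (y : U) (r : ℝ) (f : smoothFn U) : eval y (r • f) = r * eval y f := rfl

/-- A derivative at a point of an open set depends only on values in that set, so the choice made in
`extend` is harmless. -/
lemma pd_congr {F G : R4 → ℝ} (h : ∀ z ∈ U, F z = G z) {y : R4} (hy : y ∈ U) (a : Fin 4) :
    pd F y a = pd G y a := by
  have : F =ᶠ[nhds y] G := by
    filter_upwards [U.2.mem_nhds hy] with z hz using h z hz
  rw [pd, pd, this.fderiv_eq]

lemma differentiableAt {F : R4 → ℝ} (hF : ContDiffOn ℝ ∞ F U) {y : R4} (hy : y ∈ U) :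
    DifferentiableAt ℝ F y :=
  (hF.contDiffAt (U.2.mem_nhds hy)).differentiableAt (by simp)

lemma contDiffOn_pd {F : R4 → ℝ} (hF : ContDiffOn ℝ ∞ F U) (a : Fin 4) :
    ContDiffOn ℝ ∞ (fun y => pd F y a) U :=
  (hF.fderiv_of_isOpen U.2 (by simp)).clm_apply contDiffOn_const

/-- The partial derivative as a map of smooth functions. -/
def partialFn (a : Fin 4) (f : smoothFn U) : smoothFn U :=
  of (fun y => pd (extend f) y a) (contDiffOn_pd (contDiffOn_extend f) a)

/-- Any function that represents `f` on `U` may be used to compute its derivative; all later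
translations to coordinate expressions rest on this. -/
lemma eval_partialFn {f : smoothFn U} {F : R4 → ℝ} (h : ∀ y : U, eval y f = F y) (y : U)
    (a : Fin 4) : eval y (partialFn a f) = pd F y a :=
  pd_congr (fun z hz => (extend_apply f ⟨z, hz⟩).trans (h ⟨z, hz⟩)) y.2 a

variable (U) in
/-- The partial derivative as a derivation. -/
def partialDer (a : Fin 4) : Derivation ℝ (smoothFn U) (smoothFn U) :=
  Derivation.mk'
    { toFun := partialFn a
      map_add' := fun f g => ext_eval fun y => by
        rw [eval_partialFn (F := fun z => extend f z + extend g z)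
          (fun z => by rw [map_add, extend_apply, extend_apply]; rfl), map_add]
        simp only [partialFn, eval_of, pd]
        rw [fderiv_fun_add (differentiableAt (contDiffOn_extend f) y.2)
          (differentiableAt (contDiffOn_extend g) y.2)]
        rfl
      map_smul' := fun r f => ext_eval fun y => by
        rw [eval_partialFn (F := fun z => r * extend f z)
          (fun z => by rw [eval_smul, extend_apply]; rfl), RingHom.id_apply, eval_smul]
        simp only [partialFn, eval_of, pd]
        rw [fderiv_const_mul (differentiableAt (contDiffOn_extend f) y.2)]
        rfl }
    fun f g => ext_eval fun y => by
      change eval y (partialFn a (f * g)) = eval y (f * partialFn a g + g * partialFn a f)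
      rw [eval_partialFn (F := fun z => extend f z * extend g z)
        (fun z => by rw [map_mul, extend_apply, extend_apply]; rfl), map_add, map_mul, map_mul]
      simp only [partialFn, eval_of, pd]
      rw [fderiv_fun_mul (differentiableAt (contDiffOn_extend f) y.2)
        (differentiableAt (contDiffOn_extend g) y.2)]
      simp only [_root_.add_apply, _root_.smul_apply, smul_eq_mul,
        extend_apply]
      rfl

lemma eval_partialDer {f : smoothFn U} {F : R4 → ℝ} (h : ∀ y : U, eval y f = F y) (y : U)
    (a : Fin 4) : eval y (partialDer U a f) = pd F y a := eval_partialFn h y a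

lemma partialDer_comm (a b : Fin 4) (f : smoothFn U) :
    partialDer U a (partialDer U b f) = partialDer U b (partialDer U a f) := by
  refine ext_eval fun y => ?_
  have h : ∀ z : U, eval z f = extend f z := fun z => (extend_apply f z).symm
  rw [eval_partialDer (F := fun z => pd (extend f) z b) (fun z => eval_partialDer h z b),
    eval_partialDer (F := fun z => pd (extend f) z a) (fun z => eval_partialDer h z a)]
  have hf := (contDiffOn_extend f).contDiffAt (U.2.mem_nhds y.2)
  have hs : IsSymmSndFDerivAt ℝ (extend f) (y : R4) := hf.isSymmSndFDerivAt (by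
    simpa using (WithTop.coe_le_coe.2 (le_top : (2 : ℕ∞) ≤ ⊤)))
  have hd : DifferentiableAt ℝ (fderiv ℝ (extend f)) (y : R4) :=
    ((hf.fderiv_right (m := ∞) (by simp)).differentiableAt (by simp))
  have key : ∀ c d : Fin 4, pd (fun z => pd (extend f) z c) y d =
      fderiv ℝ (fderiv ℝ (extend f)) y (EuclideanSpace.single d 1) (EuclideanSpace.single c 1) := by
    intro c d
    simp only [pd]
    rw [fderiv_clm_apply hd (differentiableAt_const _)]
    simp
  rw [key, key, hs.eq]

lemma isUnit_of_ne_zero {f : smoothFn U} (h : ∀ y, eval y f ≠ 0) : IsUnit f := by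
  refine IsUnit.of_mul_eq_one (of (fun y => (extend f y)⁻¹) ((contDiffOn_extend f).inv
    fun y hy => ?_)) (ext_eval fun y => ?_)
  · have := h ⟨y, hy⟩
    rwa [eval_apply, ← extend_apply] at this
  · have := h y
    rw [map_mul, map_one, eval_of, extend_apply]
    exact mul_inv_cancel₀ this

end smoothFn

/-! ### Geometry of a metric over a ring with four commuting derivations -/

/-- A metric `G` with inverse `I` and Levi-Civita connection `Γ` over a ring with commuting
derivations `D a`. -/
structure Geom (R : Type*) [CommRing R] [Algebra ℝ R] where
  D : Fin 4 → Derivation ℝ R R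
  G : Fin 4 → Fin 4 → R
  I : Fin 4 → Fin 4 → R
  Γ : Fin 4 → Fin 4 → Fin 4 → R
  comm : ∀ a b f, D a (D b f) = D b (D a f)
  G_symm : ∀ a b, G a b = G b a
  I_symm : ∀ a b, I a b = I b a
  inv : ∀ a b, ∑ c, G a c * I c b = if a = b then 1 else 0
  Γ_symm : ∀ a b c, Γ a b c = Γ a c b
  compat : ∀ a b c, D c (G a b) = ∑ d, (Γ d a c * G d b + Γ d b c * G a d)

namespace Geom

variable {R : Type*} [CommRing R] [Algebra ℝ R] (𝔤 : Geom R)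

/-- The Riemann tensor `R^a_{bcd}`. -/
def riem (a b c d : Fin 4) : R :=
  𝔤.D c (𝔤.Γ a d b) - 𝔤.D d (𝔤.Γ a c b)
    + ∑ e, (𝔤.Γ a c e * 𝔤.Γ e d b - 𝔤.Γ a d e * 𝔤.Γ e c b)

lemma riem_antisymm (a b c d : Fin 4) : 𝔤.riem a b c d = -𝔤.riem a b d c := by
  simp only [riem, Fin.sum_univ_four]
  ring

/-- This is dΩ + [Γ, Ω] = 0 for the curvature form. Connection terms on `e`, `c`, `d` would cancel
in the cyclic sum and are left out, so that only commutation of the derivations is needed. -/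
lemma bianchi (a b e c d : Fin 4) :
    (𝔤.D e (𝔤.riem a b c d)
        + ∑ f, (𝔤.Γ a e f * 𝔤.riem f b c d - 𝔤.Γ f e b * 𝔤.riem a f c d))
      + (𝔤.D c (𝔤.riem a b d e)
        + ∑ f, (𝔤.Γ a c f * 𝔤.riem f b d e - 𝔤.Γ f c b * 𝔤.riem a f d e))
      + (𝔤.D d (𝔤.riem a b e c)
        + ∑ f, (𝔤.Γ a d f * 𝔤.riem f b e c - 𝔤.Γ f d b * 𝔤.riem a f e c)) = 0 := by
  simp only [riem, Fin.sum_univ_four, map_add, map_sub, Derivation.leibniz, smul_eq_mul]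
  rw [𝔤.comm e c, 𝔤.comm d e, 𝔤.comm c d]
  ring

/-- Apply two commuting derivations to the metric and replace each derivative by connection terms,
using compatibility twice. -/
lemma riem_lower_antisymm (a b c d : Fin 4) :
    ∑ e, (𝔤.G a e * 𝔤.riem e b c d + 𝔤.G b e * 𝔤.riem e a c d) = 0 := by
  have h := 𝔤.comm c d (𝔤.G a b)
  rw [𝔤.compat, 𝔤.compat] at h
  simp only [Fin.sum_univ_four, map_add, Derivation.leibniz, smul_eq_mul, 𝔤.compat] at h
  simp only [riem, Fin.sum_univ_four]
  simp only [𝔤.Γ_symm _ c, 𝔤.Γ_symm _ d, 𝔤.G_symm _ b] at h ⊢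
  linear_combination h

end Geom

/-! ### The Ricci tensor and the contracted Bianchi identity -/

namespace Geom

variable {R : Type*} [CommRing R] [Algebra ℝ R] (𝔤 : Geom R)

/-- The Ricci tensor. -/
def ric (a b : Fin 4) : R :=
  ∑ c, (𝔤.D c (𝔤.Γ c a b) - 𝔤.D b (𝔤.Γ c a c))
  + ∑ c, ∑ d, (𝔤.Γ c c d * 𝔤.Γ d a b - 𝔤.Γ c b d * 𝔤.Γ d a c)

lemma ric_eq_sum_riem (a b : Fin 4) : 𝔤.ric a b = ∑ c, 𝔤.riem c a c b := by
  simp only [ric, riem, ← Finset.sum_add_distrib, 𝔤.Γ_symm _ _ a]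

lemma inv_left (a b : Fin 4) : ∑ c, 𝔤.I a c * 𝔤.G c b = if a = b then 1 else 0 := by
  rw [← if_congr (eq_comm (a := b)) rfl rfl, ← 𝔤.inv b a]
  exact Finset.sum_congr rfl fun c _ => by rw [𝔤.I_symm a, 𝔤.G_symm c, mul_comm]

lemma raise_lower (x : Fin 4 → R) (a : Fin 4) :
    ∑ b, 𝔤.I a b * ∑ c, 𝔤.G b c * x c = x a := by
  have := fun c => 𝔤.inv_left a c
  simp only [Finset.mul_sum, ← mul_assoc]
  rw [Finset.sum_comm]
  simp [← Finset.sum_mul, this]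

lemma lower_raise (x : Fin 4 → R) (a : Fin 4) :
    ∑ b, 𝔤.G a b * ∑ c, 𝔤.I b c * x c = x a := by
  have := fun c => 𝔤.inv a c
  simp only [Finset.mul_sum, ← mul_assoc]
  rw [Finset.sum_comm]
  simp [← Finset.sum_mul, this]

/-- Differentiate `G * I = 1`, use compatibility, and raise the free index: the inverse metric is
parallel. -/
lemma D_inv (a b c : Fin 4) :
    𝔤.D c (𝔤.I a b) = -∑ d, (𝔤.Γ a c d * 𝔤.I d b + 𝔤.Γ b c d * 𝔤.I a d) := by
  have h : ∀ e, ∑ d, 𝔤.G e d * 𝔤.D c (𝔤.I d b)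
      = -∑ d, 𝔤.D c (𝔤.G e d) * 𝔤.I d b := by
    intro e
    have h0 : 𝔤.D c (if e = b then 1 else 0) = 0 := by split_ifs <;> simp
    rw [← 𝔤.inv e b] at h0
    simp only [map_sum, Derivation.leibniz, smul_eq_mul, Finset.sum_add_distrib] at h0
    rw [eq_neg_of_add_eq_zero_left h0]
    simp only [mul_comm]
  have h1 := 𝔤.raise_lower (fun d => 𝔤.D c (𝔤.I d b)) a
  simp only [h, 𝔤.compat] at h1
  rw [← h1]
  have e1 : ∀ d, ∑ f, (∑ k, 𝔤.G d k * 𝔤.Γ k f c) * 𝔤.I f b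
      = ∑ k, 𝔤.G d k * ∑ f, 𝔤.Γ k f c * 𝔤.I f b := by
    intro d; simp only [Fin.sum_univ_four]; ring
  have e2 : ∀ d, ∑ f, (∑ k, 𝔤.Γ k d c * 𝔤.G k f) * 𝔤.I f b = 𝔤.Γ b d c := by
    intro d
    have := fun k => 𝔤.inv k b
    simp only [Finset.sum_mul, mul_assoc]
    rw [Finset.sum_comm]
    simp [← Finset.mul_sum, this]
  have e3 : ∀ d, ∑ f, (∑ k, (𝔤.Γ k d c * 𝔤.G k f + 𝔤.Γ k f c * 𝔤.G d k)) * 𝔤.I f b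
      = 𝔤.Γ b d c + ∑ k, 𝔤.G d k * ∑ f, 𝔤.Γ k f c * 𝔤.I f b := by
    intro d
    rw [← e2 d, ← e1 d, ← Finset.sum_add_distrib]
    refine Finset.sum_congr rfl fun f _ => ?_
    rw [← add_mul, ← Finset.sum_add_distrib]
    simp only [mul_comm]
  simp only [e3]
  simp only [mul_neg, Finset.sum_neg_distrib, mul_add, Finset.sum_add_distrib]
  rw [𝔤.raise_lower (fun k => ∑ f, 𝔤.Γ k f c * 𝔤.I f b) a]
  simp only [𝔤.Γ_symm _ c, mul_comm]
  ring

/-- The Riemann tensor with the second index raised, `R^{ab}_{cd}`. -/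
def riemUp (a b c d : Fin 4) : R := ∑ f, 𝔤.I b f * 𝔤.riem a f c d

lemma riemUp_antisymm_right (a b c d : Fin 4) : 𝔤.riemUp a b c d = -𝔤.riemUp a b d c := by
  simp only [riemUp, 𝔤.riem_antisymm _ _ c d, mul_neg, Finset.sum_neg_distrib]

lemma riemUp_antisymm_left (a b c d : Fin 4) : 𝔤.riemUp a b c d = -𝔤.riemUp b a c d := by
  have h : ∀ x y, ∑ e, 𝔤.G x e * 𝔤.riem e y c d = -∑ e, 𝔤.G y e * 𝔤.riem e x c d := by
    intro x y
    rw [eq_neg_iff_add_eq_zero, ← Finset.sum_add_distrib]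
    exact 𝔤.riem_lower_antisymm x y c d
  have key : ∀ x y, 𝔤.riemUp x y c d
      = ∑ f, 𝔤.I y f * ∑ k, 𝔤.I x k * ∑ e, 𝔤.G k e * 𝔤.riem e f c d := by
    intro x y
    simp only [𝔤.raise_lower (fun e => 𝔤.riem e _ c d) x, riemUp]
  rw [key a b, key b a]
  simp only [Finset.mul_sum (s := Finset.univ) (f := fun k => 𝔤.I _ k * _)]
  rw [Finset.sum_comm]
  simp only [← Finset.sum_neg_distrib]
  refine Finset.sum_congr rfl fun k _ => Finset.sum_congr rfl fun f _ => ?_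
  rw [h k f]
  ring

/-- As the inverse metric is parallel, the second index can be raised inside the identity. Both
traces can then be taken without the metric. -/
lemma bianchi_up (a k e c d : Fin 4) :
    (𝔤.D e (𝔤.riemUp a k c d)
        + ∑ f, (𝔤.Γ a e f * 𝔤.riemUp f k c d + 𝔤.Γ k e f * 𝔤.riemUp a f c d))
      + (𝔤.D c (𝔤.riemUp a k d e)
        + ∑ f, (𝔤.Γ a c f * 𝔤.riemUp f k d e + 𝔤.Γ k c f * 𝔤.riemUp a f d e))
      + (𝔤.D d (𝔤.riemUp a k e c)
        + ∑ f, (𝔤.Γ a d f * 𝔤.riemUp f k e c + 𝔤.Γ k d f * 𝔤.riemUp a f e c)) = 0 := by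
  have h := fun b => 𝔤.bianchi a b e c d
  simp only [riemUp, Fin.sum_univ_four, map_add, Derivation.leibniz, smul_eq_mul, 𝔤.D_inv] at h ⊢
  linear_combination 𝔤.I k 0 * h 0 + 𝔤.I k 1 * h 1 + 𝔤.I k 2 * h 2 + 𝔤.I k 3 * h 3

/-- The Ricci tensor with the first index raised. -/
def ricUp (a b : Fin 4) : R := ∑ c, 𝔤.I a c * 𝔤.ric c b

lemma ricUp_eq_sum_riemUp (a b : Fin 4) : 𝔤.ricUp a b = ∑ c, 𝔤.riemUp c a c b := by
  simp only [ricUp, ric_eq_sum_riem, riemUp, Finset.mul_sum]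
  rw [Finset.sum_comm]

/-- The contracted Bianchi identity `R_{;e} = 2 R^a_{e;a}`. -/
lemma contracted_bianchi (e : Fin 4) :
    𝔤.D e (∑ a, 𝔤.ricUp a a)
      = 2 * ∑ a, (𝔤.D a (𝔤.ricUp a e)
        + ∑ f, (𝔤.Γ a a f * 𝔤.ricUp f e - 𝔤.Γ f a e * 𝔤.ricUp a f)) := by
  -- Double trace of the Bianchi identity: the first cyclic term gives the gradient of the scalar
  -- curvature, each of the other two gives minus the divergence of the Ricci tensor.
  have h : ∑ a, ∑ b, _ = ∑ a : Fin 4, ∑ b : Fin 4, (0 : R) :=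
    Finset.sum_congr rfl fun a _ => Finset.sum_congr rfl fun b _ => 𝔤.bianchi_up a b e a b
  have hl := fun a b c d => 𝔤.riemUp_antisymm_left a b c d
  have hr := fun a b c d => 𝔤.riemUp_antisymm_right a b c d
  have h0 : ∀ x : R, x = -x → x = 0 := by
    intro x hx
    have h3 : (2 : ℝ) • x = 0 := by rw [two_smul]; exact eq_neg_iff_add_eq_zero.1 hx
    simpa [smul_smul] using congrArg (fun x => (1 / 2 : ℝ) • x) h3
  have hl0 := fun a c d => h0 _ (hl a a c d)
  have hr0 := fun a b c => h0 _ (hr a b c c)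
  have hΓ := 𝔤.Γ_symm
  simp only [ricUp_eq_sum_riemUp]
  -- From here on only the antisymmetries of the curvature matter; they bring all components to a
  -- normal form.
  generalize 𝔤.riemUp = r at *
  simp only [Fin.sum_univ_four, hl0, hr0, hl 1 0, hl 2 0, hl 3 0, hl 2 1, hl 3 1, hl 3 2, hr _ _ 1 0,
    hr _ _ 2 0, hr _ _ 3 0, hr _ _ 2 1, hr _ _ 3 1, hr _ _ 3 2, hr _ _ e, map_add, map_neg, map_zero,
    hΓ _ 1 0, hΓ _ 2 0, hΓ _ 3 0, hΓ _ 2 1, hΓ _ 3 1, hΓ _ 3 2, hΓ _ e]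
    at h ⊢
  linear_combination h

end Geom

/-! ### Lie derivatives of the metric, the connection and the Ricci tensor -/

namespace Geom

variable {R : Type*} [CommRing R] [Algebra ℝ R] (𝔤 : Geom R)

/-- The Lie derivative of a tensor with two lower indices. -/
def lie2 (X : Fin 4 → R) (T : Fin 4 → Fin 4 → R) (a b : Fin 4) : R :=
  ∑ c, (X c * 𝔤.D c (T a b) + T c b * 𝔤.D a (X c) + T a c * 𝔤.D b (X c))

/-- The Lie derivative of the connection. -/
def lieΓ (X : Fin 4 → R) (a b c : Fin 4) : R :=
  ∑ d, (X d * 𝔤.D d (𝔤.Γ a b c) - 𝔤.D d (X a) * 𝔤.Γ d b c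
    + 𝔤.D b (X d) * 𝔤.Γ a d c + 𝔤.D c (X d) * 𝔤.Γ a b d) + 𝔤.D b (𝔤.D c (X a))

/-- The Koszul formula, recovered from compatibility and symmetry of the connection. -/
lemma two_mul_lower_Γ (a b c : Fin 4) :
    2 * ∑ d, 𝔤.G a d * 𝔤.Γ d b c
      = 𝔤.D b (𝔤.G a c) + 𝔤.D c (𝔤.G a b) - 𝔤.D a (𝔤.G b c) := by
  simp only [𝔤.compat, Fin.sum_univ_four, 𝔤.G_symm 0, 𝔤.G_symm 1, 𝔤.G_symm 2, 𝔤.G_symm 3,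
    𝔤.Γ_symm _ b a, 𝔤.Γ_symm _ c a, 𝔤.Γ_symm _ c b]
  ring

-- Lie-differentiate the Koszul formula: its derivatives are contracted with X, and the formula
-- itself with the derivatives of X. The second derivatives of X are the inhomogeneous term of
-- `lieΓ`.
set_option maxHeartbeats 800000 in
lemma lower_lieΓ (X : Fin 4 → R) (a b c : Fin 4) :
    2 * ∑ d, 𝔤.G a d * 𝔤.lieΓ X d b c + 2 * ∑ d, 𝔤.lie2 X 𝔤.G a d * 𝔤.Γ d b c
      = 𝔤.D b (𝔤.lie2 X 𝔤.G a c) + 𝔤.D c (𝔤.lie2 X 𝔤.G a b) - 𝔤.D a (𝔤.lie2 X 𝔤.G b c) := by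
  have k := 𝔤.two_mul_lower_Γ
  have kd := fun e => congrArg (𝔤.D e) (k a b c)
  have h2 : ∀ e, 𝔤.D e (2 : R) = 0 := fun e => by
    have := (𝔤.D e).map_natCast 2
    simpa using this
  simp only [lie2, lieΓ, Fin.sum_univ_four, map_add, map_sub, Derivation.leibniz, smul_eq_mul,
    h2, mul_zero, add_zero] at k kd ⊢
  simp only [𝔤.comm a 0, 𝔤.comm a 1, 𝔤.comm a 2, 𝔤.comm a 3, 𝔤.comm b 0, 𝔤.comm b 1, 𝔤.comm b 2,
    𝔤.comm b 3, 𝔤.comm c 0, 𝔤.comm c 1, 𝔤.comm c 2, 𝔤.comm c 3, 𝔤.comm b a, 𝔤.comm c a,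
    𝔤.comm c b] at kd ⊢
  linear_combination X 0 * kd 0 + X 1 * kd 1 + X 2 * kd 2 + X 3 * kd 3
    + 𝔤.D a (X 0) * k 0 b c + 𝔤.D a (X 1) * k 1 b c + 𝔤.D a (X 2) * k 2 b c + 𝔤.D a (X 3) * k 3 b c
    + 𝔤.D b (X 0) * k a 0 c + 𝔤.D b (X 1) * k a 1 c + 𝔤.D b (X 2) * k a 2 c + 𝔤.D b (X 3) * k a 3 c
    - 𝔤.D a (𝔤.D c (X 0)) * 𝔤.G_symm 0 b - 𝔤.D a (𝔤.D c (X 1)) * 𝔤.G_symm 1 b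
    - 𝔤.D a (𝔤.D c (X 2)) * 𝔤.G_symm 2 b - 𝔤.D a (𝔤.D c (X 3)) * 𝔤.G_symm 3 b
    + 𝔤.D c (X 0) * k a b 0 + 𝔤.D c (X 1) * k a b 1 + 𝔤.D c (X 2) * k a b 2 + 𝔤.D c (X 3) * k a b 3

/-- None of the four pieces of the Ricci tensor in `ric_eq` is a tensor, so the formal Lie
derivative of each leaves higher derivatives of X beyond those contained in `lieΓ`. They are
recorded piece by piece and cancel in `lie2_ric`. -/
lemma lie2_div_Γ (X : Fin 4 → R) (a b : Fin 4) :
    𝔤.lie2 X (fun a b => ∑ c, 𝔤.D c (𝔤.Γ c a b)) a b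
      = ∑ c, 𝔤.D c (𝔤.lieΓ X c a b)
        + ∑ c, ∑ d, (𝔤.D c (𝔤.D d (X c)) * 𝔤.Γ d a b - 𝔤.D c (𝔤.D a (X d)) * 𝔤.Γ c d b
          - 𝔤.D c (𝔤.D b (X d)) * 𝔤.Γ c a d)
        - ∑ c, 𝔤.D c (𝔤.D a (𝔤.D b (X c))) := by
  simp only [lie2, lieΓ, Fin.sum_univ_four, map_add, map_sub, Derivation.leibniz, smul_eq_mul]
  simp only [𝔤.comm 1 0, 𝔤.comm 2 0, 𝔤.comm 3 0, 𝔤.comm 2 1, 𝔤.comm 3 1, 𝔤.comm 3 2]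
  ring

/-- The trace `Γ^c_{ac}` of the connection. -/
def trΓ (a : Fin 4) : R := ∑ c, 𝔤.Γ c a c

lemma sum_lieΓ (X : Fin 4 → R) (a : Fin 4) :
    ∑ c, 𝔤.lieΓ X c a c
      = ∑ d, (X d * 𝔤.D d (𝔤.trΓ a) + 𝔤.D a (X d) * 𝔤.trΓ d + 𝔤.D a (𝔤.D d (X d))) := by
  simp only [lieΓ, trΓ, Fin.sum_univ_four, map_add]
  ring

lemma lie2_D_trΓ (X : Fin 4 → R) (a b : Fin 4) :
    𝔤.lie2 X (fun a b => 𝔤.D b (𝔤.trΓ a)) a b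
      = 𝔤.D b (∑ c, 𝔤.lieΓ X c a c)
        - ∑ d, (𝔤.D a (𝔤.D b (X d)) * 𝔤.trΓ d + 𝔤.D d (𝔤.D a (𝔤.D b (X d)))) := by
  rw [sum_lieΓ]
  simp only [lie2, Fin.sum_univ_four, map_add, Derivation.leibniz, smul_eq_mul]
  simp only [𝔤.comm a 0, 𝔤.comm a 1, 𝔤.comm a 2, 𝔤.comm a 3, 𝔤.comm b 0, 𝔤.comm b 1, 𝔤.comm b 2,
    𝔤.comm b 3, 𝔤.comm b a]
  ring

lemma lie2_trΓ_Γ (X : Fin 4 → R) (a b : Fin 4) :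
    𝔤.lie2 X (fun a b => ∑ d, 𝔤.trΓ d * 𝔤.Γ d a b) a b
      = ∑ d, ((∑ c, 𝔤.lieΓ X c d c) * 𝔤.Γ d a b + 𝔤.trΓ d * 𝔤.lieΓ X d a b)
        - ∑ d, (∑ c, 𝔤.D c (𝔤.D d (X c)) * 𝔤.Γ d a b + 𝔤.D a (𝔤.D b (X d)) * 𝔤.trΓ d) := by
  simp only [sum_lieΓ]
  simp only [lie2, lieΓ, Fin.sum_univ_four, map_add, Derivation.leibniz, smul_eq_mul]
  simp only [𝔤.comm 1 0, 𝔤.comm 2 0, 𝔤.comm 3 0, 𝔤.comm 2 1, 𝔤.comm 3 1, 𝔤.comm 3 2]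
  ring

lemma lie2_Γ_Γ (X : Fin 4 → R) (a b : Fin 4) :
    𝔤.lie2 X (fun a b => ∑ c, ∑ d, 𝔤.Γ c b d * 𝔤.Γ d a c) a b
      = ∑ c, ∑ d, 𝔤.lieΓ X c b d * 𝔤.Γ d a c + ∑ c, ∑ d, 𝔤.Γ c b d * 𝔤.lieΓ X d a c
        - ∑ c, ∑ d, (𝔤.D c (𝔤.D b (X d)) * 𝔤.Γ c a d + 𝔤.D c (𝔤.D a (X d)) * 𝔤.Γ c d b) := by
  simp only [lie2, lieΓ, Fin.sum_univ_four, map_add, Derivation.leibniz, smul_eq_mul]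
  simp only [𝔤.comm a 0, 𝔤.comm a 1, 𝔤.comm a 2, 𝔤.comm a 3, 𝔤.comm b 0, 𝔤.comm b 1, 𝔤.comm b 2,
    𝔤.comm b 3, 𝔤.Γ_symm _ _ b]
  ring

lemma ric_eq (a b : Fin 4) :
    𝔤.ric a b = ∑ c, 𝔤.D c (𝔤.Γ c a b) - 𝔤.D b (𝔤.trΓ a) + ∑ d, 𝔤.trΓ d * 𝔤.Γ d a b
      - ∑ c, ∑ d, 𝔤.Γ c b d * 𝔤.Γ d a c := by
  simp only [ric, trΓ, Finset.sum_sub_distrib, map_sum, Finset.sum_mul]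
  rw [Finset.sum_comm (f := fun c d => 𝔤.Γ c c d * 𝔤.Γ d a b)]
  simp only [fun c d => 𝔤.Γ_symm c c d]
  ring

/-- Palatini's formula: the Ricci tensor is differentiated as a function of the connection, in the
direction `lieΓ`. -/
lemma lie2_ric (X : Fin 4 → R) (a b : Fin 4) :
    𝔤.lie2 X 𝔤.ric a b = ∑ c, 𝔤.D c (𝔤.lieΓ X c a b) - 𝔤.D b (∑ c, 𝔤.lieΓ X c a c)
      + ∑ d, ((∑ c, 𝔤.lieΓ X c d c) * 𝔤.Γ d a b + 𝔤.trΓ d * 𝔤.lieΓ X d a b)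
      - ∑ c, ∑ d, 𝔤.lieΓ X c b d * 𝔤.Γ d a c - ∑ c, ∑ d, 𝔤.Γ c b d * 𝔤.lieΓ X d a c := by
  have h : 𝔤.lie2 X 𝔤.ric a b
      = 𝔤.lie2 X (fun a b => ∑ c, 𝔤.D c (𝔤.Γ c a b)) a b
        - 𝔤.lie2 X (fun a b => 𝔤.D b (𝔤.trΓ a)) a b
        + 𝔤.lie2 X (fun a b => ∑ d, 𝔤.trΓ d * 𝔤.Γ d a b) a b
        - 𝔤.lie2 X (fun a b => ∑ c, ∑ d, 𝔤.Γ c b d * 𝔤.Γ d a c) a b := by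
    simp only [lie2, ric_eq, map_sub, map_add, ← Finset.sum_sub_distrib, ← Finset.sum_add_distrib]
    refine Finset.sum_congr rfl fun c _ => ?_
    ring
  rw [h, lie2_div_Γ, lie2_D_trΓ, lie2_trΓ_Γ, lie2_Γ_Γ]
  simp only [Finset.sum_sub_distrib, Finset.sum_add_distrib]
  rw [Finset.sum_comm (f := fun c d => 𝔤.D c (𝔤.D d (X c)) * 𝔤.Γ d a b)]
  ring

end Geom

lemma two_mul_cancel {R : Type*} [CommRing R] [Algebra ℝ R] {x y : R} (h : 2 * x = 2 * y) :
    x = y := by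
  have h2 : ∀ z : R, (1 / 2 : ℝ) • (2 * z) = z := fun z => by
    rw [two_mul, ← two_smul ℝ, smul_smul]; norm_num
  rw [← h2 x, h, h2]

/-! ### The Ricci tensor under a conformal motion -/

namespace Geom

variable {R : Type*} [CommRing R] [Algebra ℝ R] (𝔤 : Geom R)

/-- The second covariant derivative of a scalar. -/
def hess (f : R) (a b : Fin 4) : R := 𝔤.D b (𝔤.D a f) - ∑ c, 𝔤.Γ c a b * 𝔤.D c f

/-- The d'Alembertian. -/
def box (f : R) : R := ∑ a, ∑ b, 𝔤.I a b * 𝔤.hess f a b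

/-- The gradient. -/
def grad (f : R) (a : Fin 4) : R := ∑ b, 𝔤.I a b * 𝔤.D b f

lemma box_eq_div_grad (f : R) :
    𝔤.box f = ∑ c, 𝔤.D c (𝔤.grad f c) + ∑ d, 𝔤.trΓ d * 𝔤.grad f d := by
  simp only [box, hess, grad, trΓ, Fin.sum_univ_four, map_add, Derivation.leibniz, smul_eq_mul,
    𝔤.D_inv]
  simp only [𝔤.comm 1 0, 𝔤.comm 2 0, 𝔤.comm 3 0, 𝔤.comm 2 1, 𝔤.comm 3 1, 𝔤.comm 3 2,
    𝔤.I_symm 1 0, 𝔤.I_symm 2 0, 𝔤.I_symm 3 0, 𝔤.I_symm 2 1, 𝔤.I_symm 3 1, 𝔤.I_symm 3 2,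
    𝔤.Γ_symm _ 1 0, 𝔤.Γ_symm _ 2 0, 𝔤.Γ_symm _ 3 0, 𝔤.Γ_symm _ 2 1, 𝔤.Γ_symm _ 3 1, 𝔤.Γ_symm _ 3 2]
  ring

variable {𝔤} {X : Fin 4 → R} {ψ : R}

/-- Insert L g = 2ψg in `lower_lieΓ`: by the Koszul formula the terms with undifferentiated ψ
cancel, and only gradients of ψ remain. -/
lemma lieΓ_of_conformal (hX : ∀ a b, 𝔤.lie2 X 𝔤.G a b = 2 * (ψ * 𝔤.G a b)) (a b c : Fin 4) :
    𝔤.lieΓ X a b c = (if a = b then 1 else 0) * 𝔤.D c ψ + (if a = c then 1 else 0) * 𝔤.D b ψ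
      - 𝔤.grad ψ a * 𝔤.G b c := by
  have h2 : ∀ e, 𝔤.D e (2 : R) = 0 := fun e => by simpa using (𝔤.D e).map_natCast 2
  have h : ∀ a, ∑ d, 𝔤.G a d * 𝔤.lieΓ X d b c
      = 𝔤.D b ψ * 𝔤.G a c + 𝔤.D c ψ * 𝔤.G a b - 𝔤.D a ψ * 𝔤.G b c := by
    intro a
    apply two_mul_cancel
    have h1 := 𝔤.lower_lieΓ X a b c
    have h3 := 𝔤.two_mul_lower_Γ a b c
    simp only [hX, Derivation.leibniz, smul_eq_mul, h2] at h1
    have h4 : ∑ d, 2 * (ψ * 𝔤.G a d) * 𝔤.Γ d b c = ψ * (2 * ∑ d, 𝔤.G a d * 𝔤.Γ d b c) := by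
      simp only [Finset.mul_sum]
      exact Finset.sum_congr rfl fun _ _ => by ring
    rw [h4, h3] at h1
    linear_combination h1
  rw [← 𝔤.raise_lower (fun d => 𝔤.lieΓ X d b c) a]
  simp only [h, mul_sub, mul_add, Finset.sum_sub_distrib, Finset.sum_add_distrib]
  rw [← 𝔤.inv_left a b, ← 𝔤.inv_left a c]
  simp only [grad, Fin.sum_univ_four]
  ring

/-- In Palatini's formula the divergence term contributes 2ψ_{;ab} − g_ab □ψ, and the trace of the
variation, 4ψ_{,a}, contributes −4ψ_{;ab}. The factor −2 is 2 minus the dimension. -/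
lemma lie2_ric_of_conformal (hX : ∀ a b, 𝔤.lie2 X 𝔤.G a b = 2 * (ψ * 𝔤.G a b)) (a b : Fin 4) :
    𝔤.lie2 X 𝔤.ric a b = -2 * 𝔤.hess ψ a b - 𝔤.G a b * 𝔤.box ψ := by
  have hL := lieΓ_of_conformal hX
  have D0 : ∀ e (p : Prop) [Decidable p], 𝔤.D e (if p then 1 else 0) = 0 := by
    intro e p _; split_ifs <;> simp
  have tr : ∀ a, ∑ c, 𝔤.lieΓ X c a c = 4 * 𝔤.D a ψ := by
    intro a
    have := 𝔤.lower_raise (fun b => 𝔤.D b ψ) a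
    simp only [hL, Finset.sum_sub_distrib, Finset.sum_add_distrib, grad]
    simp only [mul_comm (∑ b, _ * _), this, ite_mul, one_mul, zero_mul]
    simp
  have s1 : ∑ c, 𝔤.D c (𝔤.lieΓ X c a b) = 𝔤.D a (𝔤.D b ψ) + 𝔤.D b (𝔤.D a ψ)
      - (∑ c, 𝔤.D c (𝔤.grad ψ c)) * 𝔤.G a b - ∑ c, 𝔤.grad ψ c * 𝔤.D c (𝔤.G a b) := by
    simp only [hL, map_add, map_sub, Derivation.leibniz, D0, smul_eq_mul, mul_zero, add_zero,
      Finset.sum_sub_distrib, Finset.sum_add_distrib, Finset.sum_mul]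
    simp [mul_comm]
    ring
  have s4 : ∑ d, 𝔤.trΓ d * 𝔤.lieΓ X d a b = 𝔤.trΓ a * 𝔤.D b ψ + 𝔤.trΓ b * 𝔤.D a ψ
      - (∑ d, 𝔤.trΓ d * 𝔤.grad ψ d) * 𝔤.G a b := by
    simp only [hL, mul_sub, mul_add, Finset.sum_sub_distrib, Finset.sum_add_distrib, Finset.sum_mul]
    simp [mul_assoc]
  have s5 : ∑ c, ∑ d, 𝔤.lieΓ X c b d * 𝔤.Γ d a c = ∑ d, 𝔤.Γ d a b * 𝔤.D d ψ
      + 𝔤.D b ψ * 𝔤.trΓ a - ∑ c, 𝔤.grad ψ c * ∑ d, 𝔤.Γ d a c * 𝔤.G b d := by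
    simp only [hL, sub_mul, add_mul, Finset.sum_sub_distrib, Finset.sum_add_distrib,
      Finset.mul_sum, trΓ]
    simp [mul_assoc, mul_comm]
  have s6 : ∑ c, ∑ d, 𝔤.Γ c b d * 𝔤.lieΓ X d a c = ∑ d, 𝔤.Γ d a b * 𝔤.D d ψ
      + 𝔤.D a ψ * 𝔤.trΓ b - ∑ c, 𝔤.grad ψ c * ∑ d, 𝔤.Γ d b c * 𝔤.G a d := by
    simp only [hL, mul_sub, mul_add, Finset.sum_sub_distrib, Finset.sum_add_distrib,
      Finset.mul_sum, trΓ]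
    rw [Finset.sum_comm (f := fun c d => 𝔤.grad ψ c * (𝔤.Γ d b c * 𝔤.G a d))]
    simp [mul_assoc, mul_comm, 𝔤.Γ_symm _ b a]
  have s7 : ∑ c, 𝔤.grad ψ c * 𝔤.D c (𝔤.G a b)
      = ∑ c, 𝔤.grad ψ c * ∑ d, 𝔤.Γ d a c * 𝔤.G b d
        + ∑ c, 𝔤.grad ψ c * ∑ d, 𝔤.Γ d b c * 𝔤.G a d := by
    simp only [𝔤.compat, Finset.sum_add_distrib, mul_add, fun d => 𝔤.G_symm d b]
    rw [add_comm]
    simp only [fun d => 𝔤.G_symm d a]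
  have s8 : ∑ d, 4 * 𝔤.D d ψ * 𝔤.Γ d a b = 4 * ∑ d, 𝔤.Γ d a b * 𝔤.D d ψ := by
    simp only [Finset.mul_sum]
    exact Finset.sum_congr rfl fun _ _ => by ring
  have D4 : 𝔤.D b (4 * 𝔤.D a ψ) = 4 * 𝔤.D b (𝔤.D a ψ) := by
    have : 𝔤.D b (4 : R) = 0 := by simpa using (𝔤.D b).map_natCast 4
    simp [this]
  rw [𝔤.lie2_ric]
  simp only [tr, Finset.sum_add_distrib]
  rw [s1, s4, s5, s6, s7, s8, D4, box_eq_div_grad, hess, 𝔤.comm a b]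
  ring

end Geom

/-! ### The volume form in four dimensions -/

section Vol

variable {R : Type*} [CommRing R]

/-- The determinant of four rows. -/
def vol (v w x y : Fin 4 → R) : R := Matrix.det (Matrix.of ![v, w, x, y])

/-- The standard basis covector. -/
def unit (a : Fin 4) : Fin 4 → R := Pi.single a 1

lemma sum_unit (v : Fin 4 → R) : v = ∑ a, v a • unit a := by
  ext b; simp [unit, Pi.single_apply]

lemma vol_expand (v w x y : Fin 4 → R) : vol v w x y =
    v 0 * (w 1 * (x 2 * y 3 - x 3 * y 2) - w 2 * (x 1 * y 3 - x 3 * y 1)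
      + w 3 * (x 1 * y 2 - x 2 * y 1))
    - v 1 * (w 0 * (x 2 * y 3 - x 3 * y 2) - w 2 * (x 0 * y 3 - x 3 * y 0)
      + w 3 * (x 0 * y 2 - x 2 * y 0))
    + v 2 * (w 0 * (x 1 * y 3 - x 3 * y 1) - w 1 * (x 0 * y 3 - x 3 * y 0)
      + w 3 * (x 0 * y 1 - x 1 * y 0))
    - v 3 * (w 0 * (x 1 * y 2 - x 2 * y 1) - w 1 * (x 0 * y 2 - x 2 * y 0)
      + w 2 * (x 0 * y 1 - x 1 * y 0)) := by
  simp [vol, Matrix.det_succ_row_zero, Fin.sum_univ_succ, Fin.succAbove]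
  ring

/-- Multilinearity in this form replaces multiple sums against the permutation symbol by single
determinants. -/
lemma vol_sum_first {ι : Type*} (s : Finset ι) (r : ι → R) (f : ι → Fin 4 → R)
    (w x y : Fin 4 → R) :
    vol (∑ i ∈ s, r i • f i) w x y = ∑ i ∈ s, r i * vol (f i) w x y := by
  simp only [vol_expand, Finset.sum_apply, Pi.smul_apply, smul_eq_mul, Finset.sum_mul,
    ← Finset.sum_sub_distrib, ← Finset.sum_add_distrib]
  exact Finset.sum_congr rfl fun _ _ => by ring

lemma vol_cycle (v w x y : Fin 4 → R) : vol v w x y = vol w x v y := by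
  simp only [vol_expand]; ring

lemma vol_swap (v w x y : Fin 4 → R) : vol v w x y = -vol w v x y := by
  simp only [vol_expand]; ring

lemma vol_swap_mid (v w x y : Fin 4 → R) : vol v w x y = -vol v x w y := by
  simp only [vol_expand]; ring

lemma vol_swap_last (v w x y : Fin 4 → R) : vol v w x y = -vol v w y x := by
  simp only [vol_expand]; ring

lemma vol_sum_second {ι : Type*} (s : Finset ι) (r : ι → R) (f : ι → Fin 4 → R)
    (v x y : Fin 4 → R) :
    vol v (∑ i ∈ s, r i • f i) x y = ∑ i ∈ s, r i * vol v (f i) x y := by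
  simp only [fun w => vol_cycle v w x y, vol_sum_first]

lemma vol_sum_third {ι : Type*} (s : Finset ι) (r : ι → R) (f : ι → Fin 4 → R)
    (v w y : Fin 4 → R) :
    vol v w (∑ i ∈ s, r i • f i) y = ∑ i ∈ s, r i * vol v w (f i) y := by
  simp only [fun x => vol_swap_mid v w x y, vol_sum_second, mul_neg, Finset.sum_neg_distrib]

lemma vol_sum_fourth {ι : Type*} (s : Finset ι) (r : ι → R) (f : ι → Fin 4 → R)
    (v w x : Fin 4 → R) :
    vol v w x (∑ i ∈ s, r i • f i) = ∑ i ∈ s, r i * vol v w x (f i) := by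
  simp only [fun y => vol_swap_last v w x y, vol_sum_third, mul_neg, Finset.sum_neg_distrib]

/-- Antisymmetrization over five indices vanishes in dimension four. -/
lemma vol_schouten (n v w x y z : Fin 4 → R) :
    (∑ a, z a * n a) * vol v w x y = (∑ a, v a * n a) * vol z w x y
      + (∑ a, w a * n a) * vol v z x y + (∑ a, x a * n a) * vol v w z y
      + (∑ a, y a * n a) * vol v w x z := by
  simp only [vol_expand, Fin.sum_univ_four]
  ring

/-- The permutation symbol. -/
def perm (R : Type*) [CommRing R] (a b c d : Fin 4) : R :=
  vol (unit a) (unit b) (unit c) (unit d)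

lemma sum_perm (a b : Fin 4) (x y : Fin 4 → R) :
    ∑ c, ∑ d, perm R a b c d * x c * y d = vol (unit a) (unit b) x y := by
  conv_rhs => rw [sum_unit x, vol_sum_third]
  refine Finset.sum_congr rfl fun c _ => ?_
  conv_rhs => rw [sum_unit y, vol_sum_fourth, Finset.mul_sum]
  exact Finset.sum_congr rfl fun d _ => by rw [perm]; ring

lemma vol_mul (M : Fin 4 → Fin 4 → R) (v w x y : Fin 4 → R) :
    vol (fun a => ∑ b, v b * M b a) (fun a => ∑ b, w b * M b a) (fun a => ∑ b, x b * M b a)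
      (fun a => ∑ b, y b * M b a) = vol v w x y * Matrix.det (Matrix.of M) := by
  rw [vol, vol, ← Matrix.det_mul]
  congr 1
  ext i j
  fin_cases i <;> simp [Matrix.mul_apply]

lemma perm_eq (a b c d : Fin 4) : perm ℝ a b c d = permSymbol a b c d := by
  rw [perm, vol, permSymbol]
  congr 1
  ext i j
  fin_cases i <;> simp [unit, Pi.single_apply, eq_comm] <;> congr

lemma map_perm {S : Type*} [CommRing S] (f : R →+* S) (a b c d : Fin 4) :
    f (perm R a b c d) = perm S a b c d := by
  have h : ∀ i j : Fin 4, f (unit i j) = unit i j := by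
    intro i j
    simp only [unit, Pi.single_apply]
    split_ifs <;> simp
  simp only [perm, vol_expand, map_add, map_sub, map_mul, h]

end Vol

namespace Geom

variable {R : Type*} [CommRing R] [Algebra ℝ R] (𝔤 : Geom R)

/-! ### Vector fields -/

/-- Lowering an index. -/
def low (X : Fin 4 → R) (a : Fin 4) : R := ∑ b, 𝔤.G a b * X b

/-- The covariant derivative `w_{a;b}`. -/
def cov (w : Fin 4 → R) (a b : Fin 4) : R := 𝔤.D b (w a) - ∑ c, 𝔤.Γ c a b * w c

/-- The covariant derivative `X^a_{;b}`. -/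
def covUp (X : Fin 4 → R) (a b : Fin 4) : R := 𝔤.D b (X a) + ∑ c, 𝔤.Γ a c b * X c

/-- The divergence `X^a_{;a}`. -/
def div (X : Fin 4 → R) : R := ∑ a, 𝔤.covUp X a a

lemma cov_low (X : Fin 4 → R) (a b : Fin 4) :
    𝔤.cov (𝔤.low X) a b = ∑ c, 𝔤.G a c * 𝔤.covUp X c b := by
  simp only [cov, low, covUp, map_add, Derivation.leibniz, smul_eq_mul, 𝔤.compat,
    Fin.sum_univ_four]
  ring

lemma div_eq (X : Fin 4 → R) : 𝔤.div X = ∑ a, ∑ b, 𝔤.I a b * 𝔤.cov (𝔤.low X) a b := by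
  rw [div, Finset.sum_comm]
  refine Finset.sum_congr rfl fun a _ => ?_
  rw [← 𝔤.raise_lower (fun c => 𝔤.covUp X c a) a]
  simp only [cov_low, fun b => 𝔤.I_symm b a]

lemma lie2_G (X : Fin 4 → R) (a b : Fin 4) :
    𝔤.lie2 X 𝔤.G a b = 𝔤.cov (𝔤.low X) a b + 𝔤.cov (𝔤.low X) b a := by
  simp only [lie2, cov_low, covUp, 𝔤.compat, Fin.sum_univ_four]
  simp only [𝔤.Γ_symm _ _ a, 𝔤.Γ_symm _ _ b, 𝔤.G_symm 0, 𝔤.G_symm 1, 𝔤.G_symm 2, 𝔤.G_symm 3]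
  ring

lemma D_contract (X Y : Fin 4 → R) (b : Fin 4) :
    𝔤.D b (∑ a, 𝔤.low X a * Y a)
      = ∑ a, (𝔤.cov (𝔤.low X) a b * Y a + 𝔤.cov (𝔤.low Y) a b * X a) := by
  have h : ∑ a, 𝔤.cov (𝔤.low Y) a b * X a = ∑ a, 𝔤.low X a * 𝔤.covUp Y a b := by
    simp only [cov_low, low, Finset.sum_mul]
    rw [Finset.sum_comm]
    exact Finset.sum_congr rfl fun a _ => Finset.sum_congr rfl fun c _ => by
      rw [𝔤.G_symm c a]; ring
  rw [Finset.sum_add_distrib, h]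
  simp only [cov, covUp, map_add, Derivation.leibniz, smul_eq_mul, Fin.sum_univ_four]
  ring

/-- The Einstein equations of a string fluid imply the conservation equations. -/
lemma conservation {u n : Fin 4 → R} {W Q : R} (hu : ∑ a, 𝔤.low u a * u a = -1)
    (hn : ∑ a, 𝔤.low n a * n a = 1)
    (hric : ∀ a b, 𝔤.ric a b
      = W * (𝔤.low u a * 𝔤.low u b - 𝔤.low n a * 𝔤.low n b) + Q * 𝔤.G a b) (e : Fin 4) :
    𝔤.D e Q - 𝔤.D e W = (∑ a, u a * 𝔤.D a W + W * 𝔤.div u) * 𝔤.low u e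
      + W * ∑ b, 𝔤.cov (𝔤.low u) e b * u b
      - (∑ a, n a * 𝔤.D a W + W * 𝔤.div n) * 𝔤.low n e
      - W * ∑ b, 𝔤.cov (𝔤.low n) e b * n b := by
  -- In mixed form the metric term is a Kronecker delta, whose divergence is the bare gradient of Q.
  have hup : ∀ a b, 𝔤.ricUp a b = W * (u a * 𝔤.low u b - n a * 𝔤.low n b)
      + Q * (if a = b then 1 else 0) := by
    intro a b
    have h1 : ∑ b, 𝔤.I a b * 𝔤.low u b = u a := 𝔤.raise_lower u a
    have h2 : ∑ b, 𝔤.I a b * 𝔤.low n b = n a := 𝔤.raise_lower n a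
    rw [← 𝔤.inv_left a b]
    simp only [ricUp, hric, Fin.sum_univ_four] at h1 h2 ⊢
    linear_combination W * 𝔤.low u b * h1 - W * 𝔤.low n b * h2
  have htr : ∑ a, 𝔤.ricUp a a = -2 * W + 4 * Q := by
    simp only [hup, if_true, Fin.sum_univ_four] at hu hn ⊢
    linear_combination W * hu - W * hn
  have key := 𝔤.contracted_bianchi e
  have D2 : ∀ k : ℕ, ∀ x : R, 𝔤.D e (k * x) = k * 𝔤.D e x := fun k x => by
    simp [Derivation.leibniz]
  have h4 := D2 4 Q
  have h2 := D2 2 W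
  push_cast at h4 h2
  -- The scalar curvature is 4Q − 2W, so half the contracted Bianchi identity equates the gradient
  -- of 2Q − W with the divergence of the mixed Ricci tensor.
  have htr' : 𝔤.D e (∑ a, 𝔤.ricUp a a) = 2 * (2 * 𝔤.D e Q - 𝔤.D e W) := by
    rw [htr, map_add, neg_mul, map_neg, h4, h2]; ring
  rw [htr'] at key
  have key2 := two_mul_cancel key
  have hdiv : ∀ (f : R) (X : Fin 4 → R), ∑ a, (𝔤.D a (f * (X a * 𝔤.low X e))
      + ∑ d, (𝔤.Γ a a d * (f * (X d * 𝔤.low X e)) - 𝔤.Γ d a e * (f * (X a * 𝔤.low X d))))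
      = (∑ a, X a * 𝔤.D a f + f * 𝔤.div X) * 𝔤.low X e
        + f * ∑ b, 𝔤.cov (𝔤.low X) e b * X b := by
    intro f X
    simp only [div, covUp, cov, Derivation.leibniz, smul_eq_mul, Fin.sum_univ_four]
    simp only [𝔤.Γ_symm _ _ e, 𝔤.Γ_symm _ 1 0, 𝔤.Γ_symm _ 2 0, 𝔤.Γ_symm _ 3 0, 𝔤.Γ_symm _ 2 1,
      𝔤.Γ_symm _ 3 1, 𝔤.Γ_symm _ 3 2]
    ring
  have hδ : ∑ a, (𝔤.D a (Q * (if a = e then 1 else 0))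
      + ∑ d, (𝔤.Γ a a d * (Q * (if d = e then 1 else 0))
        - 𝔤.Γ d a e * (Q * (if a = d then 1 else 0)))) = 𝔤.D e Q := by
    have : ∀ a, 𝔤.D a (Q * (if a = e then 1 else 0)) = if a = e then 𝔤.D a Q else 0 := by
      intro a; split_ifs <;> simp
    simp only [this, Finset.sum_add_distrib]
    simp
  have h1 := hdiv W u
  have h2 := hdiv W n
  rw [← sub_eq_zero] at h1 h2 hδ key2 ⊢
  have hsplit : ∑ a, (𝔤.D a (𝔤.ricUp a e)
        + ∑ f, (𝔤.Γ a a f * 𝔤.ricUp f e - 𝔤.Γ f a e * 𝔤.ricUp a f))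
      = ∑ a, (𝔤.D a (W * (u a * 𝔤.low u e))
      + ∑ d, (𝔤.Γ a a d * (W * (u d * 𝔤.low u e)) - 𝔤.Γ d a e * (W * (u a * 𝔤.low u d))))
      - ∑ a, (𝔤.D a (W * (n a * 𝔤.low n e))
      + ∑ d, (𝔤.Γ a a d * (W * (n d * 𝔤.low n e)) - 𝔤.Γ d a e * (W * (n a * 𝔤.low n d))))
      + ∑ a, (𝔤.D a (Q * (if a = e then 1 else 0))
      + ∑ d, (𝔤.Γ a a d * (Q * (if d = e then 1 else 0))
        - 𝔤.Γ d a e * (Q * (if a = d then 1 else 0)))) := by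
    simp only [hup, mul_sub, map_add, map_sub, mul_add, Fin.sum_univ_four]
    ring
  rw [hsplit] at key2
  linear_combination key2 + h1 - h2 + hδ

end Geom

namespace Geom

variable {R : Type*} [CommRing R] [Algebra ℝ R] (𝔤 : Geom R)

/-! ### Maxwell's equations -/

/-- Jacobi's formula. It is needed to differentiate the density s = (−det g)^{1/2} in the volume
form. -/
lemma D_det (e : Fin 4) :
    𝔤.D e (Matrix.det (Matrix.of 𝔤.G)) = 2 * (Matrix.det (Matrix.of 𝔤.G) * 𝔤.trΓ e) := by
  set δ := Matrix.det (Matrix.of 𝔤.G) with hδ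
  have hvol : vol (𝔤.G 0) (𝔤.G 1) (𝔤.G 2) (𝔤.G 3) = δ := by
    rw [vol, hδ]
    congr 1
    ext i j
    fin_cases i <;> rfl
  -- Expand each differentiated row in the rows of the metric; by alternation only the diagonal
  -- coefficients survive in the determinant, and they add up to a trace.
  have hrow : ∀ a, (fun b => 𝔤.D e (𝔤.G a b))
      = ∑ c, (∑ k, 𝔤.D e (𝔤.G a k) * 𝔤.I k c) • 𝔤.G c := by
    intro a
    ext b
    have := 𝔤.lower_raise (fun k => 𝔤.D e (𝔤.G a k)) b
    rw [← this]
    simp only [Finset.sum_apply, Pi.smul_apply, smul_eq_mul, Fin.sum_univ_four, 𝔤.G_symm b,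
      𝔤.I_symm 1 0, 𝔤.I_symm 2 0, 𝔤.I_symm 3 0, 𝔤.I_symm 2 1, 𝔤.I_symm 3 1, 𝔤.I_symm 3 2]
    ring
  have htr : ∑ a, ∑ k, 𝔤.D e (𝔤.G a k) * 𝔤.I k a = 2 * 𝔤.trΓ e := by
    have h1 := 𝔤.inv
    have h : ∀ d, ∑ a, ∑ k, 𝔤.Γ d a e * (𝔤.G d k * 𝔤.I k a) = 𝔤.Γ d d e := by
      intro d
      simp only [← Finset.mul_sum, h1]
      simp
    have h2 : ∑ a, ∑ k, 𝔤.D e (𝔤.G a k) * 𝔤.I k a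
        = 2 * ∑ d, ∑ a, ∑ k, 𝔤.Γ d a e * (𝔤.G d k * 𝔤.I k a) := by
      simp only [𝔤.compat, Fin.sum_univ_four, 𝔤.G_symm 1 0, 𝔤.G_symm 2 0, 𝔤.G_symm 3 0,
        𝔤.G_symm 2 1, 𝔤.G_symm 3 1, 𝔤.G_symm 3 2,
        𝔤.I_symm 1 0, 𝔤.I_symm 2 0, 𝔤.I_symm 3 0, 𝔤.I_symm 2 1, 𝔤.I_symm 3 1, 𝔤.I_symm 3 2]
      ring
    rw [h2]
    simp only [h, trΓ, fun d => 𝔤.Γ_symm d d e]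
  have hD : 𝔤.D e δ = vol (fun b => 𝔤.D e (𝔤.G 0 b)) (𝔤.G 1) (𝔤.G 2) (𝔤.G 3)
      + vol (𝔤.G 0) (fun b => 𝔤.D e (𝔤.G 1 b)) (𝔤.G 2) (𝔤.G 3)
      + vol (𝔤.G 0) (𝔤.G 1) (fun b => 𝔤.D e (𝔤.G 2 b)) (𝔤.G 3)
      + vol (𝔤.G 0) (𝔤.G 1) (𝔤.G 2) (fun b => 𝔤.D e (𝔤.G 3 b)) := by
    rw [← hvol]
    simp only [vol_expand, map_add, map_sub, Derivation.leibniz, smul_eq_mul]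
    ring
  have alt : ∀ v w x : Fin 4 → R, vol v v w x = 0 ∧ vol v w v x = 0 ∧ vol v w x v = 0
      ∧ vol w v v x = 0 ∧ vol w v x v = 0 ∧ vol w x v v = 0 := by
    intro v w x
    simp only [vol_expand]
    refine ⟨?_, ?_, ?_, ?_, ?_, ?_⟩ <;> ring
  rw [hD, hrow, hrow, hrow, hrow, vol_sum_first, vol_sum_second, vol_sum_third, vol_sum_fourth]
  rw [mul_left_comm, ← htr, ← hvol]
  simp only [Fin.sum_univ_four, fun v w x => (alt v w x).1, fun v w x => (alt v w x).2.1,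
    fun v w x => (alt v w x).2.2.1, fun v w x => (alt v w x).2.2.2.1,
    fun v w x => (alt v w x).2.2.2.2.1, fun v w x => (alt v w x).2.2.2.2.2]
  ring

/-- The covariant derivative `F_{ab;c}`. -/
def cov2 (F : Fin 4 → Fin 4 → R) (a b c : Fin 4) : R :=
  𝔤.D c (F a b) - ∑ d, (𝔤.Γ d a c * F d b + 𝔤.Γ d b c * F a d)

/-- The divergence `F^{ab}_{;b}`. -/
def divUp2 (F : Fin 4 → Fin 4 → R) (a : Fin 4) : R :=
  ∑ b, (𝔤.D b (F a b) + ∑ d, (𝔤.Γ a d b * F d b + 𝔤.Γ b d b * F a d))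

/-- The tensor `F^{ab} = η^{abcd} X_c Y_d`, where `r` stands for `(-det g)^{-1/2}`. -/
def dual (r : R) (X Y : Fin 4 → R) (a b : Fin 4) : R :=
  ∑ c, ∑ d, r * perm R a b c d * 𝔤.low X c * 𝔤.low Y d

lemma dual_eq (r : R) (X Y : Fin 4 → R) (a b : Fin 4) :
    𝔤.dual r X Y a b = r * vol (unit a) (unit b) (𝔤.low X) (𝔤.low Y) := by
  rw [← sum_perm, dual]
  simp only [Finset.mul_sum, mul_assoc]

/-- All four indices of η are now lowered, which multiplies the determinant by det g = −s²; and
r(−s²) = −s. -/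
lemma lower_dual {r s : R} (hr : s * r = 1) (hs : s * s = -Matrix.det (Matrix.of 𝔤.G))
    (X Y : Fin 4 → R) (a b : Fin 4) :
    ∑ c, ∑ d, 𝔤.G a c * 𝔤.G b d * 𝔤.dual r X Y c d = -s * vol (unit a) (unit b) X Y := by
  have h1 : ∑ c, ∑ d, 𝔤.G a c * 𝔤.G b d * 𝔤.dual r X Y c d
      = r * vol (𝔤.G a) (𝔤.G b) (𝔤.low X) (𝔤.low Y) := by
    conv_rhs => rw [sum_unit (𝔤.G a), vol_sum_first, Finset.mul_sum]
    refine Finset.sum_congr rfl fun c _ => ?_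
    conv_rhs => rw [sum_unit (𝔤.G b), vol_sum_second, Finset.mul_sum, Finset.mul_sum]
    exact Finset.sum_congr rfl fun d _ => by rw [dual_eq]; ring
  have hu : ∀ a, 𝔤.G a = fun c => ∑ b, (unit a : Fin 4 → R) b * 𝔤.G b c := by
    intro a; ext c; simp [unit, Pi.single_apply]
  have hl : ∀ X, 𝔤.low X = fun c => ∑ b, X b * 𝔤.G b c := by
    intro X; ext c; simp only [low, 𝔤.G_symm c, mul_comm]
  rw [h1, hu a, hu b, hl X, hl Y, vol_mul]
  linear_combination (r * vol (unit a) (unit b) X Y) * hs - s * vol (unit a) (unit b) X Y * hr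

/-- The exterior derivative of a two-form needs no connection: the symbols cancel by symmetry. -/
lemma cov2_cyclic {F : Fin 4 → Fin 4 → R} (hF : ∀ a b, F a b = -F b a) (a b c : Fin 4) :
    𝔤.cov2 F a b c + 𝔤.cov2 F b c a + 𝔤.cov2 F c a b
      = 𝔤.D c (F a b) + 𝔤.D a (F b c) + 𝔤.D b (F c a) := by
  simp only [cov2, 𝔤.Γ_symm _ b a, 𝔤.Γ_symm _ c a, 𝔤.Γ_symm _ c b, hF 0, hF 1, hF 2, hF 3,
    Fin.sum_univ_four]
  ring

/-- Closedness of a two-form is vanishing divergence of its dual bivector, here X^a Y^b − Y^a X^b up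
to a constant factor. The derivative of the density s supplies the trace terms of that divergence.
-/
lemma maxwell_hom {r s : R} (hr : s * r = 1) (hs : s * s = -Matrix.det (Matrix.of 𝔤.G))
    {X Y : Fin 4 → R}
    (hF : ∀ a b c, 𝔤.cov2 (fun a b => ∑ c, ∑ d, 𝔤.G a c * 𝔤.G b d * 𝔤.dual r X Y c d) a b c
      + 𝔤.cov2 (fun a b => ∑ c, ∑ d, 𝔤.G a c * 𝔤.G b d * 𝔤.dual r X Y c d) b c a
      + 𝔤.cov2 (fun a b => ∑ c, ∑ d, 𝔤.G a c * 𝔤.G b d * 𝔤.dual r X Y c d) c a b = 0)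
    (a : Fin 4) :
    ∑ b, 𝔤.covUp X a b * Y b + X a * 𝔤.div Y - ∑ b, 𝔤.covUp Y a b * X b - Y a * 𝔤.div X = 0 := by
  simp only [𝔤.lower_dual hr hs] at hF
  have hDs : ∀ e, 𝔤.D e s = s * 𝔤.trΓ e := by
    intro e
    have h := congrArg (𝔤.D e) hs
    rw [map_neg, D_det, Derivation.leibniz, smul_eq_mul] at h
    have h2 : 2 * 𝔤.D e s = 2 * (s * 𝔤.trΓ e) := by
      linear_combination r * h - 2 * 𝔤.D e s * hr - 2 * r * 𝔤.trΓ e * hs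
        + 2 * (s * 𝔤.trΓ e) * hr
    exact two_mul_cancel h2
  have hcyc : ∀ a b c, 𝔤.D c (-s * vol (unit a) (unit b) X Y)
      + 𝔤.D a (-s * vol (unit b) (unit c) X Y) + 𝔤.D b (-s * vol (unit c) (unit a) X Y) = 0 := by
    intro a b c
    rw [← hF a b c, 𝔤.cov2_cyclic fun a b => ?_]
    rw [vol_swap]
    ring
  have hu : ∀ a b : Fin 4, (unit a : Fin 4 → R) b = if b = a then 1 else 0 := by
    intro a b; rw [unit, Pi.single_apply]
  -- The four independent components of dF. Component `a` of the conclusion comes from the one whose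
  -- indices omit `a`.
  have h012 := hcyc 0 1 2
  have h013 := hcyc 0 1 3
  have h023 := hcyc 0 2 3
  have h123 := hcyc 1 2 3
  have hcancel : ∀ x : R, s * x = 0 → x = 0 := fun x hx => by
    linear_combination r * hx - x * hr
  simp only [vol_expand, hu] at h012 h013 h023 h123
  apply hcancel
  fin_cases a
  all_goals
    simp [Derivation.leibniz, hDs] at h012 h013 h023 h123
    simp only [covUp, div, trΓ, Fin.sum_univ_four, Fin.zero_eta, Fin.mk_one, Fin.reduceFinMk,
      𝔤.Γ_symm _ 1 0, 𝔤.Γ_symm _ 2 0, 𝔤.Γ_symm _ 3 0, 𝔤.Γ_symm _ 2 1,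
      𝔤.Γ_symm _ 3 1, 𝔤.Γ_symm _ 3 2] at h012 h013 h023 h123 ⊢
  · linear_combination -h123
  · linear_combination h023
  · linear_combination -h013
  · linear_combination h012

/-- Product rule: w_a F^{ab} = 0, so its divergence vanishes and the derivative moves onto w.
Antisymmetry of F removes the connection terms that do not belong to w_{a;b}. -/
lemma contract_divUp2 {F : Fin 4 → Fin 4 → R} {w : Fin 4 → R} (hF : ∀ a b, F a b = -F b a)
    (hw : ∀ b, ∑ a, w a * F a b = 0) :
    ∑ a, w a * 𝔤.divUp2 F a = -∑ a, ∑ b, F a b * 𝔤.cov w a b := by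
  have h0 : ∀ a, F a a = 0 := fun a => by
    apply two_mul_cancel
    linear_combination hF a a
  have hD := fun b => congrArg (𝔤.D b) (hw b)
  simp only [Fin.sum_univ_four, map_add, map_zero, Derivation.leibniz, smul_eq_mul] at hD hw
  have w0 := hw 0
  have w1 := hw 1
  have w2 := hw 2
  have w3 := hw 3
  have d0 := hD 0
  have d1 := hD 1
  have d2 := hD 2
  have d3 := hD 3
  simp only [divUp2, cov, Fin.sum_univ_four]
  simp only [h0, hF 1 0, hF 2 0, hF 3 0, hF 2 1, hF 3 1, hF 3 2, map_neg, map_zero,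
    𝔤.Γ_symm _ 1 0, 𝔤.Γ_symm _ 2 0, 𝔤.Γ_symm _ 3 0, 𝔤.Γ_symm _ 2 1,
    𝔤.Γ_symm _ 3 1, 𝔤.Γ_symm _ 3 2] at w0 w1 w2 w3 d0 d1 d2 d3 ⊢
  linear_combination d0 + d1 + d2 + d3
    + (𝔤.Γ 0 0 0 + 𝔤.Γ 1 0 1 + 𝔤.Γ 2 0 2 + 𝔤.Γ 3 0 3) * w0
    + (𝔤.Γ 0 0 1 + 𝔤.Γ 1 1 1 + 𝔤.Γ 2 1 2 + 𝔤.Γ 3 1 3) * w1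
    + (𝔤.Γ 0 0 2 + 𝔤.Γ 1 1 2 + 𝔤.Γ 2 2 2 + 𝔤.Γ 3 2 3) * w2
    + (𝔤.Γ 0 0 3 + 𝔤.Γ 1 1 3 + 𝔤.Γ 2 2 3 + 𝔤.Γ 3 3 3) * w3

lemma contract_divUp2_dual {r : R} {X Y : Fin 4 → R} {w : Fin 4 → R}
    (hw : ∀ b, vol w (unit b) (𝔤.low X) (𝔤.low Y) = 0) :
    ∑ a, w a * 𝔤.divUp2 (𝔤.dual r X Y) a
      = -(r * ∑ a, ∑ b, vol (unit a) (unit b) (𝔤.low X) (𝔤.low Y) * 𝔤.cov w a b) := by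
  rw [contract_divUp2]
  · simp only [dual_eq, Finset.mul_sum, mul_assoc]
  · intro a b
    rw [dual_eq, dual_eq, vol_swap]; ring
  · intro b
    have := hw b
    rw [sum_unit w, vol_sum_first] at this
    calc ∑ a, w a * 𝔤.dual r X Y a b
        = r * ∑ a, w a * vol (unit a) (unit b) (𝔤.low X) (𝔤.low Y) := by
          rw [Finset.mul_sum]
          exact Finset.sum_congr rfl fun a _ => by rw [dual_eq]; ring
      _ = 0 := by rw [this, mul_zero]

end Geom

/-! ### Pointwise algebra of a double congruence -/

/-- The contraction of a covector with a vector. -/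
def dot (w v : Fin 4 → ℝ) : ℝ := ∑ a, w a * v a

namespace Congruences

variable (C : Congruences) (y : R4)

/-- `u^c n_{c;a}`. -/
def nDotT (a : Fin 4) : ℝ := ∑ c, C.Dn y c a * C.u y c

/-- The divergence `u^a_{;a}`. -/
def divU : ℝ := ∑ a, ∑ b, inv C.g y a b * C.Du y a b

/-- The divergence `n^a_{;a}`. -/
def divN : ℝ := ∑ a, ∑ b, inv C.g y a b * C.Dn y a b

/-- The vectors `u^a` and `n^a` are orthonormal along with the differential consequences. -/
structure IsFrame : Prop where
  symm : ∀ a b, C.g y a b = C.g y b a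
  inv_symm : ∀ a b, inv C.g y a b = inv C.g y b a
  inverse : ∀ a b, ∑ c, C.g y a c * inv C.g y c b = if a = b then 1 else 0
  uu : dot (C.uL y) (C.u y) = -1
  nn : dot (C.nL y) (C.n y) = 1
  un : dot (C.uL y) (C.n y) = 0
  nu : dot (C.nL y) (C.u y) = 0
  Du_u : ∀ b, ∑ a, C.Du y a b * C.u y a = 0
  Dn_n : ∀ b, ∑ a, C.Dn y a b * C.n y a = 0
  Du_n : ∀ b, ∑ a, C.Du y a b * C.n y a = -C.nDotT y b

/-- The homogeneous Maxwell equations, where `l` is the gradient of `ln H`. -/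
def Maxwell (l : Fin 4 → ℝ) : Prop :=
  ∀ a, C.nDot y a + (dot l (C.u y) + C.divU y) * C.nL y a - C.uStar y a
    - (dot l (C.n y) + C.divN y) * C.uL y a = 0

variable {C y}

lemma sum_pMix (w : Fin 4 → ℝ) (a : Fin 4) :
    ∑ c, C.pMix y c a * w c = w a + C.uL y a * dot w (C.u y) - C.nL y a * dot w (C.n y) := by
  simp only [pMix, hMix, sub_mul, add_mul, Finset.sum_sub_distrib, Finset.sum_add_distrib, dot,
    Finset.mul_sum, ite_mul, one_mul, zero_mul, Finset.sum_ite_eq', Finset.mem_univ, if_true]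
  simp only [mul_comm, mul_left_comm]

lemma sum_hMix (w : Fin 4 → ℝ) (a : Fin 4) :
    ∑ c, C.hMix y c a * w c = w a + C.uL y a * dot w (C.u y) := by
  simp only [hMix, add_mul, Finset.sum_add_distrib, dot,
    Finset.mul_sum, ite_mul, one_mul, zero_mul, Finset.sum_ite_eq', Finset.mem_univ, if_true]
  simp only [mul_comm, mul_left_comm]

lemma sum_pUp (T : Fin 4 → Fin 4 → ℝ) :
    ∑ a, ∑ b, C.pUp y a b * T a b = ∑ a, ∑ b, inv C.g y a b * T a b
      + dot (fun a => dot (T a) (C.u y)) (C.u y) - dot (fun a => dot (T a) (C.n y)) (C.n y) := by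
  simp only [pUp, hUp, dot, Fin.sum_univ_four]
  ring

lemma dot_add (v w x : Fin 4 → ℝ) : dot (fun a => v a + w a) x = dot v x + dot w x := by
  simp only [dot, Fin.sum_univ_four]; ring

lemma dot_sub (v w x : Fin 4 → ℝ) : dot (fun a => v a - w a) x = dot v x - dot w x := by
  simp only [dot, Fin.sum_univ_four]; ring

lemma dot_smul (r : ℝ) (v x : Fin 4 → ℝ) : dot (fun a => r * v a) x = r * dot v x := by
  simp only [dot, Fin.sum_univ_four]; ring

lemma dot_zero (x : Fin 4 → ℝ) : dot (fun _ => 0) x = 0 := by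
  simp [dot]

lemma dot_nDot_u : dot (C.nDot y) (C.u y) = dot (C.nDotT y) (C.u y) := by
  simp only [dot, nDot, nDotT, Fin.sum_univ_four]; ring

lemma dot_nStar_u : dot (C.nStar y) (C.u y) = dot (C.nDotT y) (C.n y) := by
  simp only [dot, nStar, nDotT, Fin.sum_univ_four]; ring

namespace IsFrame

variable (h : C.IsFrame y)
include h

lemma inverse_left (a b : Fin 4) :
    ∑ c, inv C.g y a c * C.g y c b = if a = b then 1 else 0 := by
  rw [if_congr (eq_comm (a := a)) rfl rfl, ← h.inverse b a]
  exact Finset.sum_congr rfl fun c _ => by rw [h.inv_symm, h.symm, mul_comm]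

lemma raise_lower (X : Fin 4 → ℝ) (a : Fin 4) :
    ∑ b, inv C.g y a b * ∑ c, C.g y b c * X c = X a := by
  simp only [Finset.mul_sum, ← mul_assoc]
  rw [Finset.sum_comm]
  simp [← Finset.sum_mul, h.inverse_left]

lemma lower_raise (w : Fin 4 → ℝ) (a : Fin 4) :
    ∑ b, C.g y a b * ∑ c, inv C.g y b c * w c = w a := by
  simp only [Finset.mul_sum, ← mul_assoc]
  rw [Finset.sum_comm]
  simp [← Finset.sum_mul, h.inverse]

lemma raise_eq_iff (w X : Fin 4 → ℝ) :
    (∀ a, ∑ b, inv C.g y a b * w b = X a) ↔ ∀ a, w a = ∑ b, C.g y a b * X b :=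
  ⟨fun hw a => by simp only [← hw, h.lower_raise], fun hw a => by simp only [hw, h.raise_lower]⟩

lemma trace_g : ∑ a, ∑ b, inv C.g y a b * C.g y a b = 4 := by
  have h1 : ∀ a, ∑ b, inv C.g y a b * C.g y a b = 1 := fun a => by
    rw [← if_pos (rfl : a = a) (t := (1 : ℝ)) (e := 0), ← h.inverse_left a a]
    exact Finset.sum_congr rfl fun b _ => by rw [h.symm a b]
  simp [h1]

lemma trace_mul (w X : Fin 4 → ℝ) :
    ∑ a, ∑ b, inv C.g y a b * (w a * ∑ c, C.g y b c * X c) = dot w X := by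
  simp only [mul_left_comm _ (w _), ← Finset.mul_sum, h.raise_lower]
  rfl

lemma dot_nDot_n : dot (C.nDot y) (C.n y) = 0 := by
  have := h.Dn_n
  simp only [dot, nDot, Fin.sum_univ_four] at this ⊢
  linear_combination C.u y 0 * this 0 + C.u y 1 * this 1 + C.u y 2 * this 2 + C.u y 3 * this 3

lemma dot_nStar_n : dot (C.nStar y) (C.n y) = 0 := by
  have := h.Dn_n
  simp only [dot, nStar, Fin.sum_univ_four] at this ⊢
  linear_combination C.n y 0 * this 0 + C.n y 1 * this 1 + C.n y 2 * this 2 + C.n y 3 * this 3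

lemma dot_uStar_u : dot (C.uStar y) (C.u y) = 0 := by
  have := h.Du_u
  simp only [dot, uStar, Fin.sum_univ_four] at this ⊢
  linear_combination C.n y 0 * this 0 + C.n y 1 * this 1 + C.n y 2 * this 2 + C.n y 3 * this 3

lemma dot_uDot_u : dot (C.uDot y) (C.u y) = 0 := by
  have := h.Du_u
  simp only [dot, uDot, Fin.sum_univ_four] at this ⊢
  linear_combination C.u y 0 * this 0 + C.u y 1 * this 1 + C.u y 2 * this 2 + C.u y 3 * this 3

lemma dot_uStar_n : dot (C.uStar y) (C.n y) = -dot (C.nDotT y) (C.n y) := by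
  have := h.Du_n
  simp only [dot, uStar, Fin.sum_univ_four] at this ⊢
  linear_combination C.n y 0 * this 0 + C.n y 1 * this 1 + C.n y 2 * this 2 + C.n y 3 * this 3

lemma dot_uDot_n : dot (C.uDot y) (C.n y) = -dot (C.nDotT y) (C.u y) := by
  have := h.Du_n
  simp only [dot, uDot, Fin.sum_univ_four] at this ⊢
  linear_combination C.u y 0 * this 0 + C.u y 1 * this 1 + C.u y 2 * this 2 + C.u y 3 * this 3

lemma theta_eq : C.theta y = C.divU y := by
  have := h.dot_uDot_u
  simp only [dot, uDot, theta, divU, hUp, Fin.sum_univ_four] at this ⊢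
  linear_combination this

lemma screenExp_eq : C.screenExp y = C.divN y + dot (C.nDotT y) (C.u y) := by
  have h1 := h.dot_nStar_n
  rw [screenExp, sum_pUp, divN, ← dot_nDot_u]
  change _ + _ - dot (C.nStar y) _ = _ + dot (C.nDot y) _
  rw [h1, sub_zero]
  rfl

lemma thetaT_eq (a b : Fin 4) : C.thetaT y a b = (C.Du y a b + C.Du y b a
    + C.uL y a * C.uDot y b + C.uL y b * C.uDot y a) / 2 := by
  have h1 := h.Du_u
  have h2 := h.dot_uDot_u
  have key : ∀ c, ∑ d, C.hMix y c a * C.hMix y d b * ((C.Du y c d + C.Du y d c) / 2)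
      = C.hMix y c a * ((C.Du y c b + C.Du y b c + C.uL y b * C.uDot y c) / 2) := by
    intro c
    simp only [mul_assoc, ← Finset.mul_sum]
    rw [sum_hMix]
    congr 1
    have := h1 c
    simp only [dot, uDot, Fin.sum_univ_four] at this ⊢
    linear_combination (C.uL y b) / 2 * this
  rw [thetaT]
  simp only [key]
  rw [sum_hMix]
  have := h1 b
  simp only [dot, Fin.sum_univ_four] at this h2 ⊢
  have e : C.uDot y b = ∑ c, C.Du y b c * C.u y c := rfl
  rw [e]
  simp only [Fin.sum_univ_four]
  linear_combination (C.uL y a) / 2 * this + C.uL y a * C.uL y b / 2 * h2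

/-- Orthogonality trades n^c u_{c;a} for −u^c n_{c;a}, so σ_ac n^c involves the difference of u*_a
and u^c n_{c;a}, up to multiples of u_a and n_a. -/
lemma sigma_n (a : Fin 4) : ∑ c, C.sigma y a c * C.n y c
    = (C.uStar y a - C.nDotT y a - C.uL y a * dot (C.nDotT y) (C.u y)) / 2
      - (1 / 3) * C.divU y * C.nL y a := by
  have h1 := h.Du_n a
  have h2 := h.dot_uDot_n
  have h3 := h.un
  have h4 : ∑ b, C.g y a b * C.n y b = C.nL y a := rfl
  simp only [sigma, h.thetaT_eq, h.theta_eq, Congruences.h]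
  have h5 : C.uStar y a = ∑ c, C.Du y a c * C.n y c := rfl
  rw [h5]
  simp only [dot, Fin.sum_univ_four] at h1 h2 h3 h4 ⊢
  linear_combination h1 / 2 + C.uL y a / 2 * h2 + C.uDot y a / 2 * h3 - (1 / 3) * C.divU y * h4
    - (1 / 3) * C.divU y * C.uL y a * h3

/-- With the projectors multiplied out, S_ab is n_{(a;b)} corrected by its u and n components. In
this form it can be compared with the Killing equation term by term. -/
lemma screenShear_eq (a b : Fin 4) : C.screenShear y a b
    = (C.Dn y a b + C.Dn y b a) / 2 + (C.uL y b * C.nDot y a + C.uL y a * C.nDot y b) / 2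
      - (C.nL y b * C.nStar y a + C.nL y a * C.nStar y b) / 2
      + (C.uL y a * C.nDotT y b + C.uL y b * C.nDotT y a) / 2
      + C.uL y a * C.uL y b * dot (C.nDotT y) (C.u y)
      - (C.uL y a * C.nL y b + C.uL y b * C.nL y a) / 2 * dot (C.nDotT y) (C.n y)
      - (1 / 2) * C.screenExp y * C.p y a b := by
  have h1 := h.Dn_n
  have hE : ∑ c, ∑ d, (1 / 2) * C.pUp y c d * C.p y a b * ((C.Dn y c d + C.Dn y d c) / 2)
      = (1 / 2) * C.screenExp y * C.p y a b := by
    have hp : ∀ c d, C.pUp y c d = C.pUp y d c := fun c d => by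
      simp only [pUp, hUp, h.inv_symm c d]; ring
    have e1 : C.screenExp y = ∑ c, ∑ d, C.pUp y c d * C.Dn y d c := by
      rw [screenExp, Finset.sum_comm]
      simp only [fun c d => hp c d]
    have e2 : C.screenExp y
        = (∑ c, ∑ d, C.pUp y c d * C.Dn y c d + ∑ c, ∑ d, C.pUp y c d * C.Dn y d c) / 2 := by
      rw [← e1, ← screenExp]; ring
    rw [e2]
    simp only [Fin.sum_univ_four]
    ring
  have key : ∀ c, ∑ d, C.pMix y c a * C.pMix y d b * ((C.Dn y c d + C.Dn y d c) / 2)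
      = C.pMix y c a * ((C.Dn y c b + C.Dn y b c) / 2
        + C.uL y b * (C.nDot y c + C.nDotT y c) / 2 - C.nL y b * C.nStar y c / 2) := by
    intro c
    simp only [mul_assoc, ← Finset.mul_sum]
    rw [sum_pMix]
    congr 1
    have := h1 c
    simp only [dot, nDot, nDotT, nStar, Fin.sum_univ_four] at this ⊢
    linear_combination -(C.nL y b) / 2 * this
  rw [screenShear]
  simp only [sub_mul, Finset.sum_sub_distrib, hE, key]
  rw [sum_pMix]
  have e1 : dot (fun c => (C.Dn y c b + C.Dn y b c) / 2
        + C.uL y b * (C.nDot y c + C.nDotT y c) / 2 - C.nL y b * C.nStar y c / 2) (C.u y)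
      = (C.nDotT y b + C.nDot y b) / 2 + C.uL y b * dot (C.nDotT y) (C.u y)
        - C.nL y b * dot (C.nDotT y) (C.n y) / 2 := by
    have h2 := dot_nDot_u (C := C) (y := y)
    have h3 := dot_nStar_u (C := C) (y := y)
    have e : C.nDotT y b = ∑ c, C.Dn y c b * C.u y c := rfl
    have e' : C.nDot y b = ∑ c, C.Dn y b c * C.u y c := rfl
    simp only [e, e']
    simp only [dot, Fin.sum_univ_four] at h2 h3 ⊢
    linear_combination C.uL y b / 2 * h2 - C.nL y b / 2 * h3
  have e2 : dot (fun c => (C.Dn y c b + C.Dn y b c) / 2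
        + C.uL y b * (C.nDot y c + C.nDotT y c) / 2 - C.nL y b * C.nStar y c / 2) (C.n y)
      = C.nStar y b / 2 + C.uL y b * dot (C.nDotT y) (C.n y) / 2 := by
    have h2 := h.dot_nDot_n
    have h3 := h.dot_nStar_n
    have h4 := h1 b
    have e : C.nStar y b = ∑ c, C.Dn y b c * C.n y c := rfl
    simp only [e]
    simp only [dot, Fin.sum_univ_four] at h2 h3 h4 ⊢
    linear_combination C.uL y b / 2 * h2 - C.nL y b / 2 * h3 + h4 / 2
  rw [e1, e2]
  ring

variable {l : Fin 4 → ℝ} (hM : C.Maxwell y l)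
include hM

/-- The component of the induction law along u^a. -/
lemma star_lnH : C.screenExp y = -dot l (C.n y) := by
  have : dot (fun a => C.nDot y a + (dot l (C.u y) + C.divU y) * C.nL y a - C.uStar y a
    - (dot l (C.n y) + C.divN y) * C.uL y a) (C.u y) = dot (fun _ => 0) (C.u y) :=
    congrArg (fun w => dot w (C.u y)) (funext hM)
  rw [dot_sub, dot_sub, dot_add, dot_smul, dot_smul, dot_zero, h.nu, h.uu, h.dot_uStar_u,
    dot_nDot_u] at this
  rw [h.screenExp_eq]
  linear_combination this

/-- The component of the induction law along n^a. -/
lemma dot_lnH : dot l (C.u y) = -dot (C.nDotT y) (C.n y) - C.divU y := by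
  have : dot (fun a => C.nDot y a + (dot l (C.u y) + C.divU y) * C.nL y a - C.uStar y a
    - (dot l (C.n y) + C.divN y) * C.uL y a) (C.n y) = dot (fun _ => 0) (C.n y) :=
    congrArg (fun w => dot w (C.n y)) (funext hM)
  rw [dot_sub, dot_sub, dot_add, dot_smul, dot_smul, dot_zero, h.nn, h.un, h.dot_uStar_n,
    h.dot_nDot_n] at this
  linear_combination this

/-- With the u and n components known, the induction law says that ṅ_a − u*_a has no screen part;
this is the vanishing of the Greenberg vector. -/
lemma nDot_sub_uStar (a : Fin 4) : C.nDot y a - C.uStar y a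
    = dot (C.nDotT y) (C.n y) * C.nL y a - dot (C.nDotT y) (C.u y) * C.uL y a := by
  have h1 := h.star_lnH hM
  rw [h.screenExp_eq] at h1
  linear_combination hM a - C.nL y a * h.dot_lnH hM + C.uL y a * h1

lemma greenberg_eq_zero (a : Fin 4) : C.greenberg y a = 0 := by
  rw [greenberg, sum_pMix, dot_sub, dot_sub, dot_nDot_u, h.dot_nDot_n, h.dot_uStar_n,
    h.dot_uStar_u, h.nDot_sub_uStar hM]
  ring

lemma sigma_nn : ∑ a, ∑ b, C.sigma y a b * C.n y a * C.n y b - (2 / 3) * C.theta y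
    = dot l (C.u y) := by
  have e : ∑ a, ∑ b, C.sigma y a b * C.n y a * C.n y b
      = dot (fun a => ∑ b, C.sigma y a b * C.n y b) (C.n y) := by
    simp only [dot, Finset.sum_mul]
    exact Finset.sum_congr rfl fun _ _ => Finset.sum_congr rfl fun _ _ => by ring
  rw [e, h.theta_eq, h.dot_lnH hM]
  simp only [h.sigma_n]
  have h1 := h.dot_uStar_n
  have h2 := h.un
  have h3 := h.nn
  simp only [dot, Fin.sum_univ_four] at h1 h2 h3 ⊢
  linear_combination h1 / 2
    - (C.nDotT y 0 * C.u y 0 + C.nDotT y 1 * C.u y 1 + C.nDotT y 2 * C.u y 2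
      + C.nDotT y 3 * C.u y 3) / 2 * h2 - (1 / 3) * C.divU y * h3

end IsFrame

end Congruences

/-! ### The conformal Killing equation at a point -/

namespace Congruences

variable {C : Congruences} {y : R4}

variable (C y) in
/-- The conformal Killing equation for `ξ n^a`, where `x` is the gradient of `ξ`. -/
def Conformal (ξ ψ : ℝ) (x : Fin 4 → ℝ) : Prop :=
  ∀ a b, ξ * (C.Dn y a b + C.Dn y b a) + x a * C.nL y b + x b * C.nL y a = 2 * ψ * C.g y a b

namespace IsFrame

variable (h : C.IsFrame y)
include h

section

variable {ξ ψ : ℝ} {x : Fin 4 → ℝ} (hξ : 0 < ξ) (hZ : C.Conformal y ξ ψ x)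
include hZ

lemma conformal_n (a : Fin 4) :
    ξ * C.nStar y a + x a + dot x (C.n y) * C.nL y a = 2 * ψ * C.nL y a := by
  have h1 : ∑ b, (ξ * (C.Dn y a b + C.Dn y b a) + x a * C.nL y b + x b * C.nL y a) * C.n y b
      = ∑ b, 2 * ψ * C.g y a b * C.n y b := by simp only [hZ a]
  have h2 := h.Dn_n a
  have h3 := h.nn
  have h4 : C.nL y a = ∑ b, C.g y a b * C.n y b := rfl
  simp only [nStar, dot, Fin.sum_univ_four] at h1 h2 h3 h4 ⊢
  linear_combination h1 - ξ * h2 - x a * h3 - 2 * ψ * h4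

lemma conformal_u (a : Fin 4) :
    ξ * (C.nDot y a + C.nDotT y a) + dot x (C.u y) * C.nL y a = 2 * ψ * C.uL y a := by
  have h1 : ∑ b, (ξ * (C.Dn y a b + C.Dn y b a) + x a * C.nL y b + x b * C.nL y a) * C.u y b
      = ∑ b, 2 * ψ * C.g y a b * C.u y b := by simp only [hZ a]
  have h3 := h.nu
  have h4 : C.uL y a = ∑ b, C.g y a b * C.u y b := rfl
  simp only [nDot, nDotT, dot, Fin.sum_univ_four] at h1 h3 h4 ⊢
  linear_combination h1 - x a * h3 - 2 * ψ * h4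

lemma factor_star_of_conformal : dot x (C.n y) = ψ := by
  have h1 : dot (fun a => ξ * C.nStar y a + x a + dot x (C.n y) * C.nL y a) (C.n y)
      = dot (fun a => 2 * ψ * C.nL y a) (C.n y) :=
    congrArg (fun w => dot w (C.n y)) (funext (h.conformal_n hZ))
  rw [dot_add, dot_add, dot_smul, dot_smul, dot_smul, h.dot_nStar_n, h.nn] at h1
  linarith

lemma nStar_of_conformal (a : Fin 4) : ξ * C.nStar y a = ψ * C.nL y a - x a := by
  have h1 := h.conformal_n hZ a
  rw [h.factor_star_of_conformal hZ] at h1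
  linarith

lemma conformal_uu : ξ * dot (C.nDotT y) (C.u y) = -ψ := by
  have h1 : dot (fun a => ξ * (C.nDot y a + C.nDotT y a) + dot x (C.u y) * C.nL y a) (C.u y)
      = dot (fun a => 2 * ψ * C.uL y a) (C.u y) :=
    congrArg (fun w => dot w (C.u y)) (funext (h.conformal_u hZ))
  rw [dot_add, dot_smul, dot_smul, dot_smul, dot_add, h.nu, h.uu, dot_nDot_u] at h1
  linarith

lemma conformal_un : ξ * dot (C.nDotT y) (C.n y) = -dot x (C.u y) := by
  have h1 : dot (fun a => ξ * C.nStar y a) (C.u y) = dot (fun a => ψ * C.nL y a - x a) (C.u y) :=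
    congrArg (fun w => dot w (C.u y)) (funext (h.nStar_of_conformal hZ))
  rw [dot_smul, dot_sub, dot_smul, h.nu, dot_nStar_u] at h1
  linarith

lemma conformal_trace : ξ * C.divN y + dot x (C.n y) = 4 * ψ := by
  have h1 : ∑ a, ∑ b, inv C.g y a b
      * (ξ * (C.Dn y a b + C.Dn y b a) + x a * C.nL y b + x b * C.nL y a)
      = ∑ a, ∑ b, inv C.g y a b * (2 * ψ * C.g y a b) := by simp only [hZ _ _]
  have h2 := h.trace_g
  have h4 : ∑ a, ∑ b, inv C.g y a b * (x a * C.nL y b) = dot x (C.n y) := h.trace_mul x (C.n y)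
  have i1 := h.inv_symm
  have h5 : ∑ a, ∑ b, inv C.g y a b * (x b * C.nL y a) = dot x (C.n y) := by
    rw [← h4, Finset.sum_comm]
    exact Finset.sum_congr rfl fun _ _ => Finset.sum_congr rfl fun _ _ => by rw [i1]
  have h6 : ∑ a, ∑ b, inv C.g y a b * C.Dn y b a = C.divN y := by
    rw [divN, Finset.sum_comm]
    exact Finset.sum_congr rfl fun _ _ => Finset.sum_congr rfl fun _ _ => by rw [i1]
  have h7 : C.divN y = ∑ a, ∑ b, inv C.g y a b * C.Dn y a b := rfl
  simp only [Fin.sum_univ_four] at h1 h2 h4 h5 h6 h7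
  linear_combination h1 / 2 + ξ * h7 / 2 - ξ * h6 / 2 - h4 / 2 - h5 / 2 + ψ * h2

/-- Remove the uu and nn components from the trace of the Killing equation. What remains is the
trace over the two-dimensional screen, ξE = 2ψ. -/
lemma factor_exp_of_conformal : ψ = (1 / 2) * ξ * C.screenExp y := by
  rw [h.screenExp_eq]
  linear_combination -(h.conformal_trace hZ + h.conformal_uu hZ - h.factor_star_of_conformal hZ) / 2

include hξ

/-- The right-hand side of the Killing equation is pure trace on the screen, and the gradient terms
carry a factor n_a that the screen projection removes. -/
lemma screenShear_of_conformal (a b : Fin 4) : C.screenShear y a b = 0 := by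
  have h0 : ξ * C.screenShear y a b = 0 := by
    rw [h.screenShear_eq]
    simp only [p, Congruences.h]
    have e := h.factor_exp_of_conformal hZ
    have t := fun a => h.conformal_u hZ a
    have s := fun a => h.nStar_of_conformal hZ a
    linear_combination hZ a b / 2 + C.uL y b / 2 * t a + C.uL y a / 2 * t b - C.nL y b / 2 * s a
      - C.nL y a / 2 * s b + C.uL y a * C.uL y b * h.conformal_uu hZ
      - (C.uL y a * C.nL y b + C.uL y b * C.nL y a) / 2 * h.conformal_un hZ
      + (C.g y a b + C.uL y a * C.uL y b - C.nL y a * C.nL y b) * e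
  exact (mul_eq_zero.1 h0).resolve_left hξ.ne'

end

variable {l : Fin 4 → ℝ} (hM : C.Maxwell y l)
include hM

/-- The Lie derivative of `u_a` along `ξ n^a` is `ψ u_a`. -/
lemma curl_of_conformal {ξ ψ : ℝ} {x : Fin 4 → ℝ} (hZ : C.Conformal y ξ ψ x) (a : Fin 4) :
    ξ * (C.uStar y a + C.nDotT y a) = ψ * C.uL y a := by
  linear_combination h.conformal_u hZ a - ξ * h.nDot_sub_uStar hM a
    - C.nL y a * h.conformal_un hZ + C.uL y a * h.conformal_uu hZ

/-- On the screen, ṅ = u* by Maxwell and u*_a = −u^c n_{c;a} by `curl_of_conformal`. Hence ṅ_a is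
there half of u*_a − u^c n_{c;a}, which is the screen part of σ_ac n^c. The u component is fixed by
ψ = −½ξ(ln H)*. -/
lemma nDot_of_conformal {ξ ψ : ℝ} {x : Fin 4 → ℝ} (hξ : 0 < ξ) (hZ : C.Conformal y ξ ψ x)
    (a : Fin 4) : C.nDot y a = -(1 / 2) * dot l (C.n y) * C.uL y a
      + ∑ f, C.pMix y f a * ∑ c, C.sigma y f c * C.n y c := by
  have h1 := h.curl_of_conformal hM hZ a
  have h2 := h.star_lnH hM
  have h3 := h.factor_exp_of_conformal hZ
  have h4 := h.nDot_sub_uStar hM a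
  have h5 := h.conformal_uu hZ
  rw [sum_pMix]
  simp only [h.sigma_n]
  have e : ∀ v, dot (fun f => (C.uStar y f - C.nDotT y f
      - C.uL y f * dot (C.nDotT y) (C.u y)) / 2 - 1 / 3 * C.divU y * C.nL y f) v
      = (dot (C.uStar y) v - dot (C.nDotT y) v - dot (C.uL y) v * dot (C.nDotT y) (C.u y)) / 2
        - 1 / 3 * C.divU y * dot (C.nL y) v := by
    intro v
    simp only [dot, Fin.sum_univ_four]; ring
  rw [e, e, h.uu, h.nn, h.un, h.nu, h.dot_uStar_u, h.dot_uStar_n]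
  have h6 : ξ * C.nDot y a = ξ * (-(1 / 2) * dot l (C.n y) * C.uL y a
      + ((C.uStar y a - C.nDotT y a - C.uL y a * dot (C.nDotT y) (C.u y)) / 2
        - 1 / 3 * C.divU y * C.nL y a + C.uL y a * ((0 - dot (C.nDotT y) (C.u y)
        - -1 * dot (C.nDotT y) (C.u y)) / 2 - 1 / 3 * C.divU y * 0)
        - C.nL y a * ((-dot (C.nDotT y) (C.n y) - dot (C.nDotT y) (C.n y)
          - 0 * dot (C.nDotT y) (C.u y)) / 2 - 1 / 3 * C.divU y * 1))) := by
    rw [h2] at h3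
    linear_combination ξ * h4 + h1 / 2 - C.uL y a / 2 * h5 + C.uL y a * h3
  exact mul_left_cancel₀ hξ.ne' h6

omit hM in
/-- The kinematic part of the system implies the conformal Killing equation. -/
lemma conformal_of_system {ξ ψ : ℝ} {x : Fin 4 → ℝ}
    (hS : ∀ a b, C.screenShear y a b = 0) (hE : ψ = (1 / 2) * ξ * C.screenExp y)
    (hl : C.screenExp y = -dot l (C.n y))
    (hnDot : ∀ a, C.nDot y a = -(1 / 2) * dot l (C.n y) * C.uL y a
      + ∑ f, C.pMix y f a * ∑ c, C.sigma y f c * C.n y c)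
    (hnStar : ∀ a, ξ * C.nStar y a = ψ * C.nL y a - x a)
    (hN : ∀ a, C.greenberg y a = 0) : C.Conformal y ξ ψ x := by
  have e : ∀ v, dot (fun f => (C.uStar y f - C.nDotT y f
      - C.uL y f * dot (C.nDotT y) (C.u y)) / 2 - 1 / 3 * C.divU y * C.nL y f) v
      = (dot (C.uStar y) v - dot (C.nDotT y) v - dot (C.uL y) v * dot (C.nDotT y) (C.u y)) / 2
        - 1 / 3 * C.divU y * dot (C.nL y) v := by
    intro v
    simp only [dot, Fin.sum_univ_four]; ring
  simp only [sum_pMix, h.sigma_n, e, h.uu, h.nn, h.un, h.nu, h.dot_uStar_u, h.dot_uStar_n] at hnDot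
  have hN' : ∀ a, C.nDot y a - C.uStar y a + C.uL y a * dot (C.nDotT y) (C.u y)
      - C.nL y a * dot (C.nDotT y) (C.n y) = 0 := by
    intro a
    have := hN a
    rw [greenberg, sum_pMix, dot_sub, dot_sub, dot_nDot_u, h.dot_nDot_n, h.dot_uStar_n,
      h.dot_uStar_u] at this
    linear_combination this
  have hnD : ∀ a, C.nDot y a = (-(1 / 2) * dot l (C.n y) - dot (C.nDotT y) (C.u y) / 2) * C.uL y a
      + dot (C.nDotT y) (C.n y) * C.nL y a + (1 / 2) * C.uStar y a - (1 / 2) * C.nDotT y a :=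
    fun a => by linear_combination hnDot a
  -- Contraction with u^a turns the propagation equation into an equation for the uu component
  -- alone.
  have huu : dot (C.nDotT y) (C.u y) = (1 / 2) * dot l (C.n y) := by
    have h1 : dot (C.nDot y) (C.u y) = dot (fun a => _) (C.u y) :=
      congrArg (fun w => dot w (C.u y)) (funext hnD)
    rw [dot_nDot_u, dot_sub, dot_add, dot_add, dot_smul, dot_smul, dot_smul, dot_smul, h.uu, h.nu,
      h.dot_uStar_u] at h1
    linear_combination h1
  -- Twice the propagation equation minus the Greenberg equation eliminates u*_a and leaves ṅ_a +
  -- u^c n_{c;a}, the mixed u component of the Killing equation.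
  have hT : ∀ a, C.nDot y a + C.nDotT y a
      = -dot l (C.n y) * C.uL y a + dot (C.nDotT y) (C.n y) * C.nL y a := by
    intro a
    linear_combination 2 * hnD a - hN' a
  intro a b
  have h1 := hS a b
  rw [h.screenShear_eq] at h1
  simp only [p, Congruences.h] at h1
  rw [hl] at hE h1
  linear_combination 2 * ξ * h1 - ξ * C.uL y b * hT a - ξ * C.uL y a * hT b
    + C.nL y b * hnStar a + C.nL y a * hnStar b - 2 * ξ * C.uL y a * C.uL y b * huu
    + 2 * (C.nL y a * C.nL y b - C.g y a b) * hE

end IsFrame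

end Congruences

/-! ### Vorticity and screen rotation through the volume form -/

/-- The vector `ε^{abcd} T_{bc} w_d`. -/
def dual3 (T : Fin 4 → Fin 4 → ℝ) (w : Fin 4 → ℝ) (a : Fin 4) : ℝ :=
  ∑ b, ∑ c, T b c * vol (unit a) (unit b) (unit c) w

lemma sum_eta (g : Field2) (y : R4) (T : Fin 4 → Fin 4 → ℝ) (w : Fin 4 → ℝ) (a : Fin 4) :
    ∑ b, ∑ c, ∑ d, eta g y a b c d * T b c * w d
      = (Real.sqrt (-(Matrix.of (g y)).det))⁻¹ * dual3 T w a := by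
  simp only [dual3, Finset.mul_sum]
  refine Finset.sum_congr rfl fun b _ => Finset.sum_congr rfl fun c _ => ?_
  conv_rhs => rw [sum_unit w, vol_sum_fourth, Finset.mul_sum, Finset.mul_sum]
  refine Finset.sum_congr rfl fun d _ => ?_
  rw [eta, ← perm_eq, perm]
  ring

lemma dot_dual3 (T : Fin 4 → Fin 4 → ℝ) (w z : Fin 4 → ℝ) :
    ∑ a, z a * dual3 T w a = ∑ b, ∑ c, T b c * vol z (unit b) (unit c) w := by
  simp only [dual3, Finset.mul_sum]
  rw [Finset.sum_comm]
  refine Finset.sum_congr rfl fun b _ => ?_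
  rw [Finset.sum_comm]
  refine Finset.sum_congr rfl fun c _ => ?_
  conv_rhs => rw [sum_unit z, vol_sum_first, Finset.mul_sum]
  exact Finset.sum_congr rfl fun a _ => by ring

/-- The five-index identity `vol_schouten` with z_a n^a = 1 and w_a n^a = 0 splits off the part
along n. The remainder sees T only through its antisymmetric part contracted with n, and vanishes
when that contraction is a multiple of w. -/
lemma dual3_eq {T : Fin 4 → Fin 4 → ℝ} {w z n : Fin 4 → ℝ} (hw : dot w n = 0) (hz : dot z n = 1)
    (a : Fin 4) : dual3 T w a = n a * (∑ b, ∑ c, T b c * vol z (unit b) (unit c) w)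
      + vol (unit a) z (fun c => ∑ b, (T b c - T c b) * n b) w := by
  have hu : ∀ a, dot (unit a) n = n a := fun a => by simp [dot, unit, Pi.single_apply]
  have hS : ∀ b c, vol (unit a) (unit b) (unit c) w = n a * vol z (unit b) (unit c) w
      + n b * vol (unit a) z (unit c) w - n c * vol (unit a) z (unit b) w := by
    intro b c
    have h := vol_schouten n (unit a) (unit b) (unit c) w z
    simp only [← dot.eq_1, hw, hz, hu] at h
    rw [vol_swap_mid (unit a) (unit b) z w] at h
    linear_combination h
  have h1 : vol (unit a) z (fun c => ∑ b, (T b c - T c b) * n b) w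
      = ∑ c, (∑ b, (T b c - T c b) * n b) * vol (unit a) z (unit c) w := by
    rw [← vol_sum_third]
    congr 1
    exact sum_unit _
  rw [h1, dual3]
  simp only [hS, Fin.sum_univ_four]
  ring

namespace Congruences

variable {C : Congruences} {y : R4}

lemma omega_eq (a : Fin 4) : C.omega y a
    = (1 / 2) * ((Real.sqrt (-(Matrix.of (C.g y)).det))⁻¹ * dual3 (C.Du y) (C.uL y) a) := by
  rw [omega, sum_eta]

lemma screenRotVec_eq (a : Fin 4) : C.screenRotVec y a
    = (1 / 2) * ((Real.sqrt (-(Matrix.of (C.g y)).det))⁻¹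
      * dual3 (C.screenRot y) (C.uL y) a) := by
  rw [screenRotVec, sum_eta]

namespace IsFrame

variable (h : C.IsFrame y)
include h

/-- The curl of u_a contracted with n^a is minus u*_a + u^c n_{c;a}, a multiple of u_a by
assumption, so the remainder in `dual3_eq` is a determinant with two proportional entries. -/
lemma vorticity_parallel {k : ℝ} (hk : ∀ a, C.uStar y a + C.nDotT y a = k * C.uL y a) :
    ∃ c : ℝ, ∀ a, C.omega y a = c * C.n y a := by
  refine ⟨(1 / 2) * ((Real.sqrt (-(Matrix.of (C.g y)).det))⁻¹ *
    ∑ b, ∑ c, C.Du y b c * vol (C.nL y) (unit b) (unit c) (C.uL y)), fun a => ?_⟩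
  rw [omega_eq, dual3_eq h.un h.nn]
  have h1 : (fun c => ∑ b, (C.Du y b c - C.Du y c b) * C.n y b) = fun c => -k * C.uL y c := by
    ext c
    simp only [sub_mul, Finset.sum_sub_distrib, h.Du_n]
    have := hk c
    rw [uStar] at this
    linear_combination -this
  have h2 : vol (unit a) (C.nL y) (fun c => -k * C.uL y c) (C.uL y) = 0 := by
    simp only [vol_expand]; ring
  rw [h1, h2]
  ring

/-- The screen rotation is annihilated by n^a, so `dual3_eq` leaves only the part along n. -/
lemma screenRotVec_parallel (a : Fin 4) : C.screenRotVec y a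
    = (1 / 2) * ((Real.sqrt (-(Matrix.of (C.g y)).det))⁻¹
      * ∑ b, ∑ c, C.Dn y b c * vol (unit b) (unit c) (C.nL y) (C.uL y)) * C.n y a := by
  rw [screenRotVec_eq, dual3_eq h.un h.nn]
  have hp : ∀ e, ∑ b, C.pMix y e b * C.n y b = 0 := by
    intro e
    have h1 := h.un
    have h2 := h.nn
    simp only [pMix, hMix, sub_mul, add_mul, Finset.sum_sub_distrib, Finset.sum_add_distrib,
      ite_mul, one_mul, zero_mul, Finset.sum_ite_eq, Finset.mem_univ, if_true]
    simp only [dot, Fin.sum_univ_four] at h1 h2 ⊢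
    linear_combination C.u y e * h1 - C.n y e * h2
  have hanti : ∀ b c, C.screenRot y c b = -C.screenRot y b c := by
    intro b c
    rw [screenRot, screenRot, Finset.sum_comm]
    simp only [← Finset.sum_neg_distrib]
    exact Finset.sum_congr rfl fun _ _ => Finset.sum_congr rfl fun _ _ => by ring
  have hTn : ∀ c, ∑ b, C.screenRot y b c * C.n y b = 0 := by
    intro c
    simp only [screenRot, Finset.sum_mul]
    rw [Finset.sum_comm]
    refine Finset.sum_eq_zero fun e _ => ?_
    rw [Finset.sum_comm]
    refine Finset.sum_eq_zero fun f _ => ?_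
    have := hp e
    calc _ = (∑ b, C.pMix y e b * C.n y b) * (C.pMix y f c * ((C.Dn y e f - C.Dn y f e) / 2)) := by
          rw [Finset.sum_mul]; exact Finset.sum_congr rfl fun _ _ => by ring
      _ = 0 := by rw [this, zero_mul]
  have h1 : (fun c => ∑ b, (C.screenRot y b c - C.screenRot y c b) * C.n y b)
      = fun _ => 0 := by
    ext c
    have : ∀ b, (C.screenRot y b c - C.screenRot y c b) * C.n y b
        = 2 * (C.screenRot y b c * C.n y b) := fun b => by rw [hanti b c]; ring
    simp only [this, ← Finset.mul_sum, hTn, mul_zero]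
  have h2 : vol (unit a) (C.nL y) (fun _ => 0) (C.uL y) = 0 := by
    simp only [vol_expand]; ring
  -- The projectors change a covector by multiples of u_a and n_a, and both of these already occur
  -- in the determinant.
  have hv : ∀ e f, ∑ b, ∑ c, C.pMix y e b * C.pMix y f c
      * vol (C.nL y) (unit b) (unit c) (C.uL y) = vol (C.nL y) (unit e) (unit f) (C.uL y) := by
    intro e f
    have e1 : ∀ e, C.pMix y e = fun b => unit e b + C.u y e * C.uL y b - C.n y e * C.nL y b := by
      intro e; ext b; simp [pMix, hMix, unit, Pi.single_apply, eq_comm]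
    have e2 : ∑ b, ∑ c, C.pMix y e b * C.pMix y f c
        * vol (C.nL y) (unit b) (unit c) (C.uL y)
        = vol (C.nL y) (C.pMix y e) (C.pMix y f) (C.uL y) := by
      conv_rhs => rw [sum_unit (C.pMix y e), vol_sum_second]
      refine Finset.sum_congr rfl fun b _ => ?_
      conv_rhs => rw [sum_unit (C.pMix y f), vol_sum_third, Finset.mul_sum]
      exact Finset.sum_congr rfl fun c _ => by ring
    rw [e2, e1, e1]
    simp only [vol_expand]
    ring
  have h3 : ∑ b, ∑ c, C.screenRot y b c * vol (C.nL y) (unit b) (unit c) (C.uL y)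
      = ∑ e, ∑ f, (C.Dn y e f - C.Dn y f e) / 2 * vol (C.nL y) (unit e) (unit f) (C.uL y) := by
    have e0 : ∀ e f, (C.Dn y e f - C.Dn y f e) / 2 * vol (C.nL y) (unit e) (unit f) (C.uL y)
        = ∑ b, ∑ c, (C.Dn y e f - C.Dn y f e) / 2 * (C.pMix y e b * C.pMix y f c
      * vol (C.nL y) (unit b) (unit c) (C.uL y)) := fun e f => by
      simp only [← Finset.mul_sum, hv]
    simp only [e0, screenRot, Finset.sum_mul]
    have e1 : ∀ F : Fin 4 → Fin 4 → Fin 4 → Fin 4 → ℝ,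
        ∑ b, ∑ c, ∑ e, ∑ f, F b c e f = ∑ e, ∑ f, ∑ b, ∑ c, F b c e f := fun F =>
      (Finset.sum_congr rfl fun b _ => Finset.sum_comm).trans (Finset.sum_comm.trans
        (Finset.sum_congr rfl fun e _ =>
          (Finset.sum_congr rfl fun b _ => Finset.sum_comm).trans Finset.sum_comm))
    rw [e1]
    exact Finset.sum_congr rfl fun _ _ => Finset.sum_congr rfl fun _ _ =>
      Finset.sum_congr rfl fun _ _ => Finset.sum_congr rfl fun _ _ => by ring
  have h4 : ∑ e, ∑ f, (C.Dn y e f - C.Dn y f e) / 2 * vol (C.nL y) (unit e) (unit f) (C.uL y)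
      = ∑ e, ∑ f, C.Dn y e f * vol (unit e) (unit f) (C.nL y) (C.uL y) := by
    have e1 : ∀ e f, vol (C.nL y) (unit e) (unit f) (C.uL y)
        = vol (unit e) (unit f) (C.nL y) (C.uL y) := fun e f => vol_cycle _ _ _ _
    have e2 : ∑ e, ∑ f, C.Dn y f e * vol (unit e) (unit f) (C.nL y) (C.uL y)
        = -∑ e, ∑ f, C.Dn y e f * vol (unit e) (unit f) (C.nL y) (C.uL y) := by
      rw [Finset.sum_comm]
      simp only [← Finset.sum_neg_distrib]
      exact Finset.sum_congr rfl fun e _ => Finset.sum_congr rfl fun f _ => by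
        rw [vol_swap]; ring
    simp only [e1, sub_div, sub_mul, Finset.sum_sub_distrib, div_mul_eq_mul_div,
      ← Finset.sum_div]
    rw [e2]; ring
  rw [h1, h2, h3, h4]
  ring

end IsFrame

end Congruences

/-! ### Components in charts -/

section Charts

variable {M : Type*} [TopologicalSpace M] [ChartedSpace R4 M]
  {e : OpenPartialHomeomorph M R4} (he : e ∈ IsManifold.maximalAtlas (𝓡 4) ∞ M)
  {y : R4} (hy : y ∈ e.target)

include he hy

lemma sum_vecComp (X : ∀ x : M, TangentSpace (𝓡 4) x) :
    X (e.symm y) = ∑ a, vecComp e X y a • coordVec e y a := by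
  have he1 : e ∈ IsManifold.maximalAtlas (𝓡 4) 1 M :=
    IsManifold.maximalAtlas_subset_of_le (by simp) he
  have hd : e.MDifferentiable (𝓡 4) (𝓡 4) :=
    ⟨fun x hx => (mdifferentiableAt_of_mem_maximalAtlas he1 hx).mdifferentiableWithinAt,
      fun x hx => (mdifferentiableAt_symm_of_mem_maximalAtlas he1 hx).mdifferentiableWithinAt⟩
  have hcomp : (mfderiv (𝓡 4) (𝓡 4) e.symm y) (mfderiv (𝓡 4) (𝓡 4) e (e.symm y) (X (e.symm y)))
      = X (e.symm y) := by
    have h := hd.symm_comp_deriv (e.map_target hy)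
    rw [e.right_inv hy] at h
    exact congrArg (fun L => L (X (e.symm y))) h
  have hs : ∀ v : R4, v = ∑ a, v a • EuclideanSpace.single a (1 : ℝ) := by
    intro v
    ext b
    simp [Pi.single_apply]
  conv_lhs => rw [← hcomp, hs (mfderiv (𝓡 4) (𝓡 4) e (e.symm y) (X (e.symm y)))]
  erw [map_sum]
  refine Finset.sum_congr rfl fun a _ => ?_
  exact map_smul (mfderiv (𝓡 4) (𝓡 4) e.symm y) _ _

omit he hy in
lemma vecComp_smul (f : M → ℝ) (X : ∀ x : M, TangentSpace (𝓡 4) x) (y : R4) (a : Fin 4) :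
    vecComp e (fun x => f x • X x) y a = f (e.symm y) * vecComp e X y a := by
  simp only [vecComp]
  rw [map_smul]
  rfl

lemma metric_apply (g : ∀ x : M, LinearMap.BilinForm ℝ (TangentSpace (𝓡 4) x))
    (X Y : ∀ x : M, TangentSpace (𝓡 4) x) :
    g (e.symm y) (X (e.symm y)) (Y (e.symm y))
      = ∑ a, ∑ b, metricComp e g y a b * vecComp e X y a * vecComp e Y y b := by
  rw [sum_vecComp he hy X, sum_vecComp he hy Y]
  simp only [map_sum, map_smul, LinearMap.sum_apply, LinearMap.smul_apply, smul_eq_mul, metricComp,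
    Finset.mul_sum]
  rw [Finset.sum_comm]
  exact Finset.sum_congr rfl fun _ _ => Finset.sum_congr rfl fun _ _ => by ring

/-- In an orthonormal basis B g Bᵀ = diag(−1, 1, 1, 1), hence (det B)² det g = −1. -/
lemma det_metricComp_neg {A : OrientedAtlas M}
    {g : ∀ x : M, LinearMap.BilinForm ℝ (TangentSpace (𝓡 4) x)} (hg : IsLorentzian A g) :
    (Matrix.of (metricComp e g y)).det < 0 := by
  obtain ⟨b, hb⟩ := hg.signature (e.symm y)
  -- Every tangent space is a copy of the model space, so a basis vector at one point extends to a
  -- constant field, of which only the value at that point matters.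
  set B : Matrix (Fin 4) (Fin 4) ℝ := Matrix.of fun i a =>
    vecComp e (fun x => (show TangentSpace (𝓡 4) x from (b i : R4))) y a with hB
  have h : B * Matrix.of (metricComp e g y) * B.transpose
      = Matrix.diagonal fun i => if i = 0 then -1 else 1 := by
    ext i j
    have h1 := metric_apply he hy g (fun x => (show TangentSpace (𝓡 4) x from (b i : R4)))
      (fun x => (show TangentSpace (𝓡 4) x from (b j : R4)))
    have h2 := (hb i j).symm.trans h1
    rw [Matrix.diagonal_apply, h2, Matrix.mul_apply]
    simp only [Matrix.mul_apply, Matrix.transpose_apply, hB, Matrix.of_apply, Finset.sum_mul]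
    rw [Finset.sum_comm]
    exact Finset.sum_congr rfl fun _ _ => Finset.sum_congr rfl fun _ _ => by ring
  have h2 := congrArg Matrix.det h
  rw [Matrix.det_mul, Matrix.det_mul, Matrix.det_transpose, Matrix.det_diagonal] at h2
  have h3 : ∏ i : Fin 4, (if i = 0 then (-1 : ℝ) else 1) = -1 := by
    simp
  rw [h3] at h2
  by_contra hc
  nlinarith [mul_nonneg (mul_self_nonneg B.det) (not_lt.1 hc)]

end Charts

/-- A vector orthogonal to a timelike unit vector is spacelike. -/
lemma spacelike_of_orthogonal {V : Type*} [AddCommGroup V] [Module ℝ V]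
    {g : LinearMap.BilinForm ℝ V} (b : Module.Basis (Fin 4) ℝ V)
    (hb : ∀ i j, g (b i) (b j) = if i = j then (if i = 0 then -1 else 1) else 0)
    {u v : V} (hu : g u u = -1) (hv : g v u = 0) (h0 : v ≠ 0) : 0 < g v v := by
  have key : ∀ v w, g v w = -(b.repr v 0 * b.repr w 0) + b.repr v 1 * b.repr w 1
      + b.repr v 2 * b.repr w 2 + b.repr v 3 * b.repr w 3 := by
    intro v w
    conv_lhs => rw [← b.sum_repr v, ← b.sum_repr w]
    simp only [Fin.sum_univ_four, map_add, map_smul, LinearMap.add_apply, LinearMap.smul_apply,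
      smul_eq_mul, hb, Fin.reduceEq, if_true, if_false]
    ring
  have hne : ∃ i, b.repr v i ≠ 0 := by
    by_contra hc
    push Not at hc
    exact h0 (b.repr.map_eq_zero_iff.1 (Finsupp.ext hc))
  have hne' : 0 < b.repr v 0 ^ 2 + b.repr v 1 ^ 2 + b.repr v 2 ^ 2 + b.repr v 3 ^ 2 := by
    obtain ⟨i, hi⟩ := hne
    have h := pow_pos (abs_pos.2 hi) 2
    rw [sq_abs] at h
    have hs : ∑ i, b.repr v i ^ 2
        = b.repr v 0 ^ 2 + b.repr v 1 ^ 2 + b.repr v 2 ^ 2 + b.repr v 3 ^ 2 := Fin.sum_univ_four _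
    rw [← hs]
    exact h.trans_le (Finset.single_le_sum (f := fun i => b.repr v i ^ 2)
      (fun i _ => sq_nonneg _) (Finset.mem_univ i))
  rw [key] at hu hv ⊢
  generalize b.repr u 0 = u0 at *
  generalize b.repr u 1 = u1 at *
  generalize b.repr u 2 = u2 at *
  generalize b.repr u 3 = u3 at *
  generalize b.repr v 0 = v0 at *
  generalize b.repr v 1 = v1 at *
  generalize b.repr v 2 = v2 at *
  generalize b.repr v 3 = v3 at *
  by_contra hc
  -- If g(v, v) ≤ 0, Cauchy–Schwarz on the spatial parts gives (u0 v0)² ≤ (u0² − 1) v0², so v0 = 0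
  -- and then v = 0.
  have hcs : (u1 * v1 + u2 * v2 + u3 * v3) ^ 2
      ≤ (u1 ^ 2 + u2 ^ 2 + u3 ^ 2) * (v1 ^ 2 + v2 ^ 2 + v3 ^ 2) := by
    linarith [sq_nonneg (u1 * v2 - u2 * v1), sq_nonneg (u1 * v3 - u3 * v1),
      sq_nonneg (u2 * v3 - u3 * v2)]
  have h1 : u1 * v1 + u2 * v2 + u3 * v3 = u0 * v0 := by linarith
  have h2 : u1 ^ 2 + u2 ^ 2 + u3 ^ 2 = u0 ^ 2 - 1 := by linarith
  rw [h1, h2] at hcs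
  have h3 : 0 ≤ u0 ^ 2 - 1 := by rw [← h2]; positivity
  have h4 : v1 ^ 2 + v2 ^ 2 + v3 ^ 2 ≤ v0 ^ 2 := by linarith
  have h5 := mul_le_mul_of_nonneg_left h4 h3
  have h6 : v0 ^ 2 ≤ 0 := by linarith
  linarith

/-! ### The geometry of a metric on an open set of the coordinate space -/

/-- A smooth nondegenerate metric on an open set. -/
structure MetricOn (U : TopologicalSpace.Opens R4) (g : Field2) : Prop where
  smooth : ∀ a b, ContDiffOn ℝ ∞ (fun y => g y a b) U
  symm : ∀ y a b, g y a b = g y b a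
  det_neg : ∀ y ∈ U, (Matrix.of (g y)).det < 0

namespace MetricOn

open smoothFn

variable {U : TopologicalSpace.Opens R4} {g : Field2} (hg : MetricOn U g)

/-- The metric as a matrix over the ring of smooth functions. -/
def mat : Matrix (Fin 4) (Fin 4) (smoothFn U) := Matrix.of fun a b => of _ (hg.smooth a b)

lemma map_mat (y : U) : hg.mat.map (eval y) = Matrix.of (g y) := rfl

lemma eval_det (y : U) : eval y hg.mat.det = (Matrix.of (g y)).det := by
  rw [RingHom.map_det]; rfl

lemma isUnit_det : IsUnit hg.mat.det :=
  isUnit_of_ne_zero fun y => by rw [eval_det]; exact (hg.det_neg y y.2).ne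

/-- Evaluation is a ring homomorphism and right inverses of matrices are unique, so inverting over
the ring and inverting pointwise agree. -/
lemma eval_inv (y : U) (a b : Fin 4) : eval y (hg.mat⁻¹ a b) = inv g y a b := by
  have h : Matrix.of (g y) * (hg.mat⁻¹).map (eval y) = 1 := by
    rw [← hg.map_mat y, ← Matrix.map_mul, Matrix.mul_nonsing_inv _ hg.isUnit_det,
      Matrix.map_one _ (map_zero _) (map_one _)]
  rw [inv, Matrix.inv_eq_right_inv h]
  rfl

lemma mat_symm (a b : Fin 4) : hg.mat a b = hg.mat b a :=
  ext_eval fun y => hg.symm y a b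

lemma inv_symm (a b : Fin 4) : hg.mat⁻¹ a b = hg.mat⁻¹ b a := by
  have h : hg.mat.transpose = hg.mat := by ext a b; rw [Matrix.transpose_apply, mat_symm]
  rw [← Matrix.transpose_apply (hg.mat⁻¹), Matrix.transpose_nonsing_inv, h]

lemma mul_inv (a b : Fin 4) : ∑ c, hg.mat a c * hg.mat⁻¹ c b = if a = b then 1 else 0 := by
  rw [← Matrix.mul_apply, Matrix.mul_nonsing_inv _ hg.isUnit_det, Matrix.one_apply]

/-- The Christoffel symbols as smooth functions. -/
def chris (a b c : Fin 4) : smoothFn U :=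
  (1 / 2 : ℝ) • ∑ d, hg.mat⁻¹ a d * (partialDer U b (hg.mat d c) + partialDer U c (hg.mat d b)
    - partialDer U d (hg.mat b c))

lemma lower_chris (a b c : Fin 4) : ∑ d, hg.mat a d * hg.chris d b c
    = (1 / 2 : ℝ) • (partialDer U b (hg.mat a c) + partialDer U c (hg.mat a b)
      - partialDer U a (hg.mat b c)) := by
  simp only [chris, mul_smul_comm, ← Finset.smul_sum]
  congr 1
  simp only [Finset.mul_sum, ← mul_assoc]
  rw [Finset.sum_comm]
  simp only [← Finset.sum_mul, hg.mul_inv, ite_mul, one_mul, zero_mul, Finset.sum_ite_eq,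
    Finset.mem_univ, if_true]

/-- The geometry of a metric on an open set. -/
def geom : Geom (smoothFn U) where
  D := partialDer U
  G := hg.mat
  I a b := hg.mat⁻¹ a b
  Γ := hg.chris
  comm := partialDer_comm
  G_symm := hg.mat_symm
  I_symm := hg.inv_symm
  inv := hg.mul_inv
  Γ_symm a b c := by
    simp only [chris, hg.mat_symm b c]
    congr 1
    exact Finset.sum_congr rfl fun d _ => by ring
  compat a b c := by
    have h1 := hg.lower_chris b a c
    have h2 := hg.lower_chris a b c
    rw [Finset.sum_add_distrib]
    have e1 : ∑ d, hg.chris d a c * hg.mat d b = ∑ d, hg.mat b d * hg.chris d a c :=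
      Finset.sum_congr rfl fun d _ => by rw [hg.mat_symm d b, mul_comm]
    have e2 : ∑ d, hg.chris d b c * hg.mat a d = ∑ d, hg.mat a d * hg.chris d b c :=
      Finset.sum_congr rfl fun d _ => mul_comm _ _
    rw [e1, e2, h1, h2, ← smul_add, hg.mat_symm b a]
    have e3 : partialDer U a (hg.mat b c) + partialDer U c (hg.mat a b)
        - partialDer U b (hg.mat a c) + (partialDer U b (hg.mat a c) + partialDer U c (hg.mat a b)
        - partialDer U a (hg.mat b c)) = (2 : ℝ) • partialDer U c (hg.mat a b) := by
      rw [two_smul]; ring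
    rw [e3, smul_smul]
    norm_num

/-! The objects of the geometry evaluate to their coordinate expressions. -/

lemma eval_D {f : smoothFn U} {F : R4 → ℝ} (h : ∀ y : U, eval y f = F y) (y : U)
    (a : Fin 4) : eval y (hg.geom.D a f) = pd F y a := eval_partialDer h y a

lemma eval_G (y : U) (a b : Fin 4) : eval y (hg.geom.G a b) = g y a b := rfl

lemma eval_I (y : U) (a b : Fin 4) : eval y (hg.geom.I a b) = inv g y a b := hg.eval_inv y a b

lemma eval_Γ (y : U) (a b c : Fin 4) : eval y (hg.geom.Γ a b c) = christoffel g y a b c := by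
  change eval y (hg.chris a b c) = _
  rw [chris, eval_smul, map_sum, christoffel]
  refine congrArg _ (Finset.sum_congr rfl fun d _ => ?_)
  have h : ∀ a b c, eval y (partialDer U c (hg.mat a b)) = pd (fun z => g z a b) y c :=
    fun a b c => eval_partialDer (fun _ => rfl) y c
  rw [map_mul, map_sub, map_add, hg.eval_inv, h, h, h]

lemma eval_ric (y : U) (a b : Fin 4) : eval y (hg.geom.ric a b) = ricci g y a b := by
  have h : ∀ a b c d, eval y (hg.geom.D d (hg.geom.Γ a b c))
      = pd (fun z => christoffel g z a b c) y d := fun a b c d =>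
    hg.eval_D (F := fun z => christoffel g z a b c) (fun z => hg.eval_Γ z a b c) y d
  simp only [Geom.ric, ricci, map_add, map_sub, map_mul, map_sum, eval_Γ, h]

lemma eval_low {X : Fin 4 → smoothFn U} {X' : Field1} (h : ∀ (y : U) a, eval y (X a) = X' y a)
    (y : U) (a : Fin 4) : eval y (hg.geom.low X a) = lower g X' y a := by
  simp only [Geom.low, lower, map_sum, map_mul, h, eval_G]

lemma eval_cov {w : Fin 4 → smoothFn U} {w' : Field1} (h : ∀ (y : U) a, eval y (w a) = w' y a)
    (y : U) (a b : Fin 4) : eval y (hg.geom.cov w a b) = covD g w' y a b := by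
  simp only [Geom.cov, covD, map_sub, map_sum, map_mul, h, eval_Γ]
  rw [hg.eval_D (F := fun z => w' z a) (fun z => h z a)]

lemma eval_hess {f : smoothFn U} {F : R4 → ℝ} (h : ∀ y : U, eval y f = F y) (y : U)
    (a b : Fin 4) : eval y (hg.geom.hess f a b) = hess g F y a b :=
  hg.eval_cov (w := fun c => hg.geom.D c f) (fun z c => hg.eval_D h z c) y a b

lemma eval_lie2 {X : Fin 4 → smoothFn U} {X' : Field1} (h : ∀ (y : U) a, eval y (X a) = X' y a)
    (y : U) (a b : Fin 4) : eval y (hg.geom.lie2 X hg.geom.G a b) = lieMetric g X' y a b := by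
  have h1 : ∀ c d, eval y (hg.geom.D d (X c)) = pd (fun z => X' z c) y d := fun c d =>
    hg.eval_D (F := fun z => X' z c) (fun z => h z c) y d
  have h2 : ∀ c, eval y (hg.geom.D c (hg.geom.G a b)) = pd (fun z => g z a b) y c := fun c =>
    hg.eval_D (F := fun z => g z a b) (fun z => rfl) y c
  simp only [Geom.lie2, lieMetric, map_sum, map_add, map_mul, h, h1, h2, eval_G]

lemma eval_cov2 {F : Fin 4 → Fin 4 → smoothFn U} {F' : Field2}
    (h : ∀ (y : U) a b, eval y (F a b) = F' y a b) (y : U) (a b c : Fin 4) :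
    eval y (hg.geom.cov2 F a b c) = covD2 g F' y a b c := by
  simp only [Geom.cov2, covD2, map_sub, map_add, map_sum, map_mul, h, eval_Γ]
  rw [hg.eval_D (F := fun z => F' z a b) (fun z => h z a b)]

lemma eval_divUp2 {F : Fin 4 → Fin 4 → smoothFn U} {F' : Field2}
    (h : ∀ (y : U) a b, eval y (F a b) = F' y a b) (y : U) (a : Fin 4) :
    eval y (hg.geom.divUp2 F a) = div2 g F' y a := by
  have h1 : ∀ b c, eval y (hg.geom.D c (F a b)) = pd (fun z => F' z a b) y c := fun b c =>
    hg.eval_D (F := fun z => F' z a b) (fun z => h z a b) y c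
  simp only [Geom.divUp2, div2, map_add, map_sum, map_mul, h, h1, eval_Γ]

end MetricOn

/-! ### Lie derivatives of covectors and of the string-fluid form of the Ricci tensor -/

namespace Geom

variable {R : Type*} [CommRing R] [Algebra ℝ R] (𝔤 : Geom R)

/-- The Lie derivative of a covector field. -/
def lie1 (X w : Fin 4 → R) (a : Fin 4) : R := ∑ c, (X c * 𝔤.D c (w a) + w c * 𝔤.D a (X c))

lemma sum_low_mul_covUp (X Y : Fin 4 → R) (b : Fin 4) :
    ∑ a, 𝔤.low X a * 𝔤.covUp Y a b = ∑ a, 𝔤.cov (𝔤.low Y) a b * X a := by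
  simp only [cov_low, low, Finset.sum_mul]
  rw [Finset.sum_comm]
  exact Finset.sum_congr rfl fun a _ => Finset.sum_congr rfl fun c _ => by
    rw [𝔤.G_symm c a]; ring

lemma lie1_low (X Y : Fin 4 → R) (a : Fin 4) :
    𝔤.lie1 X (𝔤.low Y) a
      = ∑ c, 𝔤.cov (𝔤.low Y) a c * X c + ∑ c, 𝔤.cov (𝔤.low X) c a * Y c := by
  rw [← sum_low_mul_covUp]
  simp only [lie1, cov, covUp, Fin.sum_univ_four]
  simp only [𝔤.Γ_symm _ _ a]
  ring

lemma cov_smul (f : R) (w : Fin 4 → R) (a b : Fin 4) :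
    𝔤.cov (fun c => f * w c) a b = f * 𝔤.cov w a b + 𝔤.D b f * w a := by
  simp only [cov, Derivation.leibniz, smul_eq_mul, Fin.sum_univ_four]
  ring

lemma low_smul (f : R) (X : Fin 4 → R) : 𝔤.low (fun c => f * X c) = fun c => f * 𝔤.low X c := by
  ext a
  simp only [low, Fin.sum_univ_four]
  ring

lemma div_smul (f : R) (X : Fin 4 → R) :
    𝔤.div (fun c => f * X c) = f * 𝔤.div X + ∑ a, X a * 𝔤.D a f := by
  simp only [div, covUp, Derivation.leibniz, smul_eq_mul, Fin.sum_univ_four]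
  ring

/-- Covectors of weight ψ have products of weight 2ψ, the same as the metric; the rest is the
Leibniz rule. -/
lemma lie2_of_form {X w z : Fin 4 → R} {ψ W Q : R} (hX : ∀ a b, 𝔤.lie2 X 𝔤.G a b = 2 * (ψ * 𝔤.G a b))
    (hw : ∀ a, 𝔤.lie1 X w a = ψ * w a) (hz : ∀ a, 𝔤.lie1 X z a = ψ * z a) (a b : Fin 4) :
    𝔤.lie2 X (fun a b => W * (w a * w b - z a * z b) + Q * 𝔤.G a b) a b
      = (∑ c, X c * 𝔤.D c W + 2 * (ψ * W)) * (w a * w b - z a * z b)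
        + (∑ c, X c * 𝔤.D c Q + 2 * (ψ * Q)) * 𝔤.G a b := by
  have h := hX a b
  have wa := hw a
  have wb := hw b
  have za := hz a
  have zb := hz b
  simp only [lie2, lie1, Fin.sum_univ_four, map_add, map_sub, Derivation.leibniz, smul_eq_mul]
    at h wa wb za zb ⊢
  linear_combination Q * h + W * w b * wa + W * w a * wb - W * z b * za - W * z a * zb

/-- The homogeneous Maxwell equations in terms of lowered components. -/
lemma maxwell_low {X Y : Fin 4 → R}
    (h : ∀ a, ∑ b, 𝔤.covUp X a b * Y b + X a * 𝔤.div Y - ∑ b, 𝔤.covUp Y a b * X b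
      - Y a * 𝔤.div X = 0) (a : Fin 4) :
    ∑ b, 𝔤.cov (𝔤.low X) a b * Y b + 𝔤.low X a * 𝔤.div Y - ∑ b, 𝔤.cov (𝔤.low Y) a b * X b
      - 𝔤.low Y a * 𝔤.div X = 0 := by
  have h0 := h 0
  have h1 := h 1
  have h2 := h 2
  have h3 := h 3
  simp only [cov_low, low, Fin.sum_univ_four] at h0 h1 h2 h3 ⊢
  linear_combination 𝔤.G a 0 * h0 + 𝔤.G a 1 * h1 + 𝔤.G a 2 * h2 + 𝔤.G a 3 * h3

end Geom

lemma pd_eq_mul_pd_log {f : R4 → ℝ} {y : R4} (hf : DifferentiableAt ℝ f y) (h0 : f y ≠ 0)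
    (a : Fin 4) : pd f y a = f y * pd (fun z => Real.log (f z)) y a := by
  rw [pd, pd, fderiv.log hf h0]
  simp only [_root_.smul_apply, smul_eq_mul]
  exact (mul_inv_cancel_left₀ h0 _).symm

/-! ### A string fluid in a chart -/

namespace Fluid

variable {M : Type*} [TopologicalSpace M] [ChartedSpace R4 M]

/-- The domain of coordinates of a chart. -/
def dom (e : OpenPartialHomeomorph M R4) : TopologicalSpace.Opens R4 := ⟨e.target, e.open_target⟩

namespace IsEMSF

open smoothFn

variable {A : OrientedAtlas M} {S : Fluid M} (hS : S.IsEMSF A)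
include hS

lemma HH_pos (x : M) : 0 < S.g x (S.Hvec x) (S.Hvec x) := by
  obtain ⟨b, hb⟩ := hS.lorentzian.signature x
  exact spacelike_of_orthogonal b hb (hS.unit_u x) (hS.ortho x) (hS.H_ne_zero x)

lemma H_pos (x : M) : 0 < S.H x := Real.sqrt_pos.2 (hS.HH_pos x)

lemma H_sq (x : M) : S.H x * S.H x = S.g x (S.Hvec x) (S.Hvec x) :=
  Real.mul_self_sqrt (hS.HH_pos x).le

lemma unit_n (x : M) : S.g x (S.n x) (S.n x) = 1 := by
  have h := hS.H_sq x
  have h0 := (hS.H_pos x).ne'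
  simp only [Fluid.n, map_smul, LinearMap.smul_apply, smul_eq_mul, ← h]
  field_simp

lemma ortho_n (x : M) : S.g x (S.n x) (S.u x) = 0 := by
  simp only [Fluid.n, map_smul, LinearMap.smul_apply, smul_eq_mul, hS.ortho, mul_zero]

variable {e : OpenPartialHomeomorph M R4} (he : e ∈ A.charts)
include he

lemma metricOn : MetricOn (dom e) (metricComp e S.g) where
  smooth := hS.lorentzian.smooth e he
  symm _ _ _ := hS.lorentzian.symm _ _ _
  det_neg _ hy := det_metricComp_neg (A.smooth e he) hy hS.lorentzian

/-- The geometry of the chart. -/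
def geom : Geom (smoothFn (dom e)) := (hS.metricOn he).geom

lemma smooth_HH : ContDiffOn ℝ ∞ (scalComp e fun x => S.g x (S.Hvec x) (S.Hvec x)) e.target := by
  refine ContDiffOn.congr (f := fun y => ∑ a, ∑ b, metricComp e S.g y a b * vecComp e S.Hvec y a
    * vecComp e S.Hvec y b) ?_ fun y hy => metric_apply (A.smooth e he) hy S.g S.Hvec S.Hvec
  exact ContDiffOn.sum fun a _ => ContDiffOn.sum fun b _ =>
    ((hS.lorentzian.smooth e he a b).mul (hS.smooth_H e he a)).mul (hS.smooth_H e he b)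

/-- H^a is spacelike and nowhere zero, so the square root is taken of a positive smooth function. -/
lemma smooth_fieldStrength : ContDiffOn ℝ ∞ (scalComp e S.H) e.target :=
  (hS.smooth_HH he).sqrt fun y _ => (hS.HH_pos (e.symm y)).ne'

lemma smooth_n (a : Fin 4) : ContDiffOn ℝ ∞ (fun y => vecComp e S.n y a) e.target := by
  refine ContDiffOn.congr (f := fun y => (scalComp e S.H y)⁻¹ * vecComp e S.Hvec y a) ?_
    fun y _ => vecComp_smul (fun x => (S.H x)⁻¹) S.Hvec y a
  exact ((hS.smooth_fieldStrength he).inv fun y _ => (hS.H_pos (e.symm y)).ne').mul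
    (hS.smooth_H e he a)

/-- The four-velocity as smooth functions on the chart. -/
def fu (a : Fin 4) : smoothFn (dom e) := of (fun y => vecComp e S.u y a) (hS.smooth_u e he a)

/-- The unit vector along the magnetic field as smooth functions on the chart. -/
def fn (a : Fin 4) : smoothFn (dom e) := of (fun y => vecComp e S.n y a) (hS.smooth_n he a)

/-- The magnetic field strength as a smooth function on the chart. -/
def fH : smoothFn (dom e) := of (scalComp e S.H) (hS.smooth_fieldStrength he)

/-- The magnetic field as smooth functions on the chart. -/
def fHvec (a : Fin 4) : smoothFn (dom e) := of (fun y => vecComp e S.Hvec y a) (hS.smooth_H e he a)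

omit he in
lemma Hvec_eq (y : R4) (a : Fin 4) :
    vecComp e S.Hvec y a = scalComp e S.H y * vecComp e S.n y a := by
  have h := vecComp_smul (e := e) (fun x => (S.H x)⁻¹) S.Hvec y a
  have h0 := (hS.H_pos (e.symm y)).ne'
  change vecComp e S.n y a = _ at h
  rw [h, scalComp]
  field_simp

lemma fHvec_eq : hS.fHvec he = fun a => hS.fH he * hS.fn he a :=
  funext fun a => ext_eval fun y => hS.Hvec_eq y a

lemma eval_D {f : smoothFn (dom e)} {F : R4 → ℝ} (h : ∀ y : dom e, eval y f = F y) (y : dom e)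
    (a : Fin 4) : eval y ((hS.geom he).D a f) = pd F y a := (hS.metricOn he).eval_D h y a

lemma eval_uL (y : dom e) (a : Fin 4) :
    eval y ((hS.geom he).low (hS.fu he) a) = (S.congr e).uL y a :=
  (hS.metricOn he).eval_low (X' := vecComp e S.u) (fun _ _ => rfl) y a

lemma eval_nL (y : dom e) (a : Fin 4) :
    eval y ((hS.geom he).low (hS.fn he) a) = (S.congr e).nL y a :=
  (hS.metricOn he).eval_low (X' := vecComp e S.n) (fun _ _ => rfl) y a

lemma eval_Du (y : dom e) (a b : Fin 4) :
    eval y ((hS.geom he).cov ((hS.geom he).low (hS.fu he)) a b) = (S.congr e).Du y a b :=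
  (hS.metricOn he).eval_cov (hS.eval_uL he) y a b

lemma eval_Dn (y : dom e) (a b : Fin 4) :
    eval y ((hS.geom he).cov ((hS.geom he).low (hS.fn he)) a b) = (S.congr e).Dn y a b :=
  (hS.metricOn he).eval_cov (hS.eval_nL he) y a b

lemma eval_divU (y : dom e) : eval y ((hS.geom he).div (hS.fu he)) = (S.congr e).divU y := by
  simp only [Geom.div_eq, map_sum, map_mul, hS.eval_Du he]
  simp only [geom, MetricOn.eval_I]
  rfl

lemma eval_divN (y : dom e) : eval y ((hS.geom he).div (hS.fn he)) = (S.congr e).divN y := by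
  simp only [Geom.div_eq, map_sum, map_mul, hS.eval_Dn he]
  simp only [geom, MetricOn.eval_I]
  rfl

lemma sum_low_mul {X Y : ∀ x : M, TangentSpace (𝓡 4) x} {fX fY : Fin 4 → smoothFn (dom e)}
    (hX : ∀ (y : dom e) a, eval y (fX a) = vecComp e X y a)
    (hY : ∀ (y : dom e) a, eval y (fY a) = vecComp e Y y a) (y : dom e) :
    eval y (∑ a, (hS.geom he).low fX a * fY a)
      = S.g (e.symm y) (X (e.symm y)) (Y (e.symm y)) := by
  have h : ∀ a, eval y ((hS.geom he).low fX a) = lower (metricComp e S.g) (vecComp e X) y a :=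
    (hS.metricOn he).eval_low hX y
  rw [hS.lorentzian.symm, metric_apply (A.smooth e he) y.2]
  simp only [map_sum, map_mul, h, hY, lower, Finset.sum_mul]
  exact Finset.sum_congr rfl fun _ _ => Finset.sum_congr rfl fun _ _ => by ring

lemma uu : ∑ a, (hS.geom he).low (hS.fu he) a * hS.fu he a = -1 := ext_eval fun y => by
  rw [hS.sum_low_mul he (X := S.u) (Y := S.u) (fun _ _ => rfl) fun _ _ => rfl, hS.unit_u]
  simp

lemma nn : ∑ a, (hS.geom he).low (hS.fn he) a * hS.fn he a = 1 := ext_eval fun y => by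
  rw [hS.sum_low_mul he (X := S.n) (Y := S.n) (fun _ _ => rfl) fun _ _ => rfl, hS.unit_n]
  simp

lemma nu : ∑ a, (hS.geom he).low (hS.fn he) a * hS.fu he a = 0 := ext_eval fun y => by
  rw [hS.sum_low_mul he (X := S.n) (Y := S.u) (fun _ _ => rfl) fun _ _ => rfl, hS.ortho_n]
  simp

lemma un : ∑ a, (hS.geom he).low (hS.fu he) a * hS.fn he a = 0 := ext_eval fun y => by
  rw [hS.sum_low_mul he (X := S.u) (Y := S.n) (fun _ _ => rfl) fun _ _ => rfl,
    hS.lorentzian.symm, hS.ortho_n]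
  simp

lemma isFrame {y : R4} (hy : y ∈ e.target) : (S.congr e).IsFrame y := by
  set z : dom e := ⟨y, hy⟩ with hz
  have hm := hS.metricOn he
  -- The contractions of u^a and n^a with each other are constant; their derivatives give the last
  -- three frame relations.
  have hD : ∀ {X Y : Fin 4 → smoothFn (dom e)} {r : ℝ} (b : Fin 4),
      ∑ a, (hS.geom he).low X a * Y a = algebraMap ℝ _ r →
      eval z (∑ a, ((hS.geom he).cov ((hS.geom he).low X) a b * Y a
        + (hS.geom he).cov ((hS.geom he).low Y) a b * X a)) = 0 := by
    intro X Y r b h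
    rw [← Geom.D_contract, h, Derivation.map_algebraMap, map_zero]
  constructor
  · exact hm.symm y
  · intro a b
    have h := congrArg (eval z) (hm.geom.I_symm a b)
    rw [hm.eval_I, hm.eval_I] at h
    exact h
  · intro a b
    have h := congrArg (eval z) (hm.geom.inv a b)
    simp only [map_sum, map_mul, hm.eval_I, hm.eval_G] at h
    rw [show (S.congr e).g = metricComp e S.g from rfl]
    rw [h]
    split_ifs <;> simp
  · have h := congrArg (eval z) (hS.uu he)
    simp only [map_sum, map_mul, hS.eval_uL he, map_neg, map_one] at h
    exact h
  · have h := congrArg (eval z) (hS.nn he)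
    simp only [map_sum, map_mul, hS.eval_nL he, map_one] at h
    exact h
  · have h := congrArg (eval z) (hS.un he)
    simp only [map_sum, map_mul, hS.eval_uL he, map_zero] at h
    exact h
  · have h := congrArg (eval z) (hS.nu he)
    simp only [map_sum, map_mul, hS.eval_nL he, map_zero] at h
    exact h
  · intro b
    have h := hD (r := -1) b (by rw [hS.uu he]; simp)
    simp only [map_sum, map_mul, hS.eval_Du he, ← two_mul, ← Finset.mul_sum] at h
    exact (mul_eq_zero.1 h).resolve_left two_ne_zero
  · intro b
    have h := hD (r := 1) b (by rw [hS.nn he]; simp)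
    simp only [map_sum, map_mul, hS.eval_Dn he, ← two_mul, ← Finset.mul_sum] at h
    exact (mul_eq_zero.1 h).resolve_left two_ne_zero
  · intro b
    have h := hD (r := 0) b (by rw [hS.un he]; simp)
    simp only [map_sum, map_add, map_mul, hS.eval_Dn he, hS.eval_Du he,
      Finset.sum_add_distrib] at h
    exact eq_neg_of_add_eq_zero_left h

lemma pd_lnH {y : R4} (hy : y ∈ e.target) (a : Fin 4) :
    pd (scalComp e S.H) y a = scalComp e S.H y * pd (S.lnH e) y a :=
  pd_eq_mul_pd_log (differentiableAt (U := dom e) (hS.smooth_fieldStrength he) hy)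
    (hS.H_pos (e.symm y)).ne' a

end IsEMSF

end Fluid

open smoothFn

/-- A Lorentzian determinant is negative, so (−det g)^{1/2} and its inverse belong to the ring and η
can be handled there. -/
lemma MetricOn.exists_sqrt {U : TopologicalSpace.Opens R4} {g : Field2} (hg : MetricOn U g) :
    ∃ s r : smoothFn U, s * r = 1 ∧ s * s = -Matrix.det (Matrix.of hg.geom.G) ∧
      ∀ y, eval y r = (Real.sqrt (-(Matrix.of (g y)).det))⁻¹ := by
  have hd : ∀ y : U, eval y (Matrix.det (Matrix.of hg.geom.G)) = (Matrix.of (g y)).det :=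
    hg.eval_det
  generalize Matrix.det (Matrix.of hg.geom.G) = δ at hd
  have hδ : ∀ y ∈ U, extend δ y = (Matrix.of (g y)).det := fun y hy =>
    (extend_apply δ ⟨y, hy⟩).trans (hd ⟨y, hy⟩)
  have hs : ContDiffOn ℝ ∞ (fun y => Real.sqrt (-extend δ y)) U :=
    (contDiffOn_extend δ).neg.sqrt fun y hy => by
      rw [hδ y hy]; exact (neg_pos.2 (hg.det_neg y hy)).ne'
  have hpos : ∀ y ∈ U, 0 < Real.sqrt (-extend δ y) := fun y hy => by
    rw [hδ y hy]; exact Real.sqrt_pos.2 (neg_pos.2 (hg.det_neg y hy))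
  refine ⟨of _ hs, of (fun y => (Real.sqrt (-extend δ y))⁻¹) (hs.inv fun y hy => (hpos y hy).ne'),
    ext_eval fun y => ?_, ext_eval fun y => ?_, fun y => ?_⟩
  · rw [map_mul, map_one, eval_of, eval_of, mul_inv_cancel₀ (hpos y y.2).ne']
  · rw [map_mul, map_neg, eval_of, hd, ← hδ y y.2, Real.mul_self_sqrt]
    rw [hδ y y.2]; exact (neg_pos.2 (hg.det_neg y y.2)).le
  · rw [eval_of, hδ y y.2]

/-! ### Maxwell's equations of the fluid -/

namespace Fluid

variable {M : Type*} [TopologicalSpace M] [ChartedSpace R4 M]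

namespace IsEMSF

variable {A : OrientedAtlas M} {S : Fluid M} (hS : S.IsEMSF A)
  {e : OpenPartialHomeomorph M R4} (he : e ∈ A.charts)
include hS he

lemma eval_HL (y : dom e) (a : Fin 4) :
    eval y ((hS.geom he).low (hS.fHvec he) a) = S.HL e y a :=
  (hS.metricOn he).eval_low (X' := vecComp e S.Hvec) (fun _ _ => rfl) y a

lemma eval_dual {r : smoothFn (dom e)}
    (hr : ∀ y, eval y r = (Real.sqrt (-(Matrix.of (metricComp e S.g y)).det))⁻¹) (y : dom e)
    (a b : Fin 4) : eval y ((hS.geom he).dual r (hS.fHvec he) (hS.fu he) a b) = S.F e y a b := by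
  have hH : ∀ c, eval y ((hS.geom he).low (hS.fHvec he) c)
      = lower (metricComp e S.g) (vecComp e S.Hvec) y c := hS.eval_HL he y
  have hu : ∀ c, eval y ((hS.geom he).low (hS.fu he) c)
      = lower (metricComp e S.g) (vecComp e S.u) y c := hS.eval_uL he y
  simp only [Geom.dual, map_sum, map_mul, hr, map_perm, perm_eq, hH, hu, F, eta]

omit he in
lemma HL_eq (y : R4) (a : Fin 4) : S.HL e y a = scalComp e S.H y * (S.congr e).nL y a := by
  simp only [HL, Congruences.nL, lower, hS.Hvec_eq, Finset.mul_sum]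
  exact Finset.sum_congr rfl fun _ _ => by simp only [Fluid.congr]; ring

/-- The bivector identity for H^a and u^a, with H^a = H n^a substituted and the factor H > 0 divided
out. -/
lemma maxwell {y : R4} (hy : y ∈ e.target) : (S.congr e).Maxwell y (pd (S.lnH e) y) := by
  set z : dom e := ⟨y, hy⟩ with hz
  obtain ⟨s, r, hsr, hss, hr⟩ := (hS.metricOn he).exists_sqrt
  have hF : ∀ (y : dom e) a b, eval y (∑ c, ∑ d, (hS.geom he).G a c * (hS.geom he).G b d
      * (hS.geom he).dual r (hS.fHvec he) (hS.fu he) c d)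
      = lower2 (metricComp e S.g) (S.F e) y a b := by
    intro y a b
    simp only [map_sum, map_mul, hS.eval_dual he hr, lower2]
    rfl
  have h1 := (hS.geom he).maxwell_low ((hS.geom he).maxwell_hom hsr hss
    (X := hS.fHvec he) (Y := hS.fu he) fun a b c => ext_eval fun y => by
      have hc := (hS.metricOn he).eval_cov2 hF y
      change ∀ a b c, eval y ((hS.geom he).cov2 _ a b c) = _ at hc
      rw [map_add, map_add, hc, hc, hc, hS.maxwell_hom e he y y.2, map_zero])
  intro a
  have h2 := congrArg (eval z) (h1 a)
  rw [hS.fHvec_eq he, Geom.low_smul, Geom.div_smul] at h2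
  have hH : ∀ b, eval z ((hS.geom he).D b (hS.fH he)) = scalComp e S.H y * pd (S.lnH e) y b :=
    fun b => (hS.eval_D he (F := scalComp e S.H) (fun _ => rfl) z b).trans (hS.pd_lnH he hy b)
  have eu : ∀ b, eval z (hS.fu he b) = (S.congr e).u y b := fun _ => rfl
  have en : ∀ b, eval z (hS.fn he b) = (S.congr e).n y b := fun _ => rfl
  have eH : eval z (hS.fH he) = scalComp e S.H y := rfl
  simp only [Geom.cov_smul, map_sub, map_add, map_sum, map_mul, map_zero, hH, hS.eval_Dn he,
    hS.eval_Du he, hS.eval_uL he, hS.eval_nL he, hS.eval_divU he, hS.eval_divN he, eu, en, eH] at h2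
  change _ at h2
  have h0 : scalComp e S.H y ≠ 0 := (hS.H_pos (e.symm y)).ne'
  refine (mul_eq_zero.1 (?_ : scalComp e S.H y * _ = 0)).resolve_left h0
  simp only [Congruences.nDot, Congruences.uStar, dot, Fin.sum_univ_four] at h2 ⊢
  linear_combination h2

lemma contract_J {w : Fin 4 → smoothFn (dom e)} (y : dom e) (w' : Field1)
    (hw : ∀ (y : dom e) a, eval y (w a) = w' y a)
    (h0 : ∀ b, vol w (unit b) ((hS.geom he).low (hS.fHvec he)) ((hS.geom he).low (hS.fu he)) = 0) :
    ∑ a, w' y a * vecComp e S.J y a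
      = -((Real.sqrt (-(Matrix.of (metricComp e S.g y)).det))⁻¹
        * ∑ a, ∑ b, vol (unit a) (unit b) (S.HL e y) ((S.congr e).uL y)
          * covD (metricComp e S.g) w' y a b) := by
  obtain ⟨s, r, hsr, hss, hr⟩ := (hS.metricOn he).exists_sqrt
  have h := congrArg (eval y) ((hS.geom he).contract_divUp2_dual (r := r) h0)
  have hv : ∀ a b : Fin 4, eval y (vol (unit a) (unit b) ((hS.geom he).low (hS.fHvec he))
      ((hS.geom he).low (hS.fu he)))
      = vol (unit a) (unit b) (S.HL e y) ((S.congr e).uL y) := by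
    intro a b
    have hu : ∀ i j : Fin 4, eval y (unit i j) = unit i j := by
      intro i j
      simp only [unit, Pi.single_apply]
      split_ifs <;> simp
    simp only [vol_expand, map_add, map_sub, map_mul, hu, hS.eval_HL he, hS.eval_uL he]
  have hd : ∀ a, eval y ((hS.geom he).divUp2 ((hS.geom he).dual r (hS.fHvec he) (hS.fu he)) a)
      = vecComp e S.J y a := fun a =>
    ((hS.metricOn he).eval_divUp2 (hS.eval_dual he hr) y a).trans (hS.maxwell_inhom e he y y.2 a)
  have hc : ∀ a b, eval y ((hS.geom he).cov w a b) = covD (metricComp e S.g) w' y a b :=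
    (hS.metricOn he).eval_cov hw y
  simpa only [map_sum, map_mul, map_neg, hw, hd, hr, hv, hc] using h

/-- The contraction F^{ab}u_{a;b} = η^{abcd}u_{a;b}H_c u_d pairs H_a with the dual of the curl of
u_a. The 2 undoes the ½ in ω^a. -/
lemma charge_eq {y : R4} (hy : y ∈ e.target) :
    S.charge e y = 2 * contract (S.HL e) (S.congr e).omega y := by
  have h := hS.contract_J he ⟨y, hy⟩ (S.congr e).uL (hS.eval_uL he) fun b => by
    simp only [vol_expand]; ring
  rw [charge, contract, h, contract]
  have h1 := dot_dual3 ((S.congr e).Du y) ((S.congr e).uL y) (S.HL e y)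
  have h2 : ∑ a, S.HL e y a * (S.congr e).omega y a
      = (1 / 2) * ((Real.sqrt (-(Matrix.of (metricComp e S.g y)).det))⁻¹
        * ∑ a, S.HL e y a * dual3 ((S.congr e).Du y) ((S.congr e).uL y) a) := by
    simp only [Congruences.omega_eq, Finset.mul_sum]
    exact Finset.sum_congr rfl fun _ _ => by simp only [Fluid.congr]; ring
  rw [h2, h1, neg_neg]
  have h3 : ∑ a, ∑ b, vol (unit a) (unit b) (S.HL e y) ((S.congr e).uL y)
      * covD (metricComp e S.g) (S.congr e).uL y a b
      = ∑ b, ∑ c, (S.congr e).Du y b c * vol (S.HL e y) (unit b) (unit c) ((S.congr e).uL y) :=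
    Finset.sum_congr rfl fun _ _ => Finset.sum_congr rfl fun _ _ => by
      rw [← vol_cycle, mul_comm]; rfl
  rw [← h3]
  ring

/-- Contracting the current with H_a gives −F^{ab}H_{a;b}, which is H² times the twist of n_a; the
screen rotation vector, already known to lie along n^a, is measured by the same twist. -/
lemma rotation {y : R4} (hy : y ∈ e.target) (a : Fin 4) : (S.congr e).screenRotVec y a
    = -(contract (S.HL e) (S.current e) y / (2 * scalComp e S.H y ^ 3)) * vecComp e S.Hvec y a := by
  have hf := hS.isFrame he hy
  have h := hS.contract_J he ⟨y, hy⟩ (S.HL e) (hS.eval_HL he) fun b => by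
    simp only [vol_expand]; ring
  have h0 : scalComp e S.H y ≠ 0 := (hS.H_pos (e.symm y)).ne'
  have hHu : ∑ a, S.HL e y a * (S.congr e).u y a = 0 := by
    simp only [hS.HL_eq, mul_assoc, ← Finset.mul_sum]
    rw [← dot, hf.nu, mul_zero]
  -- The conduction current and J^a differ by a multiple of u^a, which is orthogonal to H_a.
  have hcur : contract (S.HL e) (S.current e) y = ∑ a, S.HL e y a * vecComp e S.J y a := by
    simp only [contract, current, Congruences.hMix, Fin.sum_univ_four] at hHu ⊢
    simp
    linear_combination ((S.congr e).uL y 0 * vecComp e S.J y 0 + (S.congr e).uL y 1 * vecComp e S.J y 1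
      + (S.congr e).uL y 2 * vecComp e S.J y 2 + (S.congr e).uL y 3 * vecComp e S.J y 3) * hHu
  have hcov : ∀ b c, covD (metricComp e S.g) (S.HL e) y b c = scalComp e S.H y
      * (S.congr e).Dn y b c + pd (scalComp e S.H) y c * (S.congr e).nL y b := by
    intro b c
    set z : dom e := ⟨y, hy⟩ with hz
    have h1 : eval z ((hS.geom he).cov ((hS.geom he).low (hS.fHvec he)) b c)
        = covD (metricComp e S.g) (S.HL e) y b c :=
      (hS.metricOn he).eval_cov (hS.eval_HL he) z b c
    rw [← h1, hS.fHvec_eq he, Geom.low_smul, Geom.cov_smul, map_add, map_mul, map_mul,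
      hS.eval_Dn he, hS.eval_nL he, hS.eval_D he (F := scalComp e S.H) (fun _ => rfl)]
    rfl
  have hvol : ∀ b c, vol (unit b) (unit c) (S.HL e y) ((S.congr e).uL y)
      = scalComp e S.H y * vol (unit b) (unit c) ((S.congr e).nL y) ((S.congr e).uL y) := by
    intro b c
    simp only [vol_expand, hS.HL_eq]
    ring
  -- The gradient of the field strength enters H_{a;b} multiplied by n_a, which is already an entry
  -- of the determinant.
  have hz : ∑ b, ∑ c, vol (unit b) (unit c) ((S.congr e).nL y) ((S.congr e).uL y)
      * (pd (scalComp e S.H) y c * (S.congr e).nL y b) = 0 := by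
    rw [Finset.sum_comm]
    refine Finset.sum_eq_zero fun c _ => ?_
    have h1 : vol ((S.congr e).nL y) (unit c) ((S.congr e).nL y) ((S.congr e).uL y) = 0 := by
      simp only [vol_expand]; ring
    rw [sum_unit ((S.congr e).nL y), vol_sum_first, ← sum_unit] at h1
    calc _ = pd (scalComp e S.H) y c * ∑ b, (S.congr e).nL y b
          * vol (unit b) (unit c) ((S.congr e).nL y) ((S.congr e).uL y) := by
          rw [Finset.mul_sum]; exact Finset.sum_congr rfl fun _ _ => by ring
      _ = 0 := by rw [h1, mul_zero]
  have hsum : ∑ b, ∑ c, vol (unit b) (unit c) (S.HL e y) ((S.congr e).uL y)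
      * covD (metricComp e S.g) (S.HL e) y b c = scalComp e S.H y ^ 2 *
        ∑ b, ∑ c, (S.congr e).Dn y b c
          * vol (unit b) (unit c) ((S.congr e).nL y) ((S.congr e).uL y) := by
    have : ∀ b c, vol (unit b) (unit c) (S.HL e y) ((S.congr e).uL y)
        * covD (metricComp e S.g) (S.HL e) y b c = scalComp e S.H y ^ 2 * ((S.congr e).Dn y b c
          * vol (unit b) (unit c) ((S.congr e).nL y) ((S.congr e).uL y))
        + scalComp e S.H y * (vol (unit b) (unit c) ((S.congr e).nL y) ((S.congr e).uL y)
          * (pd (scalComp e S.H) y c * (S.congr e).nL y b)) := fun b c => by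
      rw [hcov, hvol]; ring
    simp only [this, Finset.sum_add_distrib, ← Finset.mul_sum, hz, mul_zero, add_zero]
  rw [hcur, h, hf.screenRotVec_parallel, hsum, hS.Hvec_eq]
  simp only [Fluid.congr]
  field_simp

/-- The conformal Killing equation in a chart. -/
lemma conformal_iff {ξ ψ : M → ℝ} (hξ : SmoothScalar A ξ) {y : R4} (hy : y ∈ e.target) :
    (∀ a b, lieMetric (metricComp e S.g) (vecComp e fun x => ξ x • S.n x) y a b
      = 2 * scalComp e ψ y * metricComp e S.g y a b)
      ↔ (S.congr e).Conformal y (scalComp e ξ y) (scalComp e ψ y) (pd (scalComp e ξ) y) := by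
  set z : dom e := ⟨y, hy⟩ with hz
  set fξ : smoothFn (dom e) := of (scalComp e ξ) (hξ e he) with hfξ
  have h : ∀ a b, lieMetric (metricComp e S.g) (vecComp e fun x => ξ x • S.n x) y a b
      = scalComp e ξ y * ((S.congr e).Dn y a b + (S.congr e).Dn y b a)
        + pd (scalComp e ξ) y a * (S.congr e).nL y b
        + pd (scalComp e ξ) y b * (S.congr e).nL y a := by
    intro a b
    have h1 : eval z ((hS.geom he).lie2 (fun c => fξ * hS.fn he c) (hS.geom he).G a b)
        = lieMetric (metricComp e S.g) (vecComp e fun x => ξ x • S.n x) y a b :=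
      (hS.metricOn he).eval_lie2 (fun y a => (vecComp_smul ξ S.n y a).symm) z a b
    have h2 : ∀ a, eval z ((hS.geom he).D a fξ) = pd (scalComp e ξ) y a :=
      hS.eval_D he (fun _ => rfl) z
    rw [← h1, Geom.lie2_G, Geom.low_smul]
    simp only [Geom.cov_smul, map_add, map_mul, hS.eval_Dn he, hS.eval_nL he, h2]
    change scalComp e ξ y * _ + _ + (scalComp e ξ y * _ + _) = _
    ring
  simp only [h]
  rfl

end IsEMSF

end Fluid

/-! ### Components of the conservation law and of the Lie-differentiated Ricci tensor -/

namespace Congruences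

variable {C : Congruences} {y : R4}

lemma along_eq (X : Field1) (f : R4 → ℝ) (y : R4) : along X f y = dot (pd f y) (X y) :=
  Finset.sum_congr rfl fun _ _ => mul_comm _ _

namespace IsFrame

variable (h : C.IsFrame y)
include h

lemma lower_pMix (V : Fin 4 → ℝ) (a : Fin 4) :
    ∑ b, C.g y a b * ∑ c, C.pMix y b c * V c
      = ∑ c, C.pMix y c a * ∑ b, C.g y c b * V b := by
  have h1 : ∀ b, ∑ c, C.pMix y b c * V c
      = V b + C.u y b * dot (C.uL y) V - C.n y b * dot (C.nL y) V := by
    intro b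
    simp only [pMix, hMix, sub_mul, add_mul, Finset.sum_sub_distrib, Finset.sum_add_distrib, dot,
      Finset.mul_sum, ite_mul, one_mul, zero_mul, Finset.sum_ite_eq, Finset.mem_univ, if_true,
      mul_assoc]
  have h2 : ∀ X : Fin 4 → ℝ, dot (fun c => ∑ b, C.g y c b * V b) X
      = dot (fun c => ∑ b, C.g y c b * X b) V := by
    intro X
    simp only [dot, Finset.sum_mul]
    rw [Finset.sum_comm]
    exact Finset.sum_congr rfl fun a _ => Finset.sum_congr rfl fun b _ => by rw [h.symm a b]; ring
  have h3 : C.uL y a = ∑ b, C.g y a b * C.u y b := rfl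
  have h4 : C.nL y a = ∑ b, C.g y a b * C.n y b := rfl
  have h5 : dot (fun c => ∑ b, C.g y c b * V b) (C.u y) = dot (C.uL y) V := h2 _
  have h6 : dot (fun c => ∑ b, C.g y c b * V b) (C.n y) = dot (C.nL y) V := h2 _
  rw [sum_pMix, h5, h6]
  simp only [h1, h3, h4, Fin.sum_univ_four]
  ring

/-- The propagation equation of `n^a` along `u^a` in terms of lowered components. -/
lemma raise_nDot_iff (k : ℝ) :
    (∀ a, raise C.g C.nDot y a = k * C.u y a
      + ∑ b, C.pMix y a b * raise C.g (fun z d => ∑ c, C.sigma z d c * C.n z c) y b)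
      ↔ ∀ a, C.nDot y a = k * C.uL y a + ∑ f, C.pMix y f a * ∑ c, C.sigma y f c * C.n y c := by
  refine (h.raise_eq_iff (C.nDot y) _).trans (forall_congr' fun a => ?_)
  have h1 : ∑ b, C.g y a b * (k * C.u y b
      + ∑ f, C.pMix y b f * raise C.g (fun z d => ∑ c, C.sigma z d c * C.n z c) y f)
      = k * C.uL y a + ∑ f, C.pMix y f a * ∑ c, C.sigma y f c * C.n y c := by
    simp only [mul_add, Finset.sum_add_distrib, h.lower_pMix]
    congr 1
    · simp only [uL, lower, Finset.mul_sum]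
      exact Finset.sum_congr rfl fun _ _ => by ring
    · simp only [raise, h.lower_raise]
  rw [h1]

/-- The curvature of the integral curves of `n^a` in terms of lowered components. -/
lemma raise_nStar_iff (k : ℝ) (w : Field1) :
    (∀ a, raise C.g C.nStar y a = k * C.n y a - raise C.g w y a)
      ↔ ∀ a, C.nStar y a = k * C.nL y a - w y a := by
  refine (h.raise_eq_iff (C.nStar y) _).trans (forall_congr' fun a => ?_)
  have h1 : ∑ b, C.g y a b * (k * C.n y b - raise C.g w y b) = k * C.nL y a - w y a := by
    simp only [mul_sub, Finset.sum_sub_distrib, raise, h.lower_raise]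
    congr 1
    simp only [nL, lower, Finset.mul_sum]
    exact Finset.sum_congr rfl fun _ _ => by ring
  rw [h1]

section Conservation

variable {P Q : Fin 4 → ℝ} {W : ℝ} (hc : ∀ a, Q a - (P a + Q a)
  = (dot (fun b => P b + Q b) (C.u y) + W * C.divU y) * C.uL y a + W * C.uDot y a
    - (dot (fun b => P b + Q b) (C.n y) + W * C.divN y) * C.nL y a - W * C.nStar y a)
include hc

lemma conservation_screen (a : Fin 4) :
    ∑ b, C.pMix y b a * (P b + W * (C.uDot y b - C.nStar y b)) = 0 := by
  have h1 : ∀ b, P b + W * (C.uDot y b - C.nStar y b)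
      = (dot (fun b => P b + Q b) (C.n y) + W * C.divN y) * C.nL y b
        - (dot (fun b => P b + Q b) (C.u y) + W * C.divU y) * C.uL y b := fun b => by
    linear_combination -hc b
  simp only [h1]
  rw [sum_pMix, dot_sub, dot_sub, dot_smul, dot_smul, dot_smul, dot_smul, h.uu, h.un, h.nu, h.nn]
  ring

variable {l : Fin 4 → ℝ} (hM : C.Maxwell y l)
include hM

/-- In the u component the derivative of P cancels. The remaining factor of W, u^a_{;a} + n^a u^c
n_{c;a}, is −(ln H)˙ by the induction law. -/
lemma conservation_dot : dot Q (C.u y) = W * dot l (C.u y) := by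
  have h1 := congrArg (fun w => dot w (C.u y)) (funext hc)
  simp only [dot_sub, dot_add, dot_smul, h.uu, h.nu, h.dot_uDot_u, dot_nStar_u] at h1
  rw [h.dot_lnH hM]
  linear_combination h1

/-- Along n^a the derivative of P cancels likewise, and the factor of W is the screen expansion E =
−(ln H)*. -/
lemma conservation_star : dot Q (C.n y) = W * dot l (C.n y) := by
  have h1 := congrArg (fun w => dot w (C.n y)) (funext hc)
  simp only [dot_sub, dot_add, dot_smul, h.nn, h.un, h.dot_uDot_n, h.dot_nStar_n] at h1
  have h2 := h.star_lnH hM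
  rw [h.screenExp_eq] at h2
  linear_combination h1 - W * h2

end Conservation

section Hessian

variable {K : Fin 4 → Fin 4 → ℝ} {s t : ℝ}
  (hK : ∀ a b, -2 * K a b - C.g y a b * ∑ c, ∑ d, inv C.g y c d * K c d
    = s * (C.uL y a * C.uL y b - C.nL y a * C.nL y b) + t * C.g y a b)
include hK

/-- In dimension four the trace of the left side is −6 times that of K, and the trace of the right
side is −2s + 4t. -/
lemma trace_of_lie_ric : 3 * ∑ a, ∑ b, inv C.g y a b * K a b = s - 2 * t := by
  have h1 : ∑ a, ∑ b, inv C.g y a b * (-2 * K a b - C.g y a b * ∑ c, ∑ d, inv C.g y c d * K c d)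
      = ∑ a, ∑ b, inv C.g y a b * (s * (C.uL y a * C.uL y b - C.nL y a * C.nL y b)
        + t * C.g y a b) := by simp only [hK]
  generalize hk : ∑ c, ∑ d, inv C.g y c d * K c d = k at h1 ⊢
  have h2 := h.trace_g
  have h3 : ∑ a, ∑ b, inv C.g y a b * (C.uL y a * C.uL y b) = -1 :=
    (h.trace_mul (C.uL y) (C.u y)).trans h.uu
  have h4 : ∑ a, ∑ b, inv C.g y a b * (C.nL y a * C.nL y b) = 1 :=
    (h.trace_mul (C.nL y) (C.n y)).trans h.nn
  simp only [Fin.sum_univ_four] at h1 h2 h3 h4 hk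
  linear_combination -h1 / 2 - hk + (-k / 2 - t / 2) * h2 - s / 2 * h3 + s / 2 * h4

lemma hess_nn_of_lie_ric : ∑ a, ∑ b, K a b * C.n y a * C.n y b
    = ∑ a, ∑ b, inv C.g y a b * K a b + t / 2 := by
  have h0 := h.trace_of_lie_ric hK
  have h1 : ∑ a, ∑ b, (-2 * K a b - C.g y a b * ∑ c, ∑ d, inv C.g y c d * K c d)
        * C.n y a * C.n y b
      = ∑ a, ∑ b, (s * (C.uL y a * C.uL y b - C.nL y a * C.nL y b)
        + t * C.g y a b) * C.n y a * C.n y b := by simp only [hK]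
  generalize ∑ c, ∑ d, inv C.g y c d * K c d = k at h0 h1 ⊢
  have h2 : ∑ a, ∑ b, C.g y a b * C.n y a * C.n y b = 1 := by
    rw [← h.nn]
    simp only [dot, nL, lower, Finset.sum_mul]
    exact Finset.sum_congr rfl fun _ _ => Finset.sum_congr rfl fun _ _ => by ring
  have h3 : ∑ a, ∑ b, (C.uL y a * C.uL y b - C.nL y a * C.nL y b) * C.n y a * C.n y b = -1 := by
    calc _ = dot (C.uL y) (C.n y) ^ 2 - dot (C.nL y) (C.n y) ^ 2 := by
          simp only [dot, Fin.sum_univ_four]; ring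
      _ = -1 := by rw [h.un, h.nn]; ring
  simp only [Fin.sum_univ_four] at h1 h2 h3 ⊢
  linear_combination -h1 / 2 - s / 2 * h3 - t / 2 * h2 - k / 2 * h2 - h0 / 2

lemma hess_uu_of_lie_ric : ∑ a, ∑ b, K a b * C.u y a * C.u y b
    = -∑ a, ∑ b, inv C.g y a b * K a b - t / 2 := by
  have h0 := h.trace_of_lie_ric hK
  have h1 : ∑ a, ∑ b, (-2 * K a b - C.g y a b * ∑ c, ∑ d, inv C.g y c d * K c d)
        * C.u y a * C.u y b
      = ∑ a, ∑ b, (s * (C.uL y a * C.uL y b - C.nL y a * C.nL y b)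
        + t * C.g y a b) * C.u y a * C.u y b := by simp only [hK]
  generalize ∑ c, ∑ d, inv C.g y c d * K c d = k at h0 h1 ⊢
  have h2 : ∑ a, ∑ b, C.g y a b * C.u y a * C.u y b = -1 := by
    rw [← h.uu]
    simp only [dot, uL, lower, Finset.sum_mul]
    exact Finset.sum_congr rfl fun _ _ => Finset.sum_congr rfl fun _ _ => by ring
  have h3 : ∑ a, ∑ b, (C.uL y a * C.uL y b - C.nL y a * C.nL y b) * C.u y a * C.u y b = 1 := by
    calc _ = dot (C.uL y) (C.u y) ^ 2 - dot (C.nL y) (C.u y) ^ 2 := by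
          simp only [dot, Fin.sum_univ_four]; ring
      _ = 1 := by rw [h.uu, h.nu]; ring
  simp only [Fin.sum_univ_four] at h1 h2 h3 ⊢
  linear_combination -h1 / 2 - s / 2 * h3 - t / 2 * h2 - k / 2 * h2 + h0 / 2

/-- The screen trace is the full trace plus the uu component minus the nn component, all known from
contractions of the same equation. -/
lemma trace_screen_of_lie_ric : ∑ a, ∑ b, C.pUp y a b * K a b
    = -∑ a, ∑ b, inv C.g y a b * K a b - t := by
  have hv : ∀ v : Fin 4 → ℝ, dot (fun a => dot (K a) v) v = ∑ a, ∑ b, K a b * v a * v b := by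
    intro v
    simp only [dot, Finset.sum_mul]
    exact Finset.sum_congr rfl fun _ _ => Finset.sum_congr rfl fun _ _ => by ring
  rw [sum_pUp, hv, hv, h.hess_uu_of_lie_ric hK, h.hess_nn_of_lie_ric hK]
  ring

/-- The Hessian in terms of its screen trace and its component along `n^a`. -/
lemma hess_of_lie_ric (a b : Fin 4) : K a b
    = -(∑ a, ∑ b, K a b * C.n y a * C.n y b) * (C.uL y a * C.uL y b - C.nL y a * C.nL y b)
      + (1 / 2) * (∑ a, ∑ b, C.pUp y a b * K a b) * C.p y a b := by
  have h1 := hK a b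
  have h2 := h.trace_of_lie_ric hK
  rw [h.trace_screen_of_lie_ric hK, h.hess_nn_of_lie_ric hK, p, Congruences.h]
  generalize ∑ c, ∑ d, inv C.g y c d * K c d = k at *
  linear_combination -h1 / 2 + (C.uL y a * C.uL y b - C.nL y a * C.nL y b) / 2 * h2

end Hessian

end IsFrame

end Congruences

open smoothFn Congruences

/-! ### Einstein's equations and conservation in a chart -/

namespace Fluid

variable {M : Type*} [TopologicalSpace M] [ChartedSpace R4 M]

namespace IsEMSF

variable {A : OrientedAtlas M} {S : Fluid M} (hS : S.IsEMSF A)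
  {e : OpenPartialHomeomorph M R4} (he : e ∈ A.charts)
include hS he

/-- The energy density as a smooth function on the chart. -/
def frho : smoothFn (dom e) := of (scalComp e S.rho) (hS.smooth_rho e he)

/-- The transverse pressure as a smooth function on the chart. -/
def fpPerp : smoothFn (dom e) := of (scalComp e S.pPerp) (hS.smooth_pPerp e he)

/-- `p_⊥ + λH²/2 - Λ` as a smooth function on the chart. -/
def fP : smoothFn (dom e) :=
  hS.fpPerp he + (1 / 2 * S.lam) • (hS.fH he * hS.fH he) - algebraMap ℝ _ S.Lam

/-- `ρ + λH²/2 + Λ` as a smooth function on the chart. -/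
def fQ : smoothFn (dom e) :=
  hS.frho he + (1 / 2 * S.lam) • (hS.fH he * hS.fH he) + algebraMap ℝ _ S.Lam

lemma eval_fP (y : dom e) : eval y (hS.fP he) = scalComp e (fun x => S.q x - S.Lam) y := by
  change scalComp e S.pPerp y + 1 / 2 * S.lam * (scalComp e S.H y * scalComp e S.H y) - S.Lam
    = S.q (e.symm y) - S.Lam
  rw [q, ← pow_two]
  rfl

lemma eval_fQ (y : dom e) : eval y (hS.fQ he) = S.muTot (e.symm y) + S.Lam := by
  change scalComp e S.rho y + 1 / 2 * S.lam * (scalComp e S.H y * scalComp e S.H y) + S.Lam = _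
  rw [muTot, ← pow_two]
  rfl

lemma eval_D_fQ {y : R4} (hy : y ∈ e.target) (a : Fin 4) :
    eval (U := dom e) ⟨y, hy⟩ ((hS.geom he).D a (hS.fQ he))
      = pd (scalComp e S.rho) y a + S.lam * scalComp e S.H y ^ 2 * pd (S.lnH e) y a := by
  have h1 := hS.eval_D he (F := scalComp e S.H) (f := hS.fH he) (fun _ => rfl) ⟨y, hy⟩ a
  have h2 := hS.eval_D he (F := scalComp e S.rho) (f := hS.frho he) (fun _ => rfl) ⟨y, hy⟩ a
  have h3 : eval (U := dom e) ⟨y, hy⟩ (hS.fH he) = scalComp e S.H y := rfl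
  simp only [fQ, map_add, Derivation.map_smul, Derivation.leibniz, Derivation.map_algebraMap,
    eval_smul, smul_eq_mul, map_mul, map_zero, h1, h2, h3, hS.pd_lnH he hy]
  ring

/-- Substitute p_ab = g_ab + u_a u_b − n_a n_b and trace T = 2q − 2μ, where q = p_⊥ + ½λH² and μ = ρ
+ ½λH². The coefficient of g_ab becomes μ + Λ, that of u_a u_b − n_a n_b becomes μ + q, and Λ
cancels in the latter. -/
lemma ric_eq (a b : Fin 4) : (hS.geom he).ric a b
    = (hS.fP he + hS.fQ he) * ((hS.geom he).low (hS.fu he) a * (hS.geom he).low (hS.fu he) b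
        - (hS.geom he).low (hS.fn he) a * (hS.geom he).low (hS.fn he) b)
      + hS.fQ he * (hS.geom he).G a b := ext_eval fun y => by
  have hf := hS.isFrame he y.2
  have h1 : eval y ((hS.geom he).ric a b) = ricci (metricComp e S.g) y a b :=
    (hS.metricOn he).eval_ric y a b
  have hG : eval y ((hS.geom he).G a b) = (S.congr e).g y a b := rfl
  have ht := hf.trace_g
  have hu : ∑ a, ∑ b, inv (S.congr e).g y a b * ((S.congr e).uL y a * (S.congr e).uL y b) = -1 :=
    (hf.trace_mul _ ((S.congr e).u y)).trans hf.uu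
  have hn : ∑ a, ∑ b, inv (S.congr e).g y a b * ((S.congr e).nL y a * (S.congr e).nL y b) = 1 :=
    (hf.trace_mul _ ((S.congr e).n y)).trans hf.nn
  have hT : ∀ c d, S.T e y c d = (scalComp e S.muTot y + scalComp e S.q y)
      * ((S.congr e).uL y c * (S.congr e).uL y d - (S.congr e).nL y c * (S.congr e).nL y d)
      + scalComp e S.q y * (S.congr e).g y c d := fun c d => by
    simp only [T, p, Congruences.h]; ring
  have htr : ∑ c, ∑ d, inv (metricComp e S.g) y c d * S.T e y c d
      = 2 * scalComp e S.q y - 2 * scalComp e S.muTot y := by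
    change ∑ c, ∑ d, inv (S.congr e).g y c d * S.T e y c d = _
    simp only [hT, Fin.sum_univ_four] at ht hu hn ⊢
    linear_combination (scalComp e S.muTot y + scalComp e S.q y) * (hu - hn)
      + scalComp e S.q y * ht
  rw [h1, hS.einstein e he y y.2, htr, hT]
  simp only [map_add, map_sub, map_mul, hS.eval_uL he, hS.eval_nL he, hG, hS.eval_fP he,
    hS.eval_fQ he]
  change _ + _ * (S.congr e).g y a b = _
  simp only [scalComp]
  ring

lemma conservation {y : R4} (hy : y ∈ e.target) (a : Fin 4) :
    let C := S.congr e
    let P := pd (scalComp e fun x => S.q x - S.Lam) y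
    let Q := fun a => pd (scalComp e S.rho) y a + S.lam * scalComp e S.H y ^ 2 * pd (S.lnH e) y a
    let W := scalComp e S.rho y + scalComp e S.pPerp y + S.lam * scalComp e S.H y ^ 2
    Q a - (P a + Q a) = (dot (fun b => P b + Q b) (C.u y) + W * C.divU y) * C.uL y a
      + W * C.uDot y a - (dot (fun b => P b + Q b) (C.n y) + W * C.divN y) * C.nL y a
      - W * C.nStar y a := by
  intro C P Q W
  set z : dom e := ⟨y, hy⟩ with hz
  have h1 := congrArg (eval z)
    ((hS.geom he).conservation (hS.uu he) (hS.nn he) (hS.ric_eq he) a)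
  have hP : ∀ a, eval z ((hS.geom he).D a (hS.fP he)) = P a :=
    hS.eval_D he (hS.eval_fP he) z
  have hQ : ∀ a, eval z ((hS.geom he).D a (hS.fQ he)) = Q a := hS.eval_D_fQ he hy
  have hW : eval z (hS.fP he) + eval z (hS.fQ he) = W := by
    rw [hS.eval_fP he, hS.eval_fQ he]
    simp only [W, scalComp, q, muTot]
    ring
  have eu : ∀ b, eval z (hS.fu he b) = C.u y b := fun _ => rfl
  have en : ∀ b, eval z (hS.fn he b) = C.n y b := fun _ => rfl
  simp only [map_sub, map_add, map_mul, map_sum, hP, hQ, hW, eu, en, hS.eval_uL he, hS.eval_nL he,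
    hS.eval_divU he, hS.eval_divN he, hS.eval_Du he, hS.eval_Dn he] at h1
  have e1 : ∀ v : Fin 4 → ℝ, dot (fun b => P b + Q b) v = ∑ b, v b * (P b + Q b) := fun v =>
    Finset.sum_congr rfl fun _ _ => mul_comm _ _
  rw [e1, e1]
  exact h1

end IsEMSF

end Fluid

open smoothFn Congruences

/-! ### The system and the conformal Killing equation -/

namespace Fluid

variable {M : Type*} [TopologicalSpace M] [ChartedSpace R4 M]

namespace IsEMSF

variable {A : OrientedAtlas M} {S : Fluid M} (hS : S.IsEMSF A)
  {e : OpenPartialHomeomorph M R4} (he : e ∈ A.charts)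
include hS he

omit hS in
lemma pd_scal_eq {ξ : M → ℝ} (hξ : SmoothScalar A ξ) (hξ_pos : ∀ x, 0 < ξ x) {y : R4}
    (hy : y ∈ e.target) (a : Fin 4) : pd (scalComp e ξ) y a
      = scalComp e ξ y * pd (scalComp e fun x => Real.log (ξ x)) y a :=
  pd_eq_mul_pd_log (differentiableAt (U := dom e) (hξ e he) hy) (hξ_pos _).ne' a

/-- In Q˙ = W(ln H)˙ the magnetic terms λH²(ln H)˙ on the two sides cancel. -/
lemma energy_dot {y : R4} (hy : y ∈ e.target) : along (S.congr e).u (scalComp e S.rho) y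
    - (scalComp e S.rho y + scalComp e S.pPerp y) * along (S.congr e).u (S.lnH e) y = 0 := by
  have h := (hS.isFrame he hy).conservation_dot (hS.conservation he hy) (hS.maxwell he hy)
  rw [dot_add, dot_smul] at h
  rw [along_eq, along_eq]
  linear_combination h

lemma energy_star {y : R4} (hy : y ∈ e.target) : along (S.congr e).n (scalComp e S.rho) y
    - (scalComp e S.rho y + scalComp e S.pPerp y) * along (S.congr e).n (S.lnH e) y = 0 := by
  have h := (hS.isFrame he hy).conservation_star (hS.conservation he hy) (hS.maxwell he hy)
  rw [dot_add, dot_smul] at h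
  rw [along_eq, along_eq]
  linear_combination h

section Forward

variable {ξ ψ : M → ℝ} (hξ : SmoothScalar A ξ)
  (hC : IsCKV A S.g (fun x => ξ x • S.n x) ψ)
include hξ hC

lemma conformal {y : R4} (hy : y ∈ e.target) :
    (S.congr e).Conformal y (scalComp e ξ y) (scalComp e ψ y) (pd (scalComp e ξ) y) :=
  (hS.conformal_iff he hξ hy).1 (hC e he y hy)

/-- The Hessian of the conformal factor and the Lie derivative of the Ricci tensor. -/
lemma lie_ric {y : R4} (hy : y ∈ e.target) (a b : Fin 4) :
    let C := S.congr e
    let x := scalComp e ξ y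
    let p := scalComp e (fun x => S.q x - S.Lam) y
    let r := dot (pd (S.lnH e) y) (C.n y)
    let p' := dot (pd (scalComp e fun x => S.q x - S.Lam) y) (C.n y);
    -2 * hess C.g (scalComp e ψ) y a b
        - C.g y a b * ∑ c, ∑ d, inv C.g y c d * hess C.g (scalComp e ψ) y c d
      = (x * p') * (C.uL y a * C.uL y b - C.nL y a * C.nL y b)
        + (x * (p * r)) * C.g y a b := by
  intro C x p r p'
  set z : dom e := ⟨y, hy⟩ with hz
  set fξ : smoothFn (dom e) := of (scalComp e ξ) (hξ e he) with hfξ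
  -- ψ is not assumed smooth. The Killing equation forces ψ = ξ*, and this smooth expression
  -- represents it in the ring.
  set fψ : smoothFn (dom e) := ∑ c, hS.fn he c * (hS.geom he).D c fξ with hfψ
  have eu : ∀ (z : dom e) b, eval z (hS.fu he b) = (S.congr e).u z b := fun _ _ => rfl
  have en : ∀ (z : dom e) b, eval z (hS.fn he b) = (S.congr e).n z b := fun _ _ => rfl
  have eξ : ∀ z : dom e, eval z fξ = scalComp e ξ z := fun _ => rfl
  have eDξ : ∀ (z : dom e) c, eval z ((hS.geom he).D c fξ) = pd (scalComp e ξ) z c := fun z c =>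
    hS.eval_D he eξ z c
  have eψ : ∀ z : dom e, eval z fψ = scalComp e ψ z := fun z => by
    rw [← (hS.isFrame he z.2).factor_star_of_conformal (hS.conformal he hξ hC z.2)]
    simp only [hfψ, map_sum, map_mul, eDξ, en, dot]
    exact Finset.sum_congr rfl fun _ _ => mul_comm _ _
  set X : Fin 4 → smoothFn (dom e) := fun c => fξ * hS.fn he c with hX
  have hconf : ∀ a b, (hS.geom he).lie2 X (hS.geom he).G a b = 2 * (fψ * (hS.geom he).G a b) := by
    intro a b
    refine ext_eval fun z => ?_
    have h1 : eval z ((hS.geom he).lie2 X (hS.geom he).G a b)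
        = lieMetric (metricComp e S.g) (vecComp e fun x => ξ x • S.n x) z a b :=
      (hS.metricOn he).eval_lie2 (fun y a => (vecComp_smul ξ S.n y a).symm) z a b
    rw [h1, hC e he z z.2, map_mul, map_mul, eψ, map_ofNat, mul_assoc]
    rfl
  -- L u_a = ψ u_a uses Maxwell's equations through `curl_of_conformal`; the analogous statement for
  -- n_a needs the Killing equation only.
  have hu : ∀ a, (hS.geom he).lie1 X ((hS.geom he).low (hS.fu he)) a
      = fψ * (hS.geom he).low (hS.fu he) a := by
    intro a
    refine ext_eval fun z => ?_
    have h1 := (hS.isFrame he z.2).curl_of_conformal (hS.maxwell he z.2)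
      (hS.conformal he hξ hC z.2) a
    have h2 := (hS.isFrame he z.2).nu
    rw [Geom.lie1_low, hX, Geom.low_smul]
    simp only [Geom.cov_smul, map_add, map_sum, map_mul, eψ, hS.eval_Du he, hS.eval_Dn he,
      hS.eval_uL he, hS.eval_nL he, eu, en, eξ, eDξ]
    simp only [uStar, nDotT, dot, Fin.sum_univ_four] at h1 h2 ⊢
    linear_combination h1 + pd (scalComp e ξ) z a * h2
  have hn : ∀ a, (hS.geom he).lie1 X ((hS.geom he).low (hS.fn he)) a
      = fψ * (hS.geom he).low (hS.fn he) a := by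
    intro a
    refine ext_eval fun z => ?_
    have h1 := (hS.isFrame he z.2).nStar_of_conformal (hS.conformal he hξ hC z.2) a
    have h2 := (hS.isFrame he z.2).nn
    have h3 := (hS.isFrame he z.2).Dn_n a
    rw [Geom.lie1_low, hX, Geom.low_smul]
    simp only [Geom.cov_smul, map_add, map_sum, map_mul, eψ, hS.eval_Dn he, hS.eval_nL he, en, eξ,
      eDξ]
    simp only [nStar, dot, Fin.sum_univ_four] at h1 h2 h3 ⊢
    linear_combination h1 + pd (scalComp e ξ) z a * h2 + scalComp e ξ z * h3
  have h1 := (Geom.lie2_of_form (hS.geom he) (W := hS.fP he + hS.fQ he) (Q := hS.fQ he) hconf hu hn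
    a b).symm
  rw [← funext fun a => funext fun b => hS.ric_eq he a b,
    Geom.lie2_ric_of_conformal hconf] at h1
  have h2 := (congrArg (eval z) h1).symm
  have hP : ∀ a, eval z ((hS.geom he).D a (hS.fP he)) = pd (scalComp e fun x => S.q x - S.Lam) y a :=
    hS.eval_D he (hS.eval_fP he) z
  have hh : ∀ a b, eval z ((hS.geom he).hess fψ a b) = hess C.g (scalComp e ψ) y a b :=
    (hS.metricOn he).eval_hess eψ z
  have hI : ∀ a b, eval z ((hS.geom he).I a b) = inv C.g y a b := (hS.metricOn he).eval_I z
  have hG : eval z ((hS.geom he).G a b) = C.g y a b := rfl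
  have hD : ∀ a, eval z ((hS.geom he).D a (hS.fQ he))
      = pd (scalComp e S.rho) y a + S.lam * scalComp e S.H y ^ 2 * pd (S.lnH e) y a :=
    hS.eval_D_fQ he hy
  have hW : p + eval z (hS.fQ he)
      = scalComp e S.rho y + scalComp e S.pPerp y + S.lam * scalComp e S.H y ^ 2 := by
    rw [hS.eval_fQ he]
    simp only [p, scalComp, q, muTot]
    ring
  have hf := hS.isFrame he hy
  have hQ := hf.conservation_star (hS.conservation he hy) (hS.maxwell he hy)
  have hk := hf.factor_exp_of_conformal (hS.conformal he hξ hC hy)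
  rw [hf.star_lnH (hS.maxwell he hy)] at hk
  have hs : ∀ v : Fin 4 → ℝ, ∑ c, scalComp e ξ y * (S.congr e).n y c * v c = x * dot v (C.n y) :=
    fun v => by
      rw [dot, Finset.mul_sum]
      exact Finset.sum_congr rfl fun _ _ => by ring
  simp only [hX, Geom.box, map_sub, map_add, map_mul, map_neg, map_sum, map_ofNat, hP, hh, hI, hG,
    hD, hS.eval_fP he, eψ, eξ, en, hS.eval_uL he, hS.eval_nL he] at h2
  rw [← hW] at hQ
  change _ = _ * (C.uL y a * C.uL y b - C.nL y a * C.nL y b) + _ at h2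
  rw [hs, hs, dot_add, hQ] at h2
  change scalComp e ψ y = 1 / 2 * x * -r at hk
  change _ = (x * (p' + (p + eval z (hS.fQ he)) * r) + 2 * (scalComp e ψ y * (p + eval z (hS.fQ he)))) * _
    + (x * ((p + eval z (hS.fQ he)) * r) + 2 * (scalComp e ψ y * eval z (hS.fQ he))) * _ at h2
  -- Since 2ψ = −ξ(ln H)* and Q* = W(ln H)*, the coefficients X(W) + 2ψW and X(Q) + 2ψQ reduce to
  -- ξP* and ξP(ln H)*.
  linear_combination h2 + (2 * (p + eval z (hS.fQ he)) * (C.uL y a * C.uL y b - C.nL y a * C.nL y b)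
    + 2 * eval z (hS.fQ he) * C.g y a b) * hk

lemma systemAt (hξ_pos : ∀ x, 0 < ξ x) {y : R4} (hy : y ∈ e.target) :
    S.SystemAt ξ ψ e (S.congr e) y := by
  have hf := hS.isFrame he hy
  have hM := hS.maxwell he hy
  have hZ := hS.conformal he hξ hC hy
  have hx : 0 < scalComp e ξ y := hξ_pos _
  have hK := hS.lie_ric he hξ hC hy
  have hα := hf.trace_screen_of_lie_ric hK
  have hγ := hf.hess_nn_of_lie_ric hK
  have h3 := hf.trace_of_lie_ric hK
  exact
  { energy_dot := hS.energy_dot he hy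
    energy_star := hS.energy_star he hy
    momentum := hf.conservation_screen (hS.conservation he hy)
    hessian := hf.hess_of_lie_ric hK
    field_one := by
      have h1 : along (S.congr e).n (scalComp e fun x => (S.q x - S.Lam) * S.H x) y
          = scalComp e S.H y * (dot (pd (scalComp e fun x => S.q x - S.Lam) y) ((S.congr e).n y)
            + scalComp e (fun x => S.q x - S.Lam) y
              * dot (pd (S.lnH e) y) ((S.congr e).n y)) := by
        have h2 : ∀ a, pd (scalComp e fun x => (S.q x - S.Lam) * S.H x) y a
            = scalComp e S.H y * (pd (scalComp e fun x => S.q x - S.Lam) y a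
              + scalComp e (fun x => S.q x - S.Lam) y * pd (S.lnH e) y a) := by
          intro a
          have e1 : ∀ z : dom e, eval z (hS.fP he * hS.fH he)
              = scalComp e (fun x => (S.q x - S.Lam) * S.H x) z := fun z => by
            rw [map_mul, hS.eval_fP he]; rfl
          have e2 := hS.eval_D he (hS.eval_fP he) ⟨y, hy⟩ a
          have e3 := hS.eval_D he (F := scalComp e S.H) (f := hS.fH he) (fun _ => rfl) ⟨y, hy⟩ a
          have e4 : eval (U := dom e) ⟨y, hy⟩ (hS.fH he) = scalComp e S.H y := rfl
          rw [← hS.eval_D he e1 ⟨y, hy⟩ a, Derivation.leibniz, smul_eq_mul, smul_eq_mul, map_add,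
            map_mul, map_mul, e2, e3, e4, hS.eval_fP he, hS.pd_lnH he hy]
          ring
        rw [along_eq, funext h2, dot_smul, dot_add, dot_smul]
      -- With s = ξP* and t = ξP(ln H)*, the trace relation 3□ψ = s − 2t gives α_ψ = −(s + t)/3,
      -- while [PH]* = H(s + t)/ξ.
      rw [h1, alphaOf, hα]
      field_simp
      linear_combination -scalComp e S.H y * h3
    field_two := by
      -- The d'Alembertian cancels in γ_ψ + α_ψ = −t/2.
      rw [alphaOf, gammaOf, hα, hγ, along_eq]
      field_simp
      ring
    shear := hf.screenShear_of_conformal hx hZ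
    expansion := by rw [hf.star_lnH hM, along_eq]
    n_dot := by
      rw [along_eq]
      exact (hf.raise_nDot_iff _).2 (hf.nDot_of_conformal hM hx hZ)
    n_star := (hf.raise_nStar_iff _ _).2 fun a => by
      have h1 := pd_scal_eq he hξ hξ_pos hy
      have h2 := hf.nStar_of_conformal hZ a
      rw [← hf.factor_star_of_conformal hZ, funext h1, dot_smul] at h2
      rw [along_eq]
      exact mul_left_cancel₀ hx.ne' (h2.trans (by ring))
    greenberg := hf.greenberg_eq_zero hM
    shear_nn := (hf.sigma_nn hM).trans (along_eq _ _ _).symm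
    charge_eq := hS.charge_eq he hy
    rotation := hS.rotation he hy
    factor_exp := hf.factor_exp_of_conformal hZ
    factor_star := (hf.factor_star_of_conformal hZ).symm.trans (along_eq _ _ _).symm }

lemma vorticity (hξ_pos : ∀ x, 0 < ξ x) {y : R4} (hy : y ∈ e.target) :
    ∃ c : ℝ, ∀ a, (S.congr e).omega y a = c * vecComp e S.Hvec y a := by
  have hx : scalComp e ξ y ≠ 0 := (hξ_pos _).ne'
  have h0 : scalComp e S.H y ≠ 0 := (hS.H_pos (e.symm y)).ne'
  obtain ⟨c, hc⟩ := (hS.isFrame he hy).vorticity_parallel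
    (k := scalComp e ψ y / scalComp e ξ y) fun a => by
      have h1 := (hS.isFrame he hy).curl_of_conformal (hS.maxwell he hy)
        (hS.conformal he hξ hC hy) a
      field_simp
      linear_combination h1
  refine ⟨c / scalComp e S.H y, fun a => ?_⟩
  rw [hc, hS.Hvec_eq]
  field_simp
  rfl

lemma factor {y : R4} (hy : y ∈ e.target) :
    scalComp e ψ y = (1 / 2) * scalComp e ξ y * (S.congr e).screenExp y ∧
      scalComp e ψ y = -(1 / 2) * scalComp e ξ y * along (S.congr e).n (S.lnH e) y := by
  have h1 := (hS.isFrame he hy).factor_exp_of_conformal (hS.conformal he hξ hC hy)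
  have h2 := (hS.isFrame he hy).star_lnH (hS.maxwell he hy)
  refine ⟨h1, ?_⟩
  rw [along_eq, h1, h2]
  ring

end Forward

/-- After lowering indices and passing from ln ξ to ξ, the kinematic equations of the system are the
inputs of `conformal_of_system`; ψ = ξ* turns the coefficient ξ(ln ξ)* of n_a into ψ. -/
lemma conformal_of_systemAt {ξ ψ : M → ℝ} (hξ : SmoothScalar A ξ) (hξ_pos : ∀ x, 0 < ξ x) {y : R4}
    (hy : y ∈ e.target) (h : S.SystemAt ξ ψ e (S.congr e) y) :
    (S.congr e).Conformal y (scalComp e ξ y) (scalComp e ψ y) (pd (scalComp e ξ) y) := by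
  have hf := hS.isFrame he hy
  have h1 := pd_scal_eq he hξ hξ_pos hy
  refine hf.conformal_of_system (l := pd (S.lnH e) y) h.shear h.factor_exp
    (h.expansion.trans (by rw [along_eq])) ((hf.raise_nDot_iff _).1 fun a => ?_) (fun a => ?_)
    h.greenberg
  · rw [← along_eq]
    exact h.n_dot a
  · have h2 := (hf.raise_nStar_iff _ _).1 h.n_star a
    rw [h.factor_star, h2, along_eq, along_eq, funext h1, dot_smul]
    ring

end IsEMSF

end Fluid

end EMSF

end

theorem mainTheorem1 {M : Type*} [TopologicalSpace M] [ChartedSpace EMSF.R4 M]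
    [IsManifold (modelWithCornersSelf ℝ EMSF.R4) (⊤ : ℕ∞) M]
    (A : EMSF.OrientedAtlas M) (S : EMSF.Fluid M) (hS : S.IsEMSF A)
    (ξ : M → ℝ) (hξ : EMSF.SmoothScalar A ξ) (hξ_pos : ∀ x, 0 < ξ x) (ψ : M → ℝ) :
    (EMSF.IsCKV A S.g (fun x => ξ x • S.n x) ψ ↔ S.System A ξ ψ) ∧
    (EMSF.IsCKV A S.g (fun x => ξ x • S.n x) ψ →
      S.VorticityParallel A ∧ S.FactorFormula A ξ ψ) := by
  refine ⟨⟨fun hC e he y hy => hS.systemAt he hξ hC hξ_pos hy, fun h e he y hy =>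
    (hS.conformal_iff he hξ hy).2 (hS.conformal_of_systemAt he hξ hξ_pos hy (h e he y hy))⟩,
    fun hC => ⟨fun e he y hy => hS.vorticity he hξ hC hξ_pos hy,
      fun e he y hy => hS.factor he hξ hC hy⟩⟩
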